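/- **Setting.** Let $D$ be a (smooth, real) $2n$-dimensional Lie group whose Lie algebra $\mathcal D$ carries a non-degenerate symmetric invariant bilinear form $\langle\cdot|\cdot\rangle$ (invariance: $\langle[X,Y]|Z\rangle+\langle Y|[X,Z]\rangle=0$) and two subalgebras $\mathcal G,\hat{\mathcal G}$ with $\mathcal D=\mathcal G\oplus\hat{\mathcal G}$ and $\langle\mathcal G|\mathcal G\rangle=\langle\hat{\mathcal G}|\hat{\mathcal G}\rangle=0$. Let $J$ (resp. $\hat J$) be the projector onto $\mathcal G$ along $\hat{\mathcal G}$ (resp. onto $\hat{\mathcal G}$ along $\mathcal G$). Let $R:\hat{\mathcal G}\to\mathcal G$ be linear and let $R^*:\hat{\mathcal G}\to\mathcal G$ be its adjoint, $\langle R\gamma|\delta\rangle=\langle\gamma|R^*\delta\rangle$. Put $$\mathcal R=\{\gamma+R\gamma:\gamma\in\hat{\mathcal G}\},\qquad \mathcal R^\perp=\{\gamma-R^*\gamma:\gamma\in\hat{\mathcal G}\},\qquad \mathcal F=\{\gamma+R\gamma:\gamma\in\mathrm{Ker}(R+R^*)\},$$ and let $\mathcal F^\perp$ be the orthogonal complement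 of $\mathcal F$ in $\mathcal D$. There are linear maps $\alpha_\pm:\mathcal F^\perp\to\hat{\mathcal G}$ with $X=\alpha_+(X)+\alpha_-(X)+R\alpha_+(X)-R^*\alpha_-(X)$ for all $X\in\mathcal F^\perp$, and $$K(X)=2\langle\alpha_+(X)|R\alpha_+(X)\rangle+2\langle\alpha_-(X)|R\alpha_-(X)\rangle\qquad(X\in\mathcal F^\perp)$$ does not depend on their choice. The world-sheet is $\mathbb R^2$ with coordinates $(\sigma,\tau)$. The fields are smooth maps $l:\mathbb R^2\to D$ and $\Lambda:\mathbb R^2\to\mathcal F$; the constraint imposed by the Lagrange multiplier $\Lambda$ is $\partial_\sigma l\,l^{-1}\in\mathcal F^\perp$ everywhere. Let $b=d^{-1}\langle\theta\wedge[\theta\wedge\theta]\rangle$ be any smooth 2-form on $D$ with $db=\langle\theta\wedge[\theta\wedge\theta]\rangle$, where $\theta$ is the right-invariant Maurer–Cartan form and $[\theta\wedge\theta](X,Y)=2[\theta(X),\theta(Y)]$. On a measurable region $W\subseteq\mathbb R^2$, oriented by $d\sigma\wedge d\tau$, the first-order action of fields satisfying the constraint is $$\mathcal S_W(l,\Lambda)=\frac12\int_W\Big(\langle\partial_\tau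 l\,l^{-1}|\partial_\sigma l\,l^{-1}\rangle+\tfrac16\,d^{-1}\langle dl\,l^{-1}\wedge[dl\,l^{-1}\wedge dl\,l^{-1}]\rangle+K(\partial_\sigma l\,l^{-1})+\langle\Lambda|\partial_\sigma l\,l^{-1}\rangle\Big).$$ **Theorem 3 (standard dressing cosets, gauge symmetry).** Assume that $\mathrm{Ker}R=\mathrm{Ker}R^*=0$, that $\mathcal F$ is a Lie subalgebra of $\mathcal D$, that $F$ is a connected Lie subgroup of $D$ with Lie algebra $\mathcal F$, and that, as operators on $\mathcal D$ ($R$ being extended by $0$ on $\mathcal G$), $$J\,\mathrm{Ad}_f\hat J+J[\mathrm{Ad}_f,R]\hat J=R\,\mathrm{Ad}_fR\qquad\text{for all }f\in F.$$ Then: 1. $\mathrm{Ad}_f\mathcal R=\mathcal R$ and $\mathrm{Ad}_f\mathcal R^\perp=\mathcal R^\perp$ for all $f\in F$. 2. For all $f\in F$ and $X\in\mathcal F^\perp$ one has $\mathrm{Ad}_fX\in\mathcal F^\perp$ and $K(\mathrm{Ad}_fX)=K(X)$. 3. The first-order action is gauge invariant with gauge group $F$. For every smooth $f:\mathbb R^2\to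 F$, the transformation $$l\mapsto fl,\qquad \Lambda\mapsto f\Lambda f^{-1}-\partial_\tau f\,f^{-1}$$ maps smooth fields ($l$ in $D$, $\Lambda$ in $\mathcal F$) to smooth fields and preserves the constraint. If moreover $f=1$ outside a compact set, then for every choice of $b$ as above, every measurable $W\subseteq\mathbb R^2$ containing the (closed) support of $f$, and all fields satisfying the constraint for which the integral $\mathcal S_W(l,\Lambda)$ converges, the integral $\mathcal S_W(fl,f\Lambda f^{-1}-\partial_\tau f\,f^{-1})$ converges and equals $\mathcal S_W(l,\Lambda)$. For the same $f$, $b$ and $W$, the functional $$\int_W\Big(\tfrac12\langle\partial_\tau l\,l^{-1}|\partial_\sigma l\,l^{-1}\rangle+\tfrac1{12}\,d^{-1}\langle dl\,l^{-1}\wedge[dl\,l^{-1}\wedge dl\,l^{-1}]\rangle+\langle\Lambda|\partial_\sigma l\,l^{-1}\rangle\Big)$$ is invariant in the same sense even for fields that do not satisfy the constraint. -/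

import Mathlib

open scoped Manifold ContDiff
open MeasureTheory

noncomputable section

/-! ### The algebra of a Drinfeld double -/

/-- The structure of the Lie algebra of a Drinfeld double: a non-degenerate symmetric invariant
bilinear form and two complementary isotropic subalgebras (which are then automatically of
half dimension). -/
structure DoubleAlgebra (𝔡 : Type*) [LieRing 𝔡] [LieAlgebra ℝ 𝔡] where
  /-- the bilinear form `⟨·|·⟩` -/
  form : LinearMap.BilinForm ℝ 𝔡
  symm : form.IsSymm
  nondeg : form.Nondegenerate
  invariant : ∀ X Y Z : 𝔡, form ⁅X, Y⁆ Z + form Y ⁅X, Z⁆ = 0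
  /-- the subalgebra `𝒢` -/
  g : LieSubalgebra ℝ 𝔡
  /-- the subalgebra `𝒢̂` -/
  gHat : LieSubalgebra ℝ 𝔡
  isCompl : IsCompl g.toSubmodule gHat.toSubmodule
  isotropic_g : ∀ X ∈ g, ∀ Y ∈ g, form X Y = 0
  isotropic_gHat : ∀ X ∈ gHat, ∀ Y ∈ gHat, form X Y = 0

namespace DoubleAlgebra

section Algebra

variable {𝔡 : Type*} [LieRing 𝔡] [LieAlgebra ℝ 𝔡] (S : DoubleAlgebra 𝔡)

/-- `𝒢` as a linear subspace. -/
abbrev G : Submodule ℝ 𝔡 := S.g.toSubmodule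

/-- `𝒢̂` as a linear subspace. -/
abbrev GHat : Submodule ℝ 𝔡 := S.gHat.toSubmodule

/-- The projector `J` onto `𝒢` with kernel `𝒢̂`. -/
def J : 𝔡 →ₗ[ℝ] 𝔡 := S.G.projection S.GHat S.isCompl

/-- The projector `Ĵ` onto `𝒢̂` with kernel `𝒢`. -/
def JHat : 𝔡 →ₗ[ℝ] 𝔡 := S.GHat.projection S.G S.isCompl.symm

/-- An operator `R : 𝒢̂ → 𝒢`, regarded as the operator `R Ĵ` on the whole algebra. -/
def extend (R : S.GHat →ₗ[ℝ] S.G) : 𝔡 →ₗ[ℝ] 𝔡 :=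
  S.G.subtype ∘ₗ R ∘ₗ S.GHat.projectionOnto S.G S.isCompl.symm

theorem exists_add (X : 𝔡) : ∃ (x : S.G) (a : S.GHat), X = (a : 𝔡) + (x : 𝔡) := by
  obtain ⟨u, v, h, -⟩ := Submodule.existsUnique_add_of_isCompl S.isCompl X
  exact ⟨u, v, by rw [← h, add_comm]⟩

/-- The map `𝒢 → 𝒢̂*`, `y ↦ ⟨·|y⟩`. -/
def toDual : S.G →ₗ[ℝ] Module.Dual ℝ S.GHat where
  toFun y := (S.form (y : 𝔡)).domRestrict S.GHat
  map_add' _ _ := by ext; simp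
  map_smul' _ _ := by ext; simp

/-- The map `𝒢̂ → 𝒢*`, `a ↦ ⟨·|a⟩`. -/
def toDualHat : S.GHat →ₗ[ℝ] Module.Dual ℝ S.G where
  toFun y := (S.form (y : 𝔡)).domRestrict S.G
  map_add' _ _ := by ext; simp
  map_smul' _ _ := by ext; simp

theorem toDual_injective : Function.Injective S.toDual := by
  rw [injective_iff_map_eq_zero]
  intro y hy
  apply Subtype.ext
  apply S.nondeg.1 (y : 𝔡)
  intro X
  obtain ⟨x, a, rfl⟩ := S.exists_add X
  have h1 : S.form y a = 0 := congrArg (fun φ => φ a) hy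
  rw [map_add, h1, S.isotropic_g _ y.2 _ x.2, add_zero]

theorem toDualHat_injective : Function.Injective S.toDualHat := by
  rw [injective_iff_map_eq_zero]
  intro y hy
  apply Subtype.ext
  apply S.nondeg.1 (y : 𝔡)
  intro X
  obtain ⟨x, a, rfl⟩ := S.exists_add X
  have h1 : S.form y x = 0 := congrArg (fun φ => φ x) hy
  rw [map_add, h1, S.isotropic_gHat _ y.2 _ a.2, add_zero]

variable [FiniteDimensional ℝ 𝔡]

theorem toDual_bijective : Function.Bijective S.toDual := by
  refine ⟨S.toDual_injective, ?_⟩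
  have h1 := LinearMap.finrank_le_finrank_of_injective S.toDual_injective
  have h2 := LinearMap.finrank_le_finrank_of_injective S.toDualHat_injective
  rw [Subspace.dual_finrank_eq] at h1 h2
  exact (LinearMap.injective_iff_surjective_of_finrank_eq_finrank
    (by rw [Subspace.dual_finrank_eq]; omega)).1 S.toDual_injective

/-- The adjoint `R* : 𝒢̂ → 𝒢` of `R : 𝒢̂ → 𝒢` with respect to the bilinear form. -/
def adjoint (R : S.GHat →ₗ[ℝ] S.G) : S.GHat →ₗ[ℝ] S.G :=
  (LinearEquiv.ofBijective S.toDual S.toDual_bijective).symm.toLinearMap ∘ₗ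
    { toFun := fun a => ((S.form (a : 𝔡)).domRestrict S.G) ∘ₗ R
      map_add' := fun _ _ => by ext; simp
      map_smul' := fun _ _ => by ext; simp }

theorem form_adjoint (R : S.GHat →ₗ[ℝ] S.G) (a c : S.GHat) :
    S.form (R c : 𝔡) (a : 𝔡) = S.form (c : 𝔡) (S.adjoint R a : 𝔡) := by
  have h : S.toDual (S.adjoint R a) = ((S.form (a : 𝔡)).domRestrict S.G) ∘ₗ R :=
    (LinearEquiv.ofBijective S.toDual S.toDual_bijective).apply_symm_apply _
  have h2 : S.form (S.adjoint R a : 𝔡) c = S.form a (R c) := congrArg (fun φ => φ c) h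
  rw [S.symm.eq, ← h2, S.symm.eq]

/-- The subspace `ℛ = {γ + Rγ : γ ∈ 𝒢̂}`. -/
def rSpace (R : S.GHat →ₗ[ℝ] S.G) : Submodule ℝ 𝔡 :=
  LinearMap.range (S.GHat.subtype + S.G.subtype ∘ₗ R)

/-- The subspace `ℛ^⊥ = {γ - R*γ : γ ∈ 𝒢̂}`. -/
def rPerp (R : S.GHat →ₗ[ℝ] S.G) : Submodule ℝ 𝔡 :=
  LinearMap.range (S.GHat.subtype - S.G.subtype ∘ₗ S.adjoint R)

/-- The subspace `ℱ = {γ + Rγ : γ ∈ Ker (R + R*)}`. -/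
def fSpace (R : S.GHat →ₗ[ℝ] S.G) : Submodule ℝ 𝔡 :=
  (LinearMap.ker (R + S.adjoint R)).map (S.GHat.subtype + S.G.subtype ∘ₗ R)

/-- The orthogonal complement `ℱ^⊥`. -/
def fPerp (R : S.GHat →ₗ[ℝ] S.G) : Submodule ℝ 𝔡 :=
  LinearMap.BilinForm.orthogonal S.form (S.fSpace R)

/-- The map `(α, β) ↦ α + β + Rα - R*β`. -/
def combine (R : S.GHat →ₗ[ℝ] S.G) : S.GHat × S.GHat →ₗ[ℝ] 𝔡 :=
  (S.GHat.subtype + S.G.subtype ∘ₗ R).coprod (S.GHat.subtype - S.G.subtype ∘ₗ S.adjoint R)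

theorem combine_apply (R : S.GHat →ₗ[ℝ] S.G) (a c : S.GHat) :
    S.combine R (a, c) = (a : 𝔡) + c + R a - S.adjoint R c := by
  simp [combine]; abel

theorem range_combine (R : S.GHat →ₗ[ℝ] S.G) : LinearMap.range (S.combine R) = S.fPerp R := by
  have hrefl : S.form.IsRefl := S.symm.isRefl
  apply le_antisymm
  · rintro _ ⟨⟨a, c⟩, rfl⟩
    rintro _ ⟨γ, hγ, rfl⟩
    have hk : (R γ : 𝔡) + S.adjoint R γ = 0 := by
      have := congrArg (Subtype.val) (LinearMap.mem_ker.1 hγ)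
      simpa using this
    have e1 := S.form_adjoint R γ a
    have e2 := S.form_adjoint R c γ
    have e3 : S.form (a : 𝔡) (R γ : 𝔡) + S.form (a : 𝔡) (S.adjoint R γ : 𝔡) = 0 := by
      rw [← map_add, hk, map_zero]
    have i1 := S.isotropic_gHat _ γ.2 _ a.2
    have i2 := S.isotropic_gHat _ γ.2 _ c.2
    have i3 := S.isotropic_g _ (R γ).2 _ (R a).2
    have i4 := S.isotropic_g _ (R γ).2 _ (S.adjoint R c).2
    have s1 := S.symm.eq (γ : 𝔡) (R a : 𝔡)
    have s2 := S.symm.eq (R γ : 𝔡) (a : 𝔡)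
    rw [combine_apply]
    change S.form ((γ : 𝔡) + R γ) ((a : 𝔡) + c + R a - S.adjoint R c) = 0
    simp only [LinearMap.add_apply, map_add, map_sub, i1, i2, i3, i4]
    linarith
  · rw [← LinearMap.BilinForm.orthogonal_orthogonal S.nondeg hrefl (LinearMap.range (S.combine R))]
    apply LinearMap.BilinForm.orthogonal_le
    intro Y hY
    obtain ⟨y, w, rfl⟩ := S.exists_add Y
    have hY' : ∀ a c : S.GHat, S.form (S.combine R (a, c)) ((w : 𝔡) + y) = 0 :=
      fun a c => hY _ ⟨(a, c), rfl⟩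
    have key : ∀ z : S.G, (∀ a : S.GHat, S.form (a : 𝔡) (z : 𝔡) = 0) → z = 0 := by
      intro z hz
      apply S.toDual_injective
      rw [map_zero]
      ext a
      change S.form (z : 𝔡) a = 0
      rw [S.symm.eq]
      exact hz a
    have h1 : y + S.adjoint R w = 0 := by
      apply key
      intro a
      have := hY' a 0
      rw [combine_apply] at this
      have i1 := S.isotropic_gHat _ a.2 _ w.2
      have i2 := S.isotropic_g _ (R a).2 _ y.2
      have e := S.form_adjoint R w a
      simp only [map_zero, ZeroMemClass.coe_zero, add_zero, sub_zero, map_add,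
        LinearMap.add_apply, i1, i2] at this
      rw [Submodule.coe_add, map_add]
      linarith
    have h2 : y - R w = 0 := by
      apply key
      intro c
      have := hY' 0 c
      rw [combine_apply] at this
      have i1 := S.isotropic_gHat _ c.2 _ w.2
      have i2 := S.isotropic_g _ (S.adjoint R c).2 _ y.2
      have e := S.form_adjoint R c w
      have s1 := S.symm.eq (S.adjoint R c : 𝔡) (w : 𝔡)
      have s2 := S.symm.eq (R w : 𝔡) (c : 𝔡)
      simp only [map_zero, ZeroMemClass.coe_zero, add_zero, zero_add, map_add, map_sub,
        LinearMap.sub_apply, i1, i2] at this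
      rw [Submodule.coe_sub, map_sub]
      linarith
    have h3 : y = R w := sub_eq_zero.1 h2
    refine ⟨w, ?_, ?_⟩
    · change (R + S.adjoint R) w = 0
      rw [LinearMap.add_apply, ← h3, h1]
    · simp [h3]

/-- There are linear operators `α₊, α₋ : ℱ^⊥ → 𝒢̂` with
`X = α₊(X) + α₋(X) + Rα₊(X) - R*α₋(X)` for all `X ∈ ℱ^⊥`. -/
theorem exists_alpha (R : S.GHat →ₗ[ℝ] S.G) :
    ∃ α : (S.fPerp R →ₗ[ℝ] S.GHat) × (S.fPerp R →ₗ[ℝ] S.GHat), ∀ X : S.fPerp R,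
      (X : 𝔡) = (α.1 X : 𝔡) + α.2 X + R (α.1 X) - S.adjoint R (α.2 X) := by
  have hmem : ∀ p, S.combine R p ∈ S.fPerp R := fun p => by
    rw [← range_combine]; exact ⟨p, rfl⟩
  obtain ⟨s, hs⟩ := LinearMap.exists_rightInverse_of_surjective
    ((S.combine R).codRestrict (S.fPerp R) hmem) (by
      rw [LinearMap.range_eq_top]
      rintro ⟨X, hX⟩
      rw [← range_combine] at hX
      obtain ⟨p, hp⟩ := hX
      exact ⟨p, Subtype.ext hp⟩)
  refine ⟨(LinearMap.fst ℝ _ _ ∘ₗ s, LinearMap.snd ℝ _ _ ∘ₗ s), fun X => ?_⟩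
  have h := congrArg Subtype.val (LinearMap.congr_fun hs X)
  rw [← combine_apply]
  exact h.symm

/-- A choice of `α₊ : ℱ^⊥ → 𝒢̂`. -/
def alphaPlus (R : S.GHat →ₗ[ℝ] S.G) : S.fPerp R →ₗ[ℝ] S.GHat :=
  (Classical.choose (S.exists_alpha R)).1

/-- A choice of `α₋ : ℱ^⊥ → 𝒢̂`. -/
def alphaMinus (R : S.GHat →ₗ[ℝ] S.G) : S.fPerp R →ₗ[ℝ] S.GHat :=
  (Classical.choose (S.exists_alpha R)).2

theorem alpha_spec (R : S.GHat →ₗ[ℝ] S.G) (X : S.fPerp R) :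
    (X : 𝔡) = (S.alphaPlus R X : 𝔡) + S.alphaMinus R X + R (S.alphaPlus R X)
      - S.adjoint R (S.alphaMinus R X) :=
  Classical.choose_spec (S.exists_alpha R) X

open Classical in
/-- The quadratic form `K(X) = 2⟨α₊(X)|Rα₊(X)⟩ + 2⟨α₋(X)|Rα₋(X)⟩` on `ℱ^⊥`
(with the irrelevant value `0` outside `ℱ^⊥`). -/
def K (R : S.GHat →ₗ[ℝ] S.G) (X : 𝔡) : ℝ :=
  if h : X ∈ S.fPerp R then
    2 * S.form (S.alphaPlus R ⟨X, h⟩ : 𝔡) (R (S.alphaPlus R ⟨X, h⟩) : 𝔡)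
      + 2 * S.form (S.alphaMinus R ⟨X, h⟩ : 𝔡) (R (S.alphaMinus R ⟨X, h⟩) : 𝔡)
  else 0

/-- The value of `K` does not depend on the choice of the decomposition. -/
theorem K_eq (R : S.GHat →ₗ[ℝ] S.G) (a c : S.GHat) :
    S.K R ((a : 𝔡) + c + R a - S.adjoint R c)
      = 2 * S.form (a : 𝔡) (R a : 𝔡) + 2 * S.form (c : 𝔡) (R c : 𝔡) := by
  have hX : (a : 𝔡) + c + R a - S.adjoint R c ∈ S.fPerp R := by
    rw [← range_combine, ← combine_apply]; exact ⟨_, rfl⟩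
  rw [K, dif_pos hX]
  have hs := S.alpha_spec R ⟨_, hX⟩
  set p := S.alphaPlus R ⟨_, hX⟩
  set q := S.alphaMinus R ⟨_, hX⟩
  clear_value p q
  simp only at hs
  have h1 : ((a + c - p - q : S.GHat) : 𝔡)
      = ((R p - S.adjoint R q - R a + S.adjoint R c : S.G) : 𝔡) := by
    simp only [Submodule.coe_sub, Submodule.coe_add]
    rw [← sub_eq_zero] at hs ⊢
    rw [← hs]; abel
  have h2 : ((a + c - p - q : S.GHat) : 𝔡) = 0 :=
    Submodule.disjoint_def.1 S.isCompl.disjoint _ (by rw [h1]; exact Subtype.prop _)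
      (Subtype.prop _)
  rw [h2] at h1
  have h3 : R p - S.adjoint R q - R a + S.adjoint R c = 0 := Subtype.ext h1.symm
  have h4 : a + c - p - q = 0 := Subtype.ext h2
  obtain ⟨d, rfl⟩ : ∃ d, p = a + d := ⟨p - a, by abel⟩
  obtain rfl : q = c - d := by
    rw [← sub_eq_zero] at h4 ⊢
    rw [sub_zero] at h4
    rw [← neg_eq_zero, ← h4]; abel
  have h5 : (R d : 𝔡) + S.adjoint R d = 0 := by
    have : R d + S.adjoint R d = 0 := by
      rw [map_add, map_sub] at h3
      rw [← h3]; abel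
    simpa using congrArg Subtype.val this
  have t : ∀ z : S.GHat, S.form (z : 𝔡) (R d : 𝔡) + S.form (d : 𝔡) (R z : 𝔡) = 0 := by
    intro z
    rw [S.symm.eq (d : 𝔡), S.form_adjoint, ← map_add, h5, map_zero]
  have ta := t a
  have tc := t c
  have td := t d
  simp only [map_add, map_sub, Submodule.coe_add, Submodule.coe_sub, LinearMap.add_apply,
    LinearMap.sub_apply]
  linarith

/-- The condition `J Ad Ĵ + J [Ad, R] Ĵ = R Ad R` on an operator `A` (`= Ad_f`), an identity
of operators on the whole algebra, with `R` extended by zero on `𝒢`. -/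
def DressingCondition (R : S.GHat →ₗ[ℝ] S.G) (A : 𝔡 →ₗ[ℝ] 𝔡) : Prop :=
  S.J ∘ₗ A ∘ₗ S.JHat + S.J ∘ₗ (A ∘ₗ S.extend R - S.extend R ∘ₗ A) ∘ₗ S.JHat
    = S.extend R ∘ₗ A ∘ₗ S.extend R

end Algebra
end DoubleAlgebra

/-! ### Lie groups -/

section LieGroups

instance instLEInftyMinSmoothnessThree : ENat.LEInfty (minSmoothness ℝ 3) :=
  ⟨by rw [minSmoothness_of_isRCLikeNormedField]; exact ENat.LEInfty.out⟩

variable {m : ℕ} {D : Type*} [TopologicalSpace D] [ChartedSpace (EuclideanSpace ℝ (Fin m)) D]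

instance instFiniteDimensionalGroupLieAlgebra [Group D] :
    FiniteDimensional ℝ (GroupLieAlgebra (𝓡 m) D) :=
  inferInstanceAs (FiniteDimensional ℝ (EuclideanSpace ℝ (Fin m)))

variable [Group D]

/-- The adjoint action `Ad_d` on the Lie algebra: the derivative at `1` of `x ↦ d x d⁻¹`. -/
def Ad (d : D) : GroupLieAlgebra (𝓡 m) D →ₗ[ℝ] GroupLieAlgebra (𝓡 m) D :=
  (mfderiv (𝓡 m) (𝓡 m) (fun x : D => d * x * d⁻¹) 1).toLinearMap

/-- The differential at `1` of a homomorphism of Lie groups. -/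
def lieDifferential {k : ℕ} {F : Type*} [TopologicalSpace F]
    [ChartedSpace (EuclideanSpace ℝ (Fin k)) F] [Group F] (ι : F →* D) :
    GroupLieAlgebra (𝓡 k) F →ₗ[ℝ] GroupLieAlgebra (𝓡 m) D :=
  (mfderiv (𝓡 k) (𝓡 m) ι 1).toLinearMap

/-- `ι : F → D` exhibits the Lie group `F` as an (immersed) Lie subgroup of `D` whose Lie algebra
is the subspace `𝔣` of the Lie algebra of `D`. -/
structure IsLieSubgroup {k : ℕ} {F : Type*} [TopologicalSpace F]
    [ChartedSpace (EuclideanSpace ℝ (Fin k)) F] [Group F] (ι : F →* D)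
    (𝔣 : Submodule ℝ (GroupLieAlgebra (𝓡 m) D)) : Prop where
  smooth : ContMDiff (𝓡 k) (𝓡 m) ∞ ι
  injective : Function.Injective ι
  immersion : Function.Injective (lieDifferential (m := m) (k := k) ι)
  range_eq : LinearMap.range (lieDifferential (m := m) (k := k) ι) = 𝔣

/-- For a map `l` from the world-sheet `ℝ²` to `D`, the value `(∂_v l) l⁻¹` at `x` of the pulled
back right-invariant Maurer-Cartan form on the vector `v`. -/
def maurerCartan (l : ℝ × ℝ → D) (x v : ℝ × ℝ) : GroupLieAlgebra (𝓡 m) D :=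
  (mfderiv 𝓘(ℝ, ℝ × ℝ) (𝓡 m) (fun y => l y * (l x)⁻¹) x : ℝ × ℝ →L[ℝ] _) v

/-- `∂_σ l l⁻¹`; a point of the world-sheet is a pair `(σ, τ)`. -/
def dSigma (l : ℝ × ℝ → D) (x : ℝ × ℝ) : GroupLieAlgebra (𝓡 m) D := maurerCartan l x (1, 0)

/-- `∂_τ l l⁻¹`. -/
def dTau (l : ℝ × ℝ → D) (x : ℝ × ℝ) : GroupLieAlgebra (𝓡 m) D := maurerCartan l x (0, 1)

/-- The derivative at `d` of a function on `D` along the right-invariant vector field with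
value `X` at `1`. -/
def rightDeriv (φ : D → ℝ) (X : GroupLieAlgebra (𝓡 m) D) (d : D) : ℝ :=
  (mfderiv (𝓡 m) 𝓘(ℝ, ℝ) (fun x : D => φ (x * d)) 1 : GroupLieAlgebra (𝓡 m) D →L[ℝ] ℝ) X

variable [LieGroup (𝓡 m) ∞ D]

/-- The value `[θ ∧ θ](X, Y) = [X, Y] - [Y, X]` for the right-invariant Maurer-Cartan form `θ`,
on right-invariant vector fields. -/
def bracketWedge (X Y : GroupLieAlgebra (𝓡 m) D) : GroupLieAlgebra (𝓡 m) D := ⁅X, Y⁆ - ⁅Y, X⁆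

/-- The right-invariant 3-form `⟨θ ∧ [θ ∧ θ]⟩` on `D`, on the right-invariant vector fields
given by `X`, `Y`, `Z`. -/
def wzForm (S : DoubleAlgebra (GroupLieAlgebra (𝓡 m) D)) (X Y Z : GroupLieAlgebra (𝓡 m) D) : ℝ :=
  S.form X (bracketWedge Y Z) + S.form Y (bracketWedge Z X) + S.form Z (bracketWedge X Y)

/-- `b` is a smooth 2-form on `D` with `d b = ⟨θ ∧ [θ ∧ θ]⟩`, i.e. `b = d⁻¹⟨θ ∧ [θ ∧ θ]⟩`. A 2-form
is described in the right-invariant frame: `b d X Y` is its value on the tangent vectors at `d`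
that are the right translates of `X` and `Y`. The exterior derivative is the usual invariant
formula, in which the bracket of the right-invariant vector fields of `X` and `Y` is the
right-invariant vector field of `-[X, Y]`. -/
structure IsPotential (S : DoubleAlgebra (GroupLieAlgebra (𝓡 m) D))
    (b : D → LinearMap.BilinForm ℝ (GroupLieAlgebra (𝓡 m) D)) : Prop where
  smooth : ∀ X Y, ContMDiff (𝓡 m) 𝓘(ℝ, ℝ) ∞ (fun d => b d X Y)
  alt : ∀ d X, b d X X = 0
  deriv_eq : ∀ d X Y Z,
    rightDeriv (fun d' => b d' Y Z) X d + rightDeriv (fun d' => b d' Z X) Y d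
      + rightDeriv (fun d' => b d' X Y) Z d
      + b d ⁅X, Y⁆ Z + b d ⁅Y, Z⁆ X + b d ⁅Z, X⁆ Y = wzForm S X Y Z

/-- The density `⟨∂_τ l l⁻¹|∂_σ l l⁻¹⟩ + (1/6) d⁻¹⟨dl l⁻¹ ∧ [dl l⁻¹ ∧ dl l⁻¹]⟩`; a 2-form on the
world-sheet is identified with its value on `(∂_σ, ∂_τ)`. -/
def wzwDensity (S : DoubleAlgebra (GroupLieAlgebra (𝓡 m) D))
    (b : D → LinearMap.BilinForm ℝ (GroupLieAlgebra (𝓡 m) D)) (l : ℝ × ℝ → D) (x : ℝ × ℝ) : ℝ :=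
  S.form (dTau l x) (dSigma l x) + (1 / 6) * b (l x) (dSigma l x) (dTau l x)

/-- The Lagrangian density of the first-order action. -/
def lagrangian (S : DoubleAlgebra (GroupLieAlgebra (𝓡 m) D)) (R : S.GHat →ₗ[ℝ] S.G)
    (b : D → LinearMap.BilinForm ℝ (GroupLieAlgebra (𝓡 m) D))
    (l : ℝ × ℝ → D) (Λ : ℝ × ℝ → GroupLieAlgebra (𝓡 m) D) (x : ℝ × ℝ) : ℝ :=
  (1 / 2) * (wzwDensity S b l x + S.K R (dSigma l x) + S.form (Λ x) (dSigma l x))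

/-- Smooth fields: `l` is `D`-valued and `Λ` is `ℱ`-valued. -/
structure IsWorldSheetField (S : DoubleAlgebra (GroupLieAlgebra (𝓡 m) D)) (R : S.GHat →ₗ[ℝ] S.G)
    (l : ℝ × ℝ → D) (Λ : ℝ × ℝ → GroupLieAlgebra (𝓡 m) D) : Prop where
  smooth_l : ContMDiff 𝓘(ℝ, ℝ × ℝ) (𝓡 m) ∞ l
  smooth_Λ : ContDiff ℝ ∞ (F := EuclideanSpace ℝ (Fin m)) Λ
  mem : ∀ x, Λ x ∈ S.fSpace R

/-- The constraint `∂_σ l l⁻¹ ∈ ℱ^⊥` imposed by the Lagrange multiplier. -/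
def IsConstrained (S : DoubleAlgebra (GroupLieAlgebra (𝓡 m) D)) (R : S.GHat →ₗ[ℝ] S.G)
    (l : ℝ × ℝ → D) : Prop :=
  ∀ x, dSigma l x ∈ S.fPerp R

/-- The gauge transform `f l` of `l`. -/
def gaugeField (f l : ℝ × ℝ → D) : ℝ × ℝ → D := fun x => f x * l x

/-- The gauge transform `f Λ f⁻¹ - ∂_τ f f⁻¹` of the Lagrange multiplier. -/
def gaugeMultiplier (f : ℝ × ℝ → D) (Λ : ℝ × ℝ → GroupLieAlgebra (𝓡 m) D) (x : ℝ × ℝ) :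
    GroupLieAlgebra (𝓡 m) D :=
  Ad (f x) (Λ x) - dTau f x

/-- The density `½ (⟨∂_τ l l⁻¹|∂_σ l l⁻¹⟩ + (1/6) d⁻¹⟨dl l⁻¹ ∧ [dl l⁻¹ ∧ dl l⁻¹]⟩) + ⟨Λ|∂_σ l l⁻¹⟩`,
which makes sense without the constraint. -/
def unconstrainedDensity (S : DoubleAlgebra (GroupLieAlgebra (𝓡 m) D))
    (b : D → LinearMap.BilinForm ℝ (GroupLieAlgebra (𝓡 m) D))
    (l : ℝ × ℝ → D) (Λ : ℝ × ℝ → GroupLieAlgebra (𝓡 m) D) (x : ℝ × ℝ) : ℝ :=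
  (1 / 2) * wzwDensity S b l x + S.form (Λ x) (dSigma l x)

end LieGroups

/-- The action over the region `W` of the world-sheet with density `L`. -/
def action (W : Set (ℝ × ℝ)) (L : ℝ × ℝ → ℝ) : ℝ := ∫ x in W, L x

/-- If the action over `W` with density `L` converges, then so does the one with density `L'`, and
the two are equal. -/
def SameAction (W : Set (ℝ × ℝ)) (L L' : ℝ × ℝ → ℝ) : Prop :=
  IntegrableOn L W → IntegrableOn L' W ∧ action W L' = action W L

end

noncomputable section

open scoped Topology

/-! The algebra rests on three descriptions by the form alone. The space `rPerp` is the orthogonal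
complement of `rSpace`, `fSpace` is their intersection and hence isotropic, and `fPerp` is their
sum, where `K (P + M) = ⟨P|P⟩ - ⟨M|M⟩` for `P` in `rSpace` and `M` in `rPerp` (`K_add`). Evaluated
on `γ ∈ 𝒢̂`, the dressing condition says exactly that `Ad_f` preserves `rSpace`. Used for both `f`
and `f⁻¹`, and combined with the invariance of the form under `Ad_f` (`formCLM_adCLM`, from
connectedness), it gives the first two claims.

For the action, put `φ = df f⁻¹`. A Polyakov-Wiegmann computation (`unconstrainedDensity_gauge`,
`lagrangian_gauge`) shows that the density changes by 1/12 of the 2-form `gaugeTwoForm`, which is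
`(fl)^*b - l^*b + 6⟨φ ∧ Ad_f(dl l⁻¹)⟩`. This form vanishes wherever `f` is locally 1. By the
Maurer-Cartan equation its exterior derivative is a multiple of `⟨φ|[φ, φ]⟩`, which is zero because
`ℱ` is an isotropic subalgebra. It remains to prove that this closed, compactly supported form has
integral zero over the plane.

The homotopy `l(tx)` replaces `l` by the constant `l(0)`. The integral becomes that of the pull-back
of `b` along `f·l(0)`, which is the period of a closed 2-form on `F l(0)` over a sphere. It vanishes
since the second homotopy group of a Lie group is trivial, but a more elementary argument is used
(`IsPotential.setIntegral_unitCube_pullTwoForm`). Regard the sphere as a map `g` on a 2-torus that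
is 1 on both axes, and multiply `m + 1` copies of `g`, where `m = dim D`, to get a map from a torus
of dimension `2(m + 1)` to `F`. The pull-back of `b` along the right translate of this map by `l(0)`
has rank at most `m`, so its top power, expressed by a Pfaffian, is zero. The integral of that power
depends only on the periods over coordinate 2-tori (`setIntegral_pfaffian`): these are the sought
period `c` within each block and 0 across blocks. The integral is therefore a positive multiple of
`c^(m+1)`, and `c = 0`. -/

/-- The Lie bracket as a bilinear map. -/
def lieBilin (L : Type*) [LieRing L] [LieAlgebra ℝ L] : L →ₗ[ℝ] L →ₗ[ℝ] L :=
  LinearMap.mk₂ ℝ (fun X Y : L => ⁅X, Y⁆) add_lie smul_lie lie_add lie_smul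

/-- The underlying space of the Lie algebra of an `m`-dimensional Lie group. -/
abbrev Vec (m : ℕ) := EuclideanSpace ℝ (Fin m)

/-! ### The Lie bracket through the multiplication in a chart at the identity -/

section
variable {m : ℕ} {D : Type*} [TopologicalSpace D] [ChartedSpace (EuclideanSpace ℝ (Fin m)) D]

/-- The differential of a map from a normed space to a manifold, in the coordinates given by the
preferred chart at the image point. -/
def mDiff {E : Type*} [NormedAddCommGroup E] [NormedSpace ℝ E] (f : E → D) (x : E) :
    E →L[ℝ] Vec m := mfderiv 𝓘(ℝ, E) (𝓡 m) f x

variable [Group D]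
variable {E : Type*} [NormedAddCommGroup E] [NormedSpace ℝ E]

/-- The pulled back right-invariant Maurer-Cartan form `dΦ Φ⁻¹`. -/
def mcForm (Φ : E → D) (x : E) : E →L[ℝ] Vec m := mDiff (fun y => Φ y * (Φ x)⁻¹) x

/-- At a point sent to 1 the manifold derivative is an ordinary derivative in the fixed chart at 1.
Identities between Maurer-Cartan forms then follow from uniqueness of derivatives. -/
theorem hasFDerivAt_extChartAt_comp {f : E → D} {x : E}
    (hf : MDifferentiableAt 𝓘(ℝ, E) (𝓡 m) f x) (h1 : f x = 1) :
    HasFDerivAt (fun y => extChartAt (𝓡 m) (1 : D) (f y)) (mDiff f x) x := by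
  have h := hf.hasMFDerivAt.2
  simp only [writtenInExtChartAt, h1, modelWithCornersSelf_coe, Set.range_id,
    extChartAt_model_space_eq_id, PartialEquiv.refl_coe, PartialEquiv.refl_symm, id,
    Function.comp_def] at h
  exact hasFDerivWithinAt_univ.1 h

/-- The Lie bracket as a continuous bilinear map. -/
def bracketCLM (D : Type*) [TopologicalSpace D] [ChartedSpace (EuclideanSpace ℝ (Fin m)) D]
    [Group D] [LieGroup (𝓡 m) ∞ D] : Vec m →L[ℝ] Vec m →L[ℝ] Vec m :=
  LinearMap.toContinuousBilinearMap (lieBilin (GroupLieAlgebra (𝓡 m) D) : Vec m →ₗ[ℝ] Vec m →ₗ[ℝ] Vec m)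

variable (D) in
/-- Multiplication in the chart at the identity. -/
def chartMul (p : Vec m × Vec m) : Vec m :=
  extChartAt (𝓡 m) (1 : D)
    ((extChartAt (𝓡 m) (1 : D)).symm p.1 * (extChartAt (𝓡 m) (1 : D)).symm p.2)

variable (D) in
/-- The coordinates of the identity. -/
def chartOne : Vec m := extChartAt (𝓡 m) (1 : D) 1

theorem chartOne_symm : (extChartAt (𝓡 m) (1 : D)).symm (chartOne D) = 1 := by
  simp [chartOne]

theorem chartOne_mem_target : chartOne D ∈ (extChartAt (𝓡 m) (1 : D)).target :=
  mem_extChartAt_target (1 : D)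

variable (m D) in
theorem eventually_chartOne :
    ∀ᶠ a : Vec m in 𝓝 (chartOne D), a ∈ (extChartAt (𝓡 m) (1 : D)).target :=
  (isOpen_extChartAt_target (I := 𝓡 m) (1 : D)).mem_nhds chartOne_mem_target

theorem chartMul_one_right :
    ∀ᶠ a : Vec m in 𝓝 (chartOne D), chartMul D (a, chartOne D) = a := by
  filter_upwards [eventually_chartOne m D] with a ha
  simp only [chartMul, chartOne_symm, mul_one]
  exact (extChartAt (𝓡 m) (1 : D)).right_inv ha

theorem chartMul_one_left :
    ∀ᶠ a : Vec m in 𝓝 (chartOne D), chartMul D (chartOne D, a) = a := by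
  filter_upwards [eventually_chartOne m D] with a ha
  simp only [chartMul, chartOne_symm, one_mul]
  exact (extChartAt (𝓡 m) (1 : D)).right_inv ha

variable [LieGroup (𝓡 m) ∞ D]

theorem contMDiffAt_extChartAt_symm {a : Vec m}
    (ha : a ∈ (extChartAt (𝓡 m) (1 : D)).target) :
    ContMDiffAt 𝓘(ℝ, Vec m) (𝓡 m) ∞ (extChartAt (𝓡 m) (1 : D)).symm a :=
  (contMDiffOn_extChartAt_symm (1 : D)).contMDiffAt ((isOpen_extChartAt_target (1 : D)).mem_nhds ha)

theorem contMDiffAt_extChartAt_one {d : D} (hd : d ∈ (extChartAt (𝓡 m) (1 : D)).source) :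
    ContMDiffAt (𝓡 m) 𝓘(ℝ, Vec m) ∞ (extChartAt (𝓡 m) (1 : D)) d :=
  contMDiffAt_extChartAt' (by simpa using hd)

theorem contDiffAt_chartMul {p : Vec m × Vec m}
    (h1 : p.1 ∈ (extChartAt (𝓡 m) (1 : D)).target) (h2 : p.2 ∈ (extChartAt (𝓡 m) (1 : D)).target)
    (h3 : (extChartAt (𝓡 m) (1 : D)).symm p.1 * (extChartAt (𝓡 m) (1 : D)).symm p.2 ∈
      (extChartAt (𝓡 m) (1 : D)).source) : ContDiffAt ℝ ∞ (chartMul D) p := by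
  rw [← contMDiffAt_iff_contDiffAt]
  have a1 : ContMDiffAt 𝓘(ℝ, Vec m × Vec m) (𝓡 m) ∞
     (fun p : Vec m × Vec m => (extChartAt (𝓡 m) (1 : D)).symm p.1) p :=
    (contMDiffAt_extChartAt_symm h1).comp p contDiff_fst.contMDiff.contMDiffAt
  have a2 : ContMDiffAt 𝓘(ℝ, Vec m × Vec m) (𝓡 m) ∞
     (fun p : Vec m × Vec m => (extChartAt (𝓡 m) (1 : D)).symm p.2) p :=
    (contMDiffAt_extChartAt_symm h2).comp p contDiff_snd.contMDiff.contMDiffAt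
  exact (contMDiffAt_extChartAt_one h3).comp p (a1.mul a2)

theorem contDiffAt_chartMul_one : ContDiffAt ℝ ∞ (chartMul (m := m) D) (chartOne D, chartOne D) :=
  contDiffAt_chartMul chartOne_mem_target chartOne_mem_target (by
    simp only [chartOne_symm, mul_one]; exact mem_extChartAt_source 1)

/-- The derivatives of the chart and of its inverse cancel, so in coordinates a left-invariant field
is the partial derivative of the multiplication in its second argument. -/
theorem mpullbackWithin_mulInvariantVectorField (v : Vec m) :
   ∀ᶠ a : Vec m in 𝓝 (chartOne D), VectorField.mpullbackWithin 𝓘(ℝ, Vec m) (𝓡 m)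
     (extChartAt (𝓡 m) (1 : D)).symm
     (mulInvariantVectorField (v : GroupLieAlgebra (𝓡 m) D)) (Set.range (𝓡 m)) a =
      fderiv ℝ (fun b => chartMul D (a, b)) (chartOne D) v := by
  filter_upwards [eventually_chartOne m D] with a ha
  rw [VectorField.mpullbackWithin_apply]
  have e1 := ContinuousLinearMap.inverse_eq (mfderivWithin_extChartAt_symm_comp_mfderiv_extChartAt (I := 𝓡 m) ha)
    (mfderiv_extChartAt_comp_mfderivWithin_extChartAt_symm (I := 𝓡 m) ha)
  rw [e1]
  have hs : (extChartAt (𝓡 m) (1 : D)).symm a ∈ (extChartAt (𝓡 m) (1 : D)).source :=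
    (extChartAt (𝓡 m) (1 : D)).map_target ha
  have d2 : MDifferentiableAt (𝓡 m) (𝓡 m) (fun b : D => (extChartAt (𝓡 m) (1 : D)).symm a * b) 1 :=
    (contMDiff_mul_left (n := ∞)).mdifferentiableAt (by simp)
  have d1 : MDifferentiableAt (𝓡 m) 𝓘(ℝ, EuclideanSpace ℝ (Fin m)) (extChartAt (𝓡 m) (1 : D)) ((extChartAt (𝓡 m) (1 : D)).symm a * 1) :=
    (contMDiffAt_extChartAt_one (by simpa using hs)).mdifferentiableAt (by simp)
  have d3 := (d1.hasMFDerivAt.comp (1 : D) d2.hasMFDerivAt).2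
  simp only [writtenInExtChartAt, modelWithCornersSelf_coe, Set.range_id,
    extChartAt_model_space_eq_id, PartialEquiv.refl_coe, id, Function.comp_def] at d3
  have d4 : fderiv ℝ (fun b => chartMul D (a, b)) (chartOne D) =
      (show Vec m →L[ℝ] Vec m from (mfderiv (𝓡 m) 𝓘(ℝ, Vec m) (extChartAt (𝓡 m) (1 : D))
        ((extChartAt (𝓡 m) (1 : D)).symm a * 1)).comp
        (mfderiv (𝓡 m) (𝓡 m) (fun b : D => (extChartAt (𝓡 m) (1 : D)).symm a * b) 1)) :=
    HasFDerivAt.fderiv (hasFDerivWithinAt_univ.1 d3)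
  rw [d4, mul_one]
  rfl

theorem groupLieAlgebra_bracket_eq_lieBracket (v w : GroupLieAlgebra (𝓡 m) D) :
    (⁅v, w⁆ : GroupLieAlgebra (𝓡 m) D) = VectorField.lieBracket ℝ
      (fun a => fderiv ℝ (fun b => chartMul D (a, b)) (chartOne D) v)
      (fun a => fderiv ℝ (fun b => chartMul D (a, b)) (chartOne D) w) (chartOne D) := by
  rw [GroupLieAlgebra.bracket_def, ← VectorField.mlieBracketWithin_univ, VectorField.mlieBracketWithin_apply]
  have e := mfderiv_extChartAt_self (I := 𝓡 m) (x := (1:D))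
  have e2 := congrArg ContinuousLinearMap.inverse e
  rw [e2]
  have h : (extChartAt (𝓡 m) (1 : D)).symm ⁻¹' Set.univ ∩ Set.range (𝓡 m) = Set.univ := by simp
  rw [h]
  refine (DFunLike.congr_fun (ContinuousLinearMap.inverse_id (R := ℝ) (M := Vec m)) _).trans ?_
  have h2 := Filter.EventuallyEq.lieBracket_vectorField_eq (𝕜 := ℝ) (mpullbackWithin_mulInvariantVectorField (D := D) v) (mpullbackWithin_mulInvariantVectorField (D := D) w)
  refine Eq.trans ?_ h2
  exact congrFun (VectorField.lieBracketWithin_univ (𝕜 := ℝ) (E := Vec m)) (chartOne D)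

theorem bracketCLM_eq_lieBracket (v w : Vec m) :
    bracketCLM D v w = VectorField.lieBracket ℝ
      (fun a => fderiv ℝ (fun b => chartMul D (a, b)) (chartOne D) v)
      (fun a => fderiv ℝ (fun b => chartMul D (a, b)) (chartOne D) w) (chartOne D) :=
  groupLieAlgebra_bracket_eq_lieBracket v w

/-- The bracket is the antisymmetrized mixed second derivative of the multiplication. -/
theorem bracketCLM_eq_fderiv (v w : Vec m) :
    bracketCLM D v w = fderiv ℝ (fderiv ℝ (chartMul D)) (chartOne D, chartOne D) (v, 0) (0, w)
      - fderiv ℝ (fderiv ℝ (chartMul D)) (chartOne D, chartOne D) (w, 0) (0, v) := by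
  have hd : ContDiffAt ℝ ∞ (fderiv ℝ (chartMul (m := m) D)) (chartOne D, chartOne D) :=
    contDiffAt_chartMul_one.fderiv_right (m := ∞) (by simp)
  have hd' : HasFDerivAt (fderiv ℝ (chartMul (m := m) D)) _ (chartOne D, chartOne D) :=
    (hd.differentiableAt (by simp)).hasFDerivAt
  have hev : ∀ᶠ a : Vec m in 𝓝 (chartOne D), DifferentiableAt ℝ (chartMul (m := m) D) (a, chartOne D) := by
    have h1 : ∀ᶠ p in 𝓝 ((chartOne D, chartOne D) : Vec m × Vec m), DifferentiableAt ℝ (chartMul (m := m) D) p :=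
      ((contDiffAt_chartMul_one.of_le (m := 1) (by simp)).eventually (by simp)).mono
        fun p hp => hp.differentiableAt (by simp)
    exact (Continuous.tendsto (by fun_prop : Continuous fun a : Vec m => (a, (chartOne D : Vec m))) (chartOne D)).eventually h1
  have key : ∀ w : Vec m, (fun a => fderiv ℝ (fun b => chartMul D (a, b)) (chartOne D) w) =ᶠ[𝓝 (chartOne D)]
      fun a => fderiv ℝ (chartMul D) (a, chartOne D) (0, w) := by
    intro w
    filter_upwards [hev] with a ha
    have : HasFDerivAt (fun b : Vec m => (a, b)) (ContinuousLinearMap.inr ℝ (Vec m) (Vec m)) (chartOne D) :=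
      hasFDerivAt_prodMk_right a _
    have h2 := (ha.hasFDerivAt.comp (chartOne D) this).fderiv
    have h3 := DFunLike.congr_fun h2 w
    simpa [Function.comp_def] using h3
  have key2 : ∀ w v : Vec m, fderiv ℝ (fun a => fderiv ℝ (chartMul D) (a, chartOne D) (0, w)) (chartOne D) v =
     fderiv ℝ (fderiv ℝ (chartMul D)) (chartOne D, chartOne D) (v, 0) (0, w) := by
    intro w v
    have : HasFDerivAt (fun a : Vec m => (a, (chartOne D : Vec m))) (ContinuousLinearMap.inl ℝ (Vec m) (Vec m)) (chartOne D) :=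
      hasFDerivAt_prodMk_left _ _
    have h2 := HasFDerivAt.comp (f := fun a : Vec m => (a, (chartOne D : Vec m))) (chartOne D) hd' this
    have h3 := h2.clm_apply (hasFDerivAt_const ((0, w) : Vec m × Vec m) (chartOne D))
    have h4 := DFunLike.congr_fun h3.fderiv v
    simpa [Function.comp_def] using h4
  -- At the identity the invariant field of `w` has value `w`, so the coordinate bracket formula
  -- leaves only the mixed second derivatives.
  have key3 : ∀ w : Vec m, fderiv ℝ (chartMul D) (chartOne D, chartOne D) (0, w) = w := by
    intro w
    rw [← (key w).eq_of_nhds, Filter.EventuallyEq.fderiv_eq (f₁ := fun a : Vec m => chartMul D (chartOne D, a)) (f := id)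
      chartMul_one_left]
    simp
  rw [bracketCLM_eq_lieBracket, Filter.EventuallyEq.lieBracket_vectorField_eq (key v) (key w)]
  simp only [VectorField.lieBracket, key2, key3]

end

/-! ### The Maurer-Cartan form of a map and the Maurer-Cartan equation -/

section
variable {m : ℕ} {D : Type*} [TopologicalSpace D] [ChartedSpace (EuclideanSpace ℝ (Fin m)) D]
  [Group D] [LieGroup (𝓡 m) ∞ D]
variable {E : Type*} [NormedAddCommGroup E] [NormedSpace ℝ E]

theorem mdifferentiableAt_mul_const {Φ : E → D} {x : E} (h : MDifferentiableAt 𝓘(ℝ, E) (𝓡 m) Φ x)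
    (c : D) : MDifferentiableAt 𝓘(ℝ, E) (𝓡 m) (fun y => Φ y * c) x :=
  ((contMDiff_mul_right (I := 𝓡 m) (n := ∞) (a := c)).mdifferentiableAt (by simp)).comp x h

theorem hasFDerivAt_mcForm {Φ : E → D} {x : E} (h : MDifferentiableAt 𝓘(ℝ, E) (𝓡 m) Φ x) :
    HasFDerivAt (fun y => extChartAt (𝓡 m) (1 : D) (Φ y * (Φ x)⁻¹)) (mcForm (m := m) Φ x) x :=
  hasFDerivAt_extChartAt_comp (mdifferentiableAt_mul_const h _) (by simp)

theorem mcForm_mul_const (Φ : E → D) (c : D) (x : E) :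
    mcForm (m := m) (fun y => Φ y * c) x = mcForm Φ x := by
  simp [mcForm]

theorem mcForm_const (c : D) (x : E) : mcForm (m := m) (fun _ : E => c) x = 0 := by
  have h := hasFDerivAt_mcForm (m := m) (Φ := fun _ : E => c) (x := x) (mdifferentiableAt_const)
  exact h.unique (hasFDerivAt_const _ _)

theorem mcForm_congr {Φ Ψ : E → D} {x : E} (h : Φ =ᶠ[𝓝 x] Ψ)
    (hΦ : MDifferentiableAt 𝓘(ℝ, E) (𝓡 m) Φ x) : mcForm (m := m) Φ x = mcForm Ψ x := by
  refine (hasFDerivAt_mcForm hΦ).unique ((hasFDerivAt_mcForm (h.mdifferentiableAt_iff.1 hΦ)).congr_of_eventuallyEq ?_)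
  rw [h.eq_of_nhds]
  filter_upwards [h] with y hy
  rw [hy]

theorem mcForm_comp {E' : Type*} [NormedAddCommGroup E'] [NormedSpace ℝ E'] {Φ : E → D} {g : E' → E}
    {x : E'} (h : MDifferentiableAt 𝓘(ℝ, E) (𝓡 m) Φ (g x)) (hg : DifferentiableAt ℝ g x) :
    mcForm (m := m) (fun y => Φ (g y)) x = (mcForm Φ (g x)).comp (fderiv ℝ g x) := by
  have h1 : MDifferentiableAt 𝓘(ℝ, E') (𝓡 m) (fun y => Φ (g y)) x := h.comp x hg.mdifferentiableAt
  exact (hasFDerivAt_mcForm h1).unique ((hasFDerivAt_mcForm h).comp x hg.hasFDerivAt)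

theorem contDiffAt_chart_mul_inv {Φ : E → D} (h : ContMDiff 𝓘(ℝ, E) (𝓡 m) ∞ Φ) (x : E) :
    ContDiffAt ℝ ∞ (fun p : E × E => extChartAt (𝓡 m) (1 : D) (Φ p.2 * (Φ p.1)⁻¹)) (x, x) := by
  rw [← contMDiffAt_iff_contDiffAt]
  have h1 : ContMDiff 𝓘(ℝ, E × E) (𝓡 m) ∞ (fun p : E × E => Φ p.2 * (Φ p.1)⁻¹) :=
    (h.comp contDiff_snd.contMDiff).mul (h.comp contDiff_fst.contMDiff).inv
  refine ContMDiffAt.comp (I' := 𝓡 m) (x, x) ?_ h1.contMDiffAt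
  exact contMDiffAt_extChartAt_one (by simp)

/-- The base point also enters through `(Φ x)⁻¹`. Treating it as a separate variable makes the form
a partial derivative, on the diagonal, of one smooth function of two variables; this yields its
smoothness in `x`. -/
theorem mcForm_eq_fderiv_comp_inr {Φ : E → D} (h : ContMDiff 𝓘(ℝ, E) (𝓡 m) ∞ Φ) (x : E) :
    mcForm (m := m) Φ x =
      (fderiv ℝ (fun p : E × E => extChartAt (𝓡 m) (1 : D) (Φ p.2 * (Φ p.1)⁻¹)) (x, x)).comp
        (ContinuousLinearMap.inr ℝ E E) := by
  refine (hasFDerivAt_mcForm (h.mdifferentiableAt (by simp))).unique ?_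
  have h1 := ((contDiffAt_chart_mul_inv h x).differentiableAt (by simp)).hasFDerivAt
  exact HasFDerivAt.comp (f := fun y : E => (x, y)) x h1 (hasFDerivAt_prodMk_right x x)

theorem contDiff_mcForm {Φ : E → D} (h : ContMDiff 𝓘(ℝ, E) (𝓡 m) ∞ Φ) :
    ContDiff ℝ ∞ (mcForm (m := m) Φ) := by
  rw [show mcForm (m := m) Φ = _ from funext (mcForm_eq_fderiv_comp_inr h)]
  rw [contDiff_iff_contDiffAt]
  intro x
  refine ContDiffAt.clm_comp ?_ contDiffAt_const
  have h1 := (contDiffAt_chart_mul_inv h x).fderiv_right (m := ∞) (by simp)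
  exact ContDiffAt.comp (f := fun y : E => (y, y)) x h1 (by fun_prop)

theorem fderiv_chartMul_inl (w : Vec m) :
    fderiv ℝ (chartMul D) (chartOne D, chartOne D) (w, 0) = w := by
  have hd : DifferentiableAt ℝ (chartMul (m := m) D) (chartOne D, chartOne D) :=
    contDiffAt_chartMul_one.differentiableAt (by simp)
  have h1 := HasFDerivAt.comp (f := fun a : Vec m => (a, (chartOne D : Vec m))) (chartOne D)
    hd.hasFDerivAt (hasFDerivAt_prodMk_left _ _)
  have h2 : HasFDerivAt (fun a : Vec m => chartMul D (a, chartOne D)) (ContinuousLinearMap.id ℝ _) (chartOne D) :=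
    (hasFDerivAt_id (chartOne D)).congr_of_eventuallyEq chartMul_one_right
  simpa using DFunLike.congr_fun (h1.unique h2) w

/-- Let `U` be the coordinates of `Φ`. Differentiating `Φ z = (Φ z (Φ y)⁻¹) Φ y` at `z = y` gives
`DU = D₁mul(1, U) ∘ θ`. One more derivative at `x` and the symmetry of `D²U` express the
antisymmetrized `Dθ` by mixed second derivatives of the multiplication, that is, by the bracket. -/
theorem mcForm_maurerCartan_of_eq_one {Φ : E → D} (h : ContMDiff 𝓘(ℝ, E) (𝓡 m) ∞ Φ) (x : E)
    (hx : Φ x = 1) (u v : E) :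
    fderiv ℝ (mcForm (m := m) Φ) x u v - fderiv ℝ (mcForm (m := m) Φ) x v u =
      bracketCLM D (mcForm (m := m) Φ x u) (mcForm (m := m) Φ x v) := by
  set U : E → Vec m := fun y => extChartAt (𝓡 m) (1 : D) (Φ y) with hU
  have hUs : ContDiffAt ℝ ∞ U x := by
    rw [← contMDiffAt_iff_contDiffAt]
    exact ContMDiffAt.comp (I' := 𝓡 m) x (contMDiffAt_extChartAt_one (by simp [hx])) h.contMDiffAt
  have hUx : U x = chartOne D := by simp [hU, hx, chartOne]
  have hcont : Continuous Φ := h.continuous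
  have hsrc : ∀ᶠ y in 𝓝 x, Φ y ∈ (extChartAt (𝓡 m) (1 : D)).source :=
    hcont.continuousAt.eventually ((isOpen_extChartAt_source (I := 𝓡 m) (1 : D)).mem_nhds
      (by rw [hx]; exact mem_extChartAt_source 1))
  have hmd : ∀ᶠ y in 𝓝 x, DifferentiableAt ℝ (chartMul (m := m) D) (chartOne D, U y) := by
    have h1 : ∀ᶠ p in 𝓝 ((chartOne D, U x) : Vec m × Vec m),
        DifferentiableAt ℝ (chartMul (m := m) D) p := by
      rw [hUx]
      exact ((contDiffAt_chartMul_one.of_le (m := 1) (by simp)).eventually (by simp)).mono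
        fun p hp => hp.differentiableAt (by simp)
    exact (continuousAt_const.prodMk hUs.continuousAt).eventually h1
  have key : fderiv ℝ U =ᶠ[𝓝 x] fun y => (fderiv ℝ (chartMul D) (chartOne D, U y)).comp
      ((ContinuousLinearMap.inl ℝ (Vec m) (Vec m)).comp (mcForm Φ y)) := by
    filter_upwards [hsrc, hmd] with y hy1 hy2
    have g1 := hasFDerivAt_mcForm (m := m) (h.mdifferentiableAt (x := y) (by simp))
    have g2 := g1.prodMk (hasFDerivAt_const (U y) y)
    have g0 : (extChartAt (𝓡 m) (1 : D) (Φ y * (Φ y)⁻¹), U y) = ((chartOne D, U y) : Vec m × Vec m) := by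
      simp [chartOne]
    have g3 := HasFDerivAt.comp (g := chartMul (m := m) D) y (by rw [g0]; exact hy2.hasFDerivAt) g2
    have g4 : U =ᶠ[𝓝 y] chartMul D ∘ fun z => (extChartAt (𝓡 m) (1 : D) (Φ z * (Φ y)⁻¹), U y) := by
      have : ∀ᶠ z in 𝓝 y, Φ z * (Φ y)⁻¹ ∈ (extChartAt (𝓡 m) (1 : D)).source := by
        have c : ContinuousAt (fun z => Φ z * (Φ y)⁻¹) y :=
          ((contMDiff_mul_right (I := 𝓡 m) (n := ∞) (a := (Φ y)⁻¹)).continuous.comp hcont).continuousAt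
        exact c.eventually ((isOpen_extChartAt_source (I := 𝓡 m) (1 : D)).mem_nhds
          (by simp only [mul_inv_cancel]; exact mem_extChartAt_source 1))
      filter_upwards [this] with z hz
      simp only [Function.comp_def, chartMul, hU]
      rw [(extChartAt (𝓡 m) (1 : D)).left_inv hz, (extChartAt (𝓡 m) (1 : D)).left_inv hy1]
      simp
    rw [(g3.congr_of_eventuallyEq g4).fderiv]
    congr 1
  have hD2 : HasFDerivAt (fderiv ℝ U) (fderiv ℝ (fderiv ℝ U) x) x :=
    ((hUs.fderiv_right (m := ∞) (by simp)).differentiableAt (by simp)).hasFDerivAt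
  have hm2 : HasFDerivAt (fderiv ℝ (chartMul (m := m) D))
      (fderiv ℝ (fderiv ℝ (chartMul (m := m) D)) (chartOne D, chartOne D)) (chartOne D, U x) := by
    rw [hUx]
    exact ((contDiffAt_chartMul_one.fderiv_right (m := ∞) (by simp)).differentiableAt
      (by simp)).hasFDerivAt
  have hθ : HasFDerivAt (mcForm (m := m) Φ) (fderiv ℝ (mcForm Φ) x) x :=
    ((contDiff_mcForm h).differentiable (by simp) x).hasFDerivAt
  have hUd := (hUs.differentiableAt (by simp)).hasFDerivAt
  have hDU : ∀ w, fderiv ℝ U x w = mcForm Φ x w := by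
    intro w
    rw [key.eq_of_nhds, hUx]
    simp [fderiv_chartMul_inl]
  have hsym := (hUs.isSymmSndFDerivAt
    (by rw [minSmoothness_of_isRCLikeNormedField]; exact ENat.LEInfty.out)).eq u v
  have formula : ∀ u v, fderiv ℝ (fderiv ℝ U) x u v =
      fderiv ℝ (fderiv ℝ (chartMul D)) (chartOne D, chartOne D) (0, mcForm Φ x u) (mcForm Φ x v, 0)
        + fderiv ℝ (mcForm Φ) x u v := by
    intro u v
    have q1 := HasFDerivAt.comp (f := fun y => ((chartOne D, U y) : Vec m × Vec m)) x hm2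
      ((hasFDerivAt_const (chartOne D) x).prodMk hUd)
    have q2 := ((hasFDerivAt_const (ContinuousLinearMap.inl ℝ (Vec m) (Vec m)) x).clm_comp hθ)
    have q3 := (q1.clm_comp q2).congr_of_eventuallyEq key
    have q4 := DFunLike.congr_fun (DFunLike.congr_fun (hD2.unique q3) u) v
    rw [q4]
    simp [hDU, hUx, fderiv_chartMul_inl, add_comm]
  rw [formula, formula] at hsym
  have s2 : IsSymmSndFDerivAt ℝ (chartMul (m := m) D) (chartOne D, chartOne D) :=
    contDiffAt_chartMul_one.isSymmSndFDerivAt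
    (by rw [minSmoothness_of_isRCLikeNormedField]; exact ENat.LEInfty.out)
  rw [bracketCLM_eq_fderiv, s2.eq (mcForm Φ x u, 0) (0, mcForm Φ x v),
    s2.eq (mcForm Φ x v, 0) (0, mcForm Φ x u), sub_eq_sub_iff_add_eq_add, add_comm, hsym, add_comm]

/-- The Maurer-Cartan equation. -/
theorem mcForm_maurerCartan {Φ : E → D} (h : ContMDiff 𝓘(ℝ, E) (𝓡 m) ∞ Φ) (x u v : E) :
    fderiv ℝ (mcForm (m := m) Φ) x u v - fderiv ℝ (mcForm (m := m) Φ) x v u =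
      bracketCLM D (mcForm (m := m) Φ x u) (mcForm (m := m) Φ x v) := by
  -- The form is right-invariant, so a right translation arranges that the value at `x` is 1.
  have h1 : ContMDiff 𝓘(ℝ, E) (𝓡 m) ∞ (fun y => Φ y * (Φ x)⁻¹) := h.mul contMDiff_const
  have h2 := mcForm_maurerCartan_of_eq_one h1 x (by simp) u v
  have h3 : mcForm (m := m) (fun y => Φ y * (Φ x)⁻¹) = mcForm Φ :=
    funext fun y => mcForm_mul_const Φ _ y
  rwa [h3] at h2
end

/-! ### The adjoint action and its derivative -/

section
variable {m : ℕ} {D : Type*} [TopologicalSpace D] [ChartedSpace (EuclideanSpace ℝ (Fin m)) D]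
  [Group D]
variable {E : Type*} [NormedAddCommGroup E] [NormedSpace ℝ E]

/-- The adjoint action as a continuous linear map. -/
def adCLM (d : D) : Vec m →L[ℝ] Vec m := mfderiv (𝓡 m) (𝓡 m) (fun x : D => d * x * d⁻¹) 1

variable [LieGroup (𝓡 m) ∞ D]

theorem mdifferentiableAt_conj (d x : D) :
    MDifferentiableAt (𝓡 m) (𝓡 m) (fun x : D => d * x * d⁻¹) x :=
  ((contMDiff_mul_right (I := 𝓡 m) (n := ∞)).comp (contMDiff_mul_left (I := 𝓡 m) (n := ∞))).mdifferentiableAt (by simp)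

theorem mDiff_conj {f : E → D} {x : E} (hf : MDifferentiableAt 𝓘(ℝ, E) (𝓡 m) f x) (h1 : f x = 1)
    (d : D) : mDiff (m := m) (fun y => d * f y * d⁻¹) x = (adCLM d).comp (mDiff f x) := by
  have h := mfderiv_comp_of_eq (I := 𝓘(ℝ, E)) (I' := 𝓡 m) (I'' := 𝓡 m) (f := f) (mdifferentiableAt_conj d 1) hf h1
  rw [h1] at h
  exact h

/-- The derivative of the multiplication at `(1, 1)` is addition. -/
theorem mDiff_mul {f g : E → D} {x : E} (hf : MDifferentiableAt 𝓘(ℝ, E) (𝓡 m) f x) (h1 : f x = 1)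
    (hg : MDifferentiableAt 𝓘(ℝ, E) (𝓡 m) g x) (h2 : g x = 1) :
    mDiff (m := m) (fun y => f y * g y) x = mDiff f x + mDiff g x := by
  have hfg : MDifferentiableAt 𝓘(ℝ, E) (𝓡 m) (fun y => f y * g y) x := by
    have := ((contMDiff_mul (𝓡 m) ∞ (G := D)).mdifferentiableAt (x := (f x, g x)) (by simp)).comp x (hf.prodMk hg)
    exact this
  refine (hasFDerivAt_extChartAt_comp hfg (by simp [h1, h2])).unique ?_
  have hd : DifferentiableAt ℝ (chartMul (m := m) D) (chartOne D, chartOne D) :=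
    contDiffAt_chartMul_one.differentiableAt (by simp)
  have e : chartMul D ∘ (fun y => (extChartAt (𝓡 m) (1 : D) (f y), extChartAt (𝓡 m) (1 : D) (g y)))
      =ᶠ[𝓝 x] (fun y => extChartAt (𝓡 m) (1 : D) (f y * g y)) := by
    have k1 : ∀ᶠ y in 𝓝 x, f y ∈ (extChartAt (𝓡 m) (1 : D)).source :=
      hf.continuousAt.eventually ((isOpen_extChartAt_source (I := 𝓡 m) (1 : D)).mem_nhds
        (by rw [h1]; exact mem_extChartAt_source 1))
    have k2 : ∀ᶠ y in 𝓝 x, g y ∈ (extChartAt (𝓡 m) (1 : D)).source :=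
      hg.continuousAt.eventually ((isOpen_extChartAt_source (I := 𝓡 m) (1 : D)).mem_nhds
        (by rw [h2]; exact mem_extChartAt_source 1))
    filter_upwards [k1, k2] with y y1 y2
    simp only [Function.comp_def, chartMul]
    rw [(extChartAt (𝓡 m) (1 : D)).left_inv y1, (extChartAt (𝓡 m) (1 : D)).left_inv y2]
  have hr : ∀ w : Vec m, fderiv ℝ (chartMul D) (chartOne D, chartOne D) (0, w) = w := by
    intro w
    have h1 := HasFDerivAt.comp (f := fun a : Vec m => ((chartOne D : Vec m), a)) (chartOne D)
      hd.hasFDerivAt (hasFDerivAt_prodMk_right _ _)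
    have h2 : HasFDerivAt (fun a : Vec m => chartMul D (chartOne D, a)) (ContinuousLinearMap.id ℝ _) (chartOne D) :=
      (hasFDerivAt_id (chartOne D)).congr_of_eventuallyEq chartMul_one_left
    simpa using DFunLike.congr_fun (h1.unique h2) w
  have g2 := (hasFDerivAt_extChartAt_comp hf h1).prodMk (hasFDerivAt_extChartAt_comp hg h2)
  have g3 := HasFDerivAt.comp (g := chartMul (m := m) D) x (by rw [h1, h2]; exact hd.hasFDerivAt) g2
  convert! g3.congr_of_eventuallyEq e.symm using 1
  ext1 w
  have : ((mDiff (m := m) f x w, mDiff (m := m) g x w) : Vec m × Vec m) = (mDiff f x w, 0) + (0, mDiff g x w) := by simp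
  simp only [add_apply, ContinuousLinearMap.comp_apply, ContinuousLinearMap.prod_apply]
  rw [this, map_add, fderiv_chartMul_inl, hr]

theorem mcForm_mul {Φ Ψ : E → D} {x : E} (h1 : MDifferentiableAt 𝓘(ℝ, E) (𝓡 m) Φ x)
    (h2 : MDifferentiableAt 𝓘(ℝ, E) (𝓡 m) Ψ x) :
    mcForm (m := m) (fun y => Φ y * Ψ y) x = mcForm Φ x + (adCLM (Φ x)).comp (mcForm Ψ x) := by
  have k1 := mdifferentiableAt_mul_const h1 (Φ x)⁻¹
  have k2 := mdifferentiableAt_mul_const h2 (Ψ x)⁻¹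
  have k3 : MDifferentiableAt 𝓘(ℝ, E) (𝓡 m) (fun y => Φ x * (Ψ y * (Ψ x)⁻¹) * (Φ x)⁻¹) x :=
    (mdifferentiableAt_conj (m := m) (Φ x) _).comp x k2
  -- The quotient splits into two factors that are both 1 at `x`; the second is a conjugate, which
  -- produces `Ad`.
  have e : (fun y => Φ y * Ψ y * (Φ x * Ψ x)⁻¹) =
      fun y => (Φ y * (Φ x)⁻¹) * (Φ x * (Ψ y * (Ψ x)⁻¹) * (Φ x)⁻¹) := by
    funext y; group
  rw [mcForm, e, mDiff_mul k1 (by simp) k3 (by simp), mDiff_conj k2 (by simp)]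
  rfl

theorem adCLM_one : adCLM (1 : D) = ContinuousLinearMap.id ℝ (Vec m) := by
  have e : (fun x : D => 1 * x * 1⁻¹) = id := by funext x; simp
  unfold adCLM
  rw [e]
  exact mfderiv_id

theorem adCLM_mul (a b : D) : adCLM (m := m) (a * b) = (adCLM a).comp (adCLM b) := by
  have e : (fun x : D => a * b * x * (a * b)⁻¹) = (fun x : D => a * x * a⁻¹) ∘ fun x : D => b * x * b⁻¹ := by
    funext x; simp only [Function.comp_apply]; group
  have h := mfderiv_comp_of_eq (I := 𝓡 m) (I' := 𝓡 m) (I'' := 𝓡 m) (x := (1 : D)) (y := (1 : D)) (mdifferentiableAt_conj a 1) (mdifferentiableAt_conj b 1) (by simp)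
  unfold adCLM
  rw [e, h]
  have : b * 1 * b⁻¹ = 1 := by simp
  rw [this]
  rfl

theorem adCLM_inv_apply (a : D) (X : Vec m) : adCLM a⁻¹ (adCLM a X) = X := by
  rw [← ContinuousLinearMap.comp_apply, ← adCLM_mul]
  simp [adCLM_one]

theorem adCLM_apply_inv (a : D) (X : Vec m) : adCLM a (adCLM a⁻¹ X) = X := by
  rw [← ContinuousLinearMap.comp_apply, ← adCLM_mul]
  simp [adCLM_one]

variable (m D) in
/-- There is a globally defined smooth map to the group that is a chart near the identity. -/
theorem exists_smooth_param : ∃ c : Vec m → D, ContMDiff 𝓘(ℝ, Vec m) (𝓡 m) ∞ c ∧ c 0 = 1 ∧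
    mcForm c 0 = ContinuousLinearMap.id ℝ (Vec m) ∧ Set.range c ∈ 𝓝 (1 : D) := by
  obtain ⟨r, hr, hball⟩ := Metric.isOpen_iff.1 (isOpen_extChartAt_target (I := 𝓡 m) (1 : D)) _
    (mem_extChartAt_target (I := 𝓡 m) (1 : D))
  let χ : ContDiffBump (0 : Vec m) := ⟨r / 4, r / 2, by positivity, by linarith⟩
  -- The cutoff is 1 on radius `r / 4` and 0 beyond `r / 2`. So `g` is a translation near 0 and
  -- never leaves the chart target, and the inverse chart can be composed with it globally.
  let g : Vec m → Vec m := fun y => chartOne D + χ y • y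
  have hg : ContDiff ℝ ∞ g := contDiff_const.add (χ.contDiff.smul contDiff_id)
  have hgt : ∀ y, g y ∈ (extChartAt (𝓡 m) (1 : D)).target := by
    intro y
    apply hball
    rw [mem_ball_iff_norm]
    have : g y - extChartAt (𝓡 m) (1 : D) 1 = χ y • y := by simp [g, chartOne]
    rw [this, norm_smul, Real.norm_of_nonneg χ.nonneg]
    by_cases hy : ‖y‖ < r / 2
    · calc χ y * ‖y‖ ≤ 1 * ‖y‖ := by gcongr; exact χ.le_one
        _ < r := by linarith
    · rw [χ.zero_of_le_dist (by simpa [χ] using hy)]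
      simpa using hr
  have hev : ∀ y ∈ Metric.ball (0 : Vec m) (r / 4), g y = chartOne D + y := by
    intro y hy
    simp [g, χ.one_of_mem_closedBall (Metric.ball_subset_closedBall hy)]
  have hc : ContMDiff 𝓘(ℝ, Vec m) (𝓡 m) ∞ (fun y => (extChartAt (𝓡 m) (1 : D)).symm (g y)) :=
    fun y => (contMDiffAt_extChartAt_symm (hgt y)).comp y hg.contMDiff.contMDiffAt
  have hc0 : (extChartAt (𝓡 m) (1 : D)).symm (g 0) = 1 := by
    rw [hev 0 (by simpa using hr), add_zero, chartOne_symm]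
  refine ⟨fun y => (extChartAt (𝓡 m) (1 : D)).symm (g y), hc, hc0, ?_, ?_⟩
  · refine (hasFDerivAt_mcForm (hc.mdifferentiableAt (by simp))).unique ?_
    refine ((hasFDerivAt_id (0 : Vec m)).const_add (chartOne D)).congr_of_eventuallyEq ?_
    filter_upwards [Metric.ball_mem_nhds (0 : Vec m) (by positivity : 0 < r / 4)] with y hy
    rw [hc0, inv_one, mul_one, (extChartAt (𝓡 m) (1 : D)).right_inv (hgt y), hev y hy]
    rfl
  · have h1 : (extChartAt (𝓡 m) (1 : D)) ⁻¹' Metric.ball (chartOne D) (r / 4) ∈ 𝓝 (1 : D) :=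
      (continuousAt_extChartAt (1 : D)).preimage_mem_nhds (Metric.ball_mem_nhds _ (by positivity))
    filter_upwards [h1, extChartAt_source_mem_nhds (I := 𝓡 m) (1 : D)] with d h1 h2
    refine ⟨extChartAt (𝓡 m) (1 : D) d - chartOne D, ?_⟩
    simp only
    rw [hev _ (by simpa [dist_eq_norm] using h1), add_sub_cancel, (extChartAt (𝓡 m) (1 : D)).left_inv h2]


/-- The derivative of the auxiliary map `(x, y) ↦ h x * c y`. -/
theorem mcForm_mul_param {h : E → D} (hh : ContMDiff 𝓘(ℝ, E) (𝓡 m) ∞ h)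
    {c : Vec m → D} (hc : ContMDiff 𝓘(ℝ, Vec m) (𝓡 m) ∞ c) (x : E) (y : Vec m) :
    mcForm (m := m) (fun p : E × Vec m => h p.1 * c p.2) (x, y) =
      (mcForm h x).comp (ContinuousLinearMap.fst ℝ E (Vec m)) +
        (adCLM (h x)).comp ((mcForm c y).comp (ContinuousLinearMap.snd ℝ E (Vec m))) := by
  have e1 := mcForm_comp (m := m) (Φ := h) (g := fun p : E × Vec m => p.1) (x := (x, y))
    (hh.mdifferentiableAt (by simp)) differentiableAt_fst
  have e2 := mcForm_comp (m := m) (Φ := c) (g := fun p : E × Vec m => p.2) (x := (x, y))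
    (hc.mdifferentiableAt (by simp)) differentiableAt_snd
  have h1 : ContMDiff 𝓘(ℝ, E × Vec m) (𝓡 m) ∞ (fun p : E × Vec m => h p.1) :=
    hh.comp contDiff_fst.contMDiff
  have h2 : ContMDiff 𝓘(ℝ, E × Vec m) (𝓡 m) ∞ (fun p : E × Vec m => c p.2) :=
    hc.comp contDiff_snd.contMDiff
  rw [mcForm_mul (h1.mdifferentiableAt (by simp)) (h2.mdifferentiableAt (by simp)), e1, e2,
    fderiv_fst, fderiv_snd]

/-- `Ad_{h x} X` is a component at `y = 0` of the Maurer-Cartan form of `(x, y) ↦ h x * c y`, whose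
smoothness is known. -/
theorem contDiff_adCLM_apply {h : E → D} (hh : ContMDiff 𝓘(ℝ, E) (𝓡 m) ∞ h) (X : Vec m) :
    ContDiff ℝ ∞ (fun x => adCLM (h x) X) := by
  obtain ⟨c, hc, -, hc1, -⟩ := exists_smooth_param m D
  have h1 : ContMDiff 𝓘(ℝ, E × Vec m) (𝓡 m) ∞ (fun p : E × Vec m => h p.1 * c p.2) :=
    (hh.comp contDiff_fst.contMDiff).mul (hc.comp contDiff_snd.contMDiff)
  have e : (fun x => adCLM (h x) X) = fun x => mcForm (m := m) (fun p : E × Vec m => h p.1 * c p.2) (x, 0) (0, X) := by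
    funext x
    rw [mcForm_mul_param hh hc, hc1]
    simp
  rw [e]
  have h2 : ContDiff ℝ ∞ (fun x : E => (x, (0 : Vec m))) := by fun_prop
  exact ((contDiff_mcForm h1).comp h2).clm_apply contDiff_const

theorem contDiff_adCLM {h : E → D} (hh : ContMDiff 𝓘(ℝ, E) (𝓡 m) ∞ h) :
    ContDiff ℝ ∞ (fun x => adCLM (m := m) (h x)) :=
  contDiff_clm_apply_iff.2 fun X => contDiff_adCLM_apply hh X

/-- This is the Maurer-Cartan equation of `(x, y) ↦ h x * c y` in the directions `(v, 0)` and `(0,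
X)`. The second derivative term drops out because the component along `(v, 0)` does not depend on
`y`. -/
theorem fderiv_adCLM {h : E → D} (hh : ContMDiff 𝓘(ℝ, E) (𝓡 m) ∞ h) (X : Vec m) (x v : E) :
    fderiv ℝ (fun x => adCLM (h x) X) x v =
      bracketCLM D (mcForm h x v) (adCLM (h x) X) := by
  obtain ⟨c, hc, -, hc1, -⟩ := exists_smooth_param m D
  set Φ : E × Vec m → D := fun p : E × Vec m => h p.1 * c p.2 with hΦ
  have h1 : ContMDiff 𝓘(ℝ, E × Vec m) (𝓡 m) ∞ Φ :=
    (hh.comp contDiff_fst.contMDiff).mul (hc.comp contDiff_snd.contMDiff)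
  have hMC := mcForm_maurerCartan h1 (x, 0) (v, 0) (0, X)
  have hd : HasFDerivAt (mcForm (m := m) Φ) (fderiv ℝ (mcForm (m := m) Φ) (x, 0)) (x, (0 : Vec m)) :=
    ((contDiff_mcForm h1).differentiable (by simp) _).hasFDerivAt
  have a1 := (HasFDerivAt.comp (f := fun x : E => (x, (0 : Vec m))) x hd (hasFDerivAt_prodMk_left x 0)).clm_apply
    (hasFDerivAt_const ((0, X) : E × Vec m) x)
  have a2 := (HasFDerivAt.comp (f := fun y : Vec m => (x, y)) 0 hd (hasFDerivAt_prodMk_right x 0)).clm_apply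
    (hasFDerivAt_const ((v, 0) : E × Vec m) 0)
  have e1 : (fun x => adCLM (h x) X) = fun x => (mcForm (m := m) Φ ∘ fun x : E => (x, (0 : Vec m))) x (0, X) := by
    funext x
    simp only [Function.comp_apply]
    rw [mcForm_mul_param hh hc, hc1]
    simp
  have e2 : (fun y => (mcForm (m := m) Φ ∘ fun y : Vec m => (x, y)) y (v, 0)) = fun _ => mcForm h x v := by
    funext y
    simp only [Function.comp_apply]
    rw [mcForm_mul_param hh hc]
    simp
  rw [e2] at a2
  have a3 := DFunLike.congr_fun (a2.unique (hasFDerivAt_const _ _)) X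
  rw [e1, a1.fderiv]
  rw [mcForm_mul_param hh hc, hc1] at hMC
  simp at a3 hMC ⊢
  rw [← hMC, a3, sub_zero]

/-- Left translation by `d` multiplies the Maurer-Cartan form of `c` by the constant `Ad_d`; compare
the Maurer-Cartan equations of `c` and `d * c` at 0. -/
theorem adCLM_bracket (d : D) (X Y : Vec m) :
    adCLM d (bracketCLM D X Y) = bracketCLM D (adCLM d X) (adCLM d Y) := by
  obtain ⟨c, hc, -, hc1, -⟩ := exists_smooth_param m D
  have h1 : ContMDiff 𝓘(ℝ, Vec m) (𝓡 m) ∞ (fun y => d * c y) := contMDiff_const.mul hc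
  have e : mcForm (m := m) (fun y => d * c y) = fun y => (adCLM d).comp (mcForm c y) := by
    funext y
    rw [mcForm_mul (Φ := fun _ => d) mdifferentiableAt_const (hc.mdifferentiableAt (by simp)), mcForm_const,
      zero_add]
  have hd : HasFDerivAt (mcForm (m := m) c) (fderiv ℝ (mcForm (m := m) c) 0) 0 :=
    ((contDiff_mcForm hc).differentiable (by simp) _).hasFDerivAt
  have hd2 := (hasFDerivAt_const (adCLM (m := m) d) (0 : Vec m)).clm_comp hd
  have m1 := mcForm_maurerCartan h1 0 X Y
  have m2 := mcForm_maurerCartan hc 0 X Y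
  rw [e, hd2.fderiv] at m1
  simp [hc1] at m1 m2
  rw [← m1, ← m2, map_sub]

end

/-! ### Homomorphisms, invariance of the form, and pull-backs of the potential -/

section
variable {m : ℕ} {D : Type*} [TopologicalSpace D] [ChartedSpace (EuclideanSpace ℝ (Fin m)) D]
  [Group D] [LieGroup (𝓡 m) ∞ D]
variable {E : Type*} [NormedAddCommGroup E] [NormedSpace ℝ E]
variable {k : ℕ} {F : Type*} [TopologicalSpace F] [ChartedSpace (EuclideanSpace ℝ (Fin k)) F]
  [Group F] [LieGroup (𝓡 k) ∞ F]

/-- Chain rule for `φ (Φ y) = φ ((Φ y (Φ x)⁻¹) Φ x)`. It connects the frame derivatives in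
`IsPotential` with derivatives along maps. -/
theorem fderiv_comp_eq_rightDeriv {φ : D → ℝ} (hφ : ContMDiff (𝓡 m) 𝓘(ℝ, ℝ) ∞ φ) {Φ : E → D}
    (hΦ : ContMDiff 𝓘(ℝ, E) (𝓡 m) ∞ Φ) (x v : E) :
    fderiv ℝ (fun y => φ (Φ y)) x v = rightDeriv (m := m) φ (mcForm Φ x v) (Φ x) := by
  have h1 : MDifferentiableAt (𝓡 m) 𝓘(ℝ, ℝ) (fun z : D => φ (z * Φ x)) 1 :=
    (hφ.comp (contMDiff_mul_right (I := 𝓡 m) (n := ∞))).mdifferentiableAt (by simp)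
  have h2 := mdifferentiableAt_mul_const (hΦ.mdifferentiableAt (x := x) (by simp)) (Φ x)⁻¹
  have h3 := mfderiv_comp_of_eq (I := 𝓘(ℝ, E)) (I' := 𝓡 m) (I'' := 𝓘(ℝ, ℝ)) h1 h2 (by simp)
  have e : (fun z : D => φ (z * Φ x)) ∘ (fun y => Φ y * (Φ x)⁻¹) = fun y => φ (Φ y) := by
    funext y; simp
  rw [e, mfderiv_eq_fderiv, mul_inv_cancel] at h3
  exact DFunLike.congr_fun h3 v

/-- The differential at the identity of a homomorphism, as a continuous linear map. -/
def lieDifferentialCLM (ι : F →* D) : Vec k →L[ℝ] Vec m := mfderiv (𝓡 k) (𝓡 m) ι 1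

theorem mcForm_hom_comp {ι : F →* D} (hι : ContMDiff (𝓡 k) (𝓡 m) ∞ ι) {f : E → F} {x : E}
    (hf : MDifferentiableAt 𝓘(ℝ, E) (𝓡 k) f x) :
    mcForm (m := m) (fun y => ι (f y)) x = (lieDifferentialCLM ι).comp (mcForm (m := k) f x) := by
  have h2 := mdifferentiableAt_mul_const hf (f x)⁻¹
  have h3 := mfderiv_comp_of_eq (I := 𝓘(ℝ, E)) (I' := 𝓡 k) (I'' := 𝓡 m) (y := (1 : F)) (g := ι)
    (hι.mdifferentiableAt (by simp)) h2 (by simp)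
  have e : ι ∘ (fun y => f y * (f x)⁻¹) = fun y => ι (f y) * (ι (f x))⁻¹ := by
    funext y; simp
  rw [e, mul_inv_cancel] at h3
  exact h3

theorem mcForm_hom_comp_mem {ι : F →* D} {𝔣 : Submodule ℝ (GroupLieAlgebra (𝓡 m) D)}
    (hι : IsLieSubgroup (m := m) (k := k) ι 𝔣) {f : E → F} {x : E}
    (hf : MDifferentiableAt 𝓘(ℝ, E) (𝓡 k) f x) (v : E) :
    (mcForm (m := m) (fun y => ι (f y)) x v : GroupLieAlgebra (𝓡 m) D) ∈ 𝔣 := by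
  rw [mcForm_hom_comp hι.smooth hf, ← hι.range_eq]
  exact ⟨mcForm (m := k) f x v, rfl⟩

/-- A function on a connected Lie group that is locally constant along all smooth maps from the
coordinate space is constant. -/
theorem eq_of_fderiv_comp_eq_zero [ConnectedSpace F] {φ : F → ℝ}
    (hd : ∀ f : Vec k → F, ContMDiff 𝓘(ℝ, Vec k) (𝓡 k) ∞ f → Differentiable ℝ (fun y => φ (f y)))
    (h0 : ∀ f : Vec k → F, ContMDiff 𝓘(ℝ, Vec k) (𝓡 k) ∞ f → ∀ x, fderiv ℝ (fun y => φ (f y)) x = 0)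
    (a b : F) : φ a = φ b := by
  have hl : IsLocallyConstant φ := by
    rw [IsLocallyConstant.iff_eventually_eq]
    intro f₀
    obtain ⟨c, hc, hc0, -, hr⟩ := exists_smooth_param k F
    -- A right translate of the smooth parametrization covers a neighbourhood of `f₀`.
    have h1 : ContMDiff 𝓘(ℝ, Vec k) (𝓡 k) ∞ (fun y => c y * f₀) := hc.mul contMDiff_const
    have hcont : Continuous fun z : F => z * f₀⁻¹ :=
      (contMDiff_mul_right (I := 𝓡 k) (n := ∞) (a := f₀⁻¹)).continuous
    have h2 : ∀ᶠ z in 𝓝 f₀, z * f₀⁻¹ ∈ Set.range c :=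
      hcont.continuousAt.eventually (by simp only [mul_inv_cancel]; exact hr)
    filter_upwards [h2] with z ⟨y, hy⟩
    have := is_const_of_fderiv_eq_zero (hd _ h1) (h0 _ h1) y 0
    simpa [hy, hc0] using this
  exact hl.apply_eq_of_preconnectedSpace a b

variable (S : DoubleAlgebra (GroupLieAlgebra (𝓡 m) D))

/-- A bilinear form on the Lie algebra as a continuous bilinear map. -/
def bilinCLM (β : LinearMap.BilinForm ℝ (GroupLieAlgebra (𝓡 m) D)) : Vec m →L[ℝ] Vec m →L[ℝ] ℝ :=
  let β' : Vec m →ₗ[ℝ] Vec m →ₗ[ℝ] ℝ := β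
  β'.toContinuousBilinearMap

/-- The bilinear form of a double as a continuous bilinear map. -/
def formCLM : Vec m →L[ℝ] Vec m →L[ℝ] ℝ := bilinCLM S.form

theorem formCLM_symm (X Y : Vec m) : formCLM S X Y = formCLM S Y X := S.symm.eq X Y

theorem formCLM_invariant (X Y Z : Vec m) :
    formCLM S (bracketCLM D X Y) Z + formCLM S Y (bracketCLM D X Z) = 0 :=
  S.invariant X Y Z

theorem bracketCLM_skew (X Y : Vec m) : bracketCLM D X Y = - bracketCLM D Y X :=
  have h : ∀ X Y : GroupLieAlgebra (𝓡 m) D, ⁅X, Y⁆ = -⁅Y, X⁆ := fun X Y => (lie_skew X Y).symm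
  h X Y

theorem formCLM_bracket_swap (X Y Z : Vec m) :
    formCLM S X (bracketCLM D Z Y) = - formCLM S X (bracketCLM D Y Z) := by
  rw [bracketCLM_skew, map_neg]

theorem formCLM_bracket_rotate (X Y Z : Vec m) :
    formCLM S Y (bracketCLM D Z X) = formCLM S X (bracketCLM D Y Z) := by
  have h := formCLM_invariant S Z X Y
  rw [formCLM_symm, formCLM_bracket_swap S X Y Z] at h
  linarith

/-- Along any smooth map the derivative of `⟨Ad X|Ad Y⟩` is `⟨[θ, Ad X]|Ad Y⟩ + ⟨Ad X|[θ, Ad Y]⟩`,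
which is zero by infinitesimal invariance. Connectedness then allows comparison with the identity.
-/
theorem formCLM_adCLM [ConnectedSpace F] {ι : F →* D} (hι : ContMDiff (𝓡 k) (𝓡 m) ∞ ι) (f : F)
    (X Y : Vec m) : formCLM S (adCLM (ι f) X) (adCLM (ι f) Y) = formCLM S X Y := by
  have key : ∀ g : Vec k → F, ContMDiff 𝓘(ℝ, Vec k) (𝓡 k) ∞ g → ∀ x,
      HasFDerivAt (fun y => formCLM S (adCLM (ι (g y)) X) (adCLM (ι (g y)) Y)) (0 : Vec k →L[ℝ] ℝ) x := by
    intro g hg x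
    have hh : ContMDiff 𝓘(ℝ, Vec k) (𝓡 m) ∞ (fun y => ι (g y)) := hι.comp hg
    have d1 : ∀ Z, HasFDerivAt (fun y => adCLM (ι (g y)) Z) (fderiv ℝ (fun y => adCLM (ι (g y)) Z) x) x :=
      fun Z => ((contDiff_adCLM_apply hh Z).differentiable (by simp) x).hasFDerivAt
    have d2 := (((formCLM S).hasFDerivAt.comp x (d1 X)).clm_apply (d1 Y))
    refine d2.congr_fderiv ?_
    ext v
    have := formCLM_invariant S (mcForm (m := m) (fun y => ι (g y)) x v) (adCLM (ι (g x)) X) (adCLM (ι (g x)) Y)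
    simp [fderiv_adCLM hh]
    linarith
  have := eq_of_fderiv_comp_eq_zero (φ := fun f => formCLM S (adCLM (ι f) X) (adCLM (ι f) Y))
    (fun g hg x => (key g hg x).differentiableAt) (fun g hg x => (key g hg x).fderiv) f 1
  simpa [adCLM_one] using this

/-- A closed smooth differential 2-form on a normed space. -/
structure IsClosedTwoForm (η : E → E →L[ℝ] E →L[ℝ] ℝ) : Prop where
  smooth : ContDiff ℝ ∞ η
  alt : ∀ x u, η x u u = 0
  closed : ∀ x u v w, fderiv ℝ η x u v w + fderiv ℝ η x v w u + fderiv ℝ η x w u v = 0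

/-- The pull-back under `Φ` of a 2-form on the group, given in the right-invariant frame. -/
def pullTwoForm (b : D → LinearMap.BilinForm ℝ (GroupLieAlgebra (𝓡 m) D)) (Φ : E → D) (x : E) :
    E →L[ℝ] E →L[ℝ] ℝ :=
  (bilinCLM (b (Φ x))).bilinearComp
    (mcForm Φ x) (mcForm Φ x)

variable {b : D → LinearMap.BilinForm ℝ (GroupLieAlgebra (𝓡 m) D)}

theorem pullTwoForm_apply (Φ : E → D) (x u v : E) :
    pullTwoForm b Φ x u v = b (Φ x) (mcForm (m := m) Φ x u) (mcForm (m := m) Φ x v) := rfl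

variable {S}

/-- The components of a potential along a map, as a family of bilinear forms. -/
theorem IsPotential.contDiff_comp (hb : IsPotential S b) {Φ : E → D}
    (hΦ : ContMDiff 𝓘(ℝ, E) (𝓡 m) ∞ Φ) :
    ContDiff ℝ ∞ (fun x => bilinCLM (b (Φ x))) :=
  contDiff_clm_apply_iff.2 fun X => contDiff_clm_apply_iff.2 fun Y => by
    have h : ContDiff ℝ ∞ (fun x => b (Φ x) X Y) := ((hb.smooth X Y).comp hΦ).contDiff
    exact h

theorem IsPotential.contDiff_pullTwoForm [FiniteDimensional ℝ E] (hb : IsPotential S b) {Φ : E → D}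
    (hΦ : ContMDiff 𝓘(ℝ, E) (𝓡 m) ∞ Φ) : ContDiff ℝ ∞ (pullTwoForm b Φ) :=
  contDiff_clm_apply_iff.2 fun _ => contDiff_clm_apply_iff.2 fun _ =>
    ((hb.contDiff_comp hΦ).clm_apply ((contDiff_mcForm hΦ).clm_apply contDiff_const)).clm_apply
      ((contDiff_mcForm hΦ).clm_apply contDiff_const)

theorem IsPotential.antisymm (hb : IsPotential S b) (d : D) (X Y : GroupLieAlgebra (𝓡 m) D) :
    b d X Y = - b d Y X := by
  have h := hb.alt d (X + Y)
  simp only [map_add, LinearMap.add_apply, hb.alt] at h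
  linarith

/-- The 6 consists of three equal cyclic terms, each with the factor 2 of `[θ ∧ θ]`. -/
theorem wzForm_eq (X Y Z : Vec m) :
    wzForm S X Y Z = 6 * formCLM S X (bracketCLM D Y Z) := by
  have e : ∀ X Y Z : Vec m, S.form X (bracketWedge (D := D) Y Z) = 2 * formCLM S X (bracketCLM D Y Z) := by
    intro X Y Z
    have : S.form X (bracketWedge (D := D) Y Z) =
      formCLM S X (bracketCLM D Y Z - bracketCLM D Z Y) := rfl
    rw [this, map_sub, formCLM_bracket_swap S X Y Z]; ring
  unfold wzForm
  rw [e, e, e, formCLM_bracket_rotate, formCLM_bracket_rotate S Y Z X, formCLM_bracket_rotate S X Y Z]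
  ring

/-- The exterior derivative commutes with pull-back. The product rule gives the frame derivatives of
`b` and terms with `Dθ`; antisymmetrized by the Maurer-Cartan equation, the latter become the
bracket terms in `IsPotential.deriv_eq`. -/
theorem IsPotential.fderiv_pullTwoForm [FiniteDimensional ℝ E] (hb : IsPotential S b) {Φ : E → D}
    (hΦ : ContMDiff 𝓘(ℝ, E) (𝓡 m) ∞ Φ) (x u v w : E) :
    fderiv ℝ (pullTwoForm b Φ) x u v w + fderiv ℝ (pullTwoForm b Φ) x v w u
      + fderiv ℝ (pullTwoForm b Φ) x w u v =
      6 * formCLM S (mcForm Φ x u) (bracketCLM D (mcForm Φ x v) (mcForm Φ x w)) := by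
  set β : E → Vec m →L[ℝ] Vec m →L[ℝ] ℝ := fun x => bilinCLM (b (Φ x)) with hβ
  have hβ' : HasFDerivAt β (fderiv ℝ β x) x :=
    ((hb.contDiff_comp hΦ).differentiable (by simp) x).hasFDerivAt
  have hθ : HasFDerivAt (mcForm (m := m) Φ) (fderiv ℝ (mcForm Φ) x) x :=
    ((contDiff_mcForm hΦ).differentiable (by simp) x).hasFDerivAt
  have hp : HasFDerivAt (pullTwoForm b Φ) (fderiv ℝ (pullTwoForm b Φ) x) x :=
    ((hb.contDiff_pullTwoForm hΦ).differentiable (by simp) x).hasFDerivAt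
  have hr : ∀ u (X Y : Vec m), fderiv ℝ β x u X Y =
      rightDeriv (m := m) (fun d => b d X Y) (mcForm Φ x u) (Φ x) := by
    intro u X Y
    rw [← fderiv_comp_eq_rightDeriv (hb.smooth X Y) hΦ]
    have h1 := (hβ'.clm_apply (hasFDerivAt_const X x)).clm_apply (hasFDerivAt_const Y x)
    have h2 : fderiv ℝ (fun y => b (Φ y) X Y) x = _ := h1.fderiv
    rw [h2]; simp
  have hd : ∀ u v w, fderiv ℝ (pullTwoForm b Φ) x u v w =
      rightDeriv (m := m) (fun d => b d (mcForm (m := m) Φ x v) (mcForm (m := m) Φ x w)) (mcForm Φ x u) (Φ x)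
      + β x (fderiv ℝ (mcForm Φ) x u v) (mcForm Φ x w)
      + β x (mcForm Φ x v) (fderiv ℝ (mcForm Φ) x u w) := by
    intro u v w
    have h1 := (hp.clm_apply (hasFDerivAt_const v x)).clm_apply (hasFDerivAt_const w x)
    have h2 := (hβ'.clm_apply (hθ.clm_apply (hasFDerivAt_const v x))).clm_apply
      (hθ.clm_apply (hasFDerivAt_const w x))
    have h3 := DFunLike.congr_fun (h1.unique (show HasFDerivAt (fun y => pullTwoForm b Φ y v w) _ x from h2)) u
    simp at h3
    rw [h3, hr]; ring
  have hanti : ∀ X Y, β x X Y = - β x Y X := fun X Y => hb.antisymm (Φ x) X Y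
  have M : ∀ u v, fderiv ℝ (mcForm (m := m) Φ) x u v = fderiv ℝ (mcForm (m := m) Φ) x v u +
      bracketCLM D (mcForm (m := m) Φ x u) (mcForm (m := m) Φ x v) := fun u v => by
    rw [← mcForm_maurerCartan hΦ]; abel
  have hde := hb.deriv_eq (Φ x) (mcForm (m := m) Φ x u) (mcForm (m := m) Φ x v) (mcForm (m := m) Φ x w)
  rw [wzForm_eq] at hde
  rw [← hde, hd, hd, hd, M u v, M v w, M w u, map_add, map_add, map_add, add_apply, add_apply,
    add_apply, hanti (mcForm Φ x v), hanti (mcForm Φ x w) (fderiv ℝ (mcForm Φ) x v u),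
    hanti (mcForm Φ x u) (fderiv ℝ (mcForm Φ) x w v)]
  have e : ∀ X Y Z : Vec m, β x (bracketCLM D X Y) Z =
    b (Φ x) (⁅(show GroupLieAlgebra (𝓡 m) D from X), (show GroupLieAlgebra (𝓡 m) D from Y)⁆ : GroupLieAlgebra (𝓡 m) D) Z := fun _ _ _ => rfl
  rw [e, e, e]
  ring
end

/-! ### Linear algebra of `ℛ`, `ℛ^⊥`, `ℱ` and `K`, and operators preserving them -/

namespace DoubleAlgebra
section
variable {𝔡 : Type*} [LieRing 𝔡] [LieAlgebra ℝ 𝔡] (S : DoubleAlgebra 𝔡) [FiniteDimensional ℝ 𝔡]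
  (R : S.GHat →ₗ[ℝ] S.G)

theorem mem_rSpace {X : 𝔡} : X ∈ S.rSpace R ↔ ∃ γ : S.GHat, (γ : 𝔡) + R γ = X := by
  simp [rSpace]

theorem mem_rPerp {X : 𝔡} : X ∈ S.rPerp R ↔ ∃ γ : S.GHat, (γ : 𝔡) - S.adjoint R γ = X := by
  simp [rPerp]

theorem form_rSpace_rPerp {X Y : 𝔡} (hX : X ∈ S.rSpace R) (hY : Y ∈ S.rPerp R) :
    S.form X Y = 0 := by
  obtain ⟨γ, rfl⟩ := (S.mem_rSpace R).1 hX
  obtain ⟨δ, rfl⟩ := (S.mem_rPerp R).1 hY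
  have i1 := S.isotropic_gHat _ γ.2 _ δ.2
  have i2 := S.isotropic_g _ (R γ).2 _ (S.adjoint R δ).2
  have e := S.form_adjoint R δ γ
  simp only [map_add, map_sub, LinearMap.add_apply, i1, i2]
  linarith

/-- Pairing `δ + x` with every `γ + Rγ` determines the `𝒢`-part, because `𝒢` embeds in the dual of
`𝒢̂`; this forces `x = -R*δ`. -/
theorem mem_rPerp_iff {X : 𝔡} : X ∈ S.rPerp R ↔ ∀ Y ∈ S.rSpace R, S.form Y X = 0 := by
  refine ⟨fun hX Y hY => S.form_rSpace_rPerp R hY hX, fun h => ?_⟩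
  obtain ⟨x, δ, rfl⟩ := S.exists_add X
  rw [mem_rPerp]
  refine ⟨δ, ?_⟩
  have : x + S.adjoint R δ = 0 := by
    apply S.toDual_injective
    rw [map_zero]
    ext γ
    change S.form ((x + S.adjoint R δ : S.G) : 𝔡) γ = 0
    have h1 := h _ ((S.mem_rSpace R).2 ⟨γ, rfl⟩)
    have i1 := S.isotropic_gHat _ γ.2 _ δ.2
    have i2 := S.isotropic_g _ (R γ).2 _ x.2
    have e := S.form_adjoint R δ γ
    simp only [map_add, LinearMap.add_apply, i1, i2] at h1
    rw [S.symm.eq, Submodule.coe_add, map_add]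
    linarith
  rw [eq_neg_of_add_eq_zero_left this]
  simp [sub_eq_add_neg]

/-- Directness of `𝒢 ⊕ 𝒢̂` turns `γ + Rγ = δ - R*δ` into `γ = δ` and `(R + R*)γ = 0`. -/
theorem mem_fSpace_iff {X : 𝔡} : X ∈ S.fSpace R ↔ X ∈ S.rSpace R ∧ X ∈ S.rPerp R := by
  constructor
  · rintro ⟨γ, hγ, rfl⟩
    refine ⟨⟨γ, rfl⟩, (S.mem_rPerp R).2 ⟨γ, ?_⟩⟩
    have h : R γ + S.adjoint R γ = 0 := LinearMap.mem_ker.1 hγ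
    simp [eq_neg_of_add_eq_zero_left h, sub_eq_add_neg]
  · rintro ⟨h1, h2⟩
    obtain ⟨γ, rfl⟩ := (S.mem_rSpace R).1 h1
    obtain ⟨δ, hδ⟩ := (S.mem_rPerp R).1 h2
    have h3 : ((δ - γ : S.GHat) : 𝔡) = ((R γ + S.adjoint R δ : S.G) : 𝔡) := by
      simp only [Submodule.coe_add, Submodule.coe_sub]
      rw [sub_eq_iff_eq_add] at hδ
      rw [hδ]; abel
    have h4 : ((δ - γ : S.GHat) : 𝔡) = 0 :=
      Submodule.disjoint_def.1 S.isCompl.disjoint _ (by rw [h3]; exact Subtype.prop _)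
        (Subtype.prop _)
    have h5 : δ = γ := sub_eq_zero.1 (Subtype.ext h4)
    rw [h4] at h3
    refine ⟨γ, ?_, by simp⟩
    have h6 : R γ + S.adjoint R δ = 0 := Subtype.ext h3.symm
    rw [h5] at h6
    exact h6

theorem fSpace_isotropic {X Y : 𝔡} (hX : X ∈ S.fSpace R) (hY : Y ∈ S.fSpace R) :
    S.form X Y = 0 :=
  S.form_rSpace_rPerp R ((S.mem_fSpace_iff R).1 hX).1 ((S.mem_fSpace_iff R).1 hY).2

theorem exists_rSpace_add_rPerp {X : 𝔡} (hX : X ∈ S.fPerp R) :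
    ∃ P ∈ S.rSpace R, ∃ M ∈ S.rPerp R, P + M = X := by
  rw [← range_combine] at hX
  obtain ⟨⟨a, c⟩, rfl⟩ := hX
  refine ⟨_, (S.mem_rSpace R).2 ⟨a, rfl⟩, _, (S.mem_rPerp R).2 ⟨c, rfl⟩, ?_⟩
  rw [combine_apply]; abel

/-- By isotropy `⟨P|P⟩ = 2⟨a|Ra⟩` and `⟨M|M⟩ = -2⟨c|R*c⟩ = -2⟨c|Rc⟩`. Thus `K` depends only on the
form and the two subspaces, and isometries preserving them preserve `K`. -/
theorem K_add {P M : 𝔡} (hP : P ∈ S.rSpace R) (hM : M ∈ S.rPerp R) :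
    S.K R (P + M) = S.form P P - S.form M M := by
  obtain ⟨a, rfl⟩ := (S.mem_rSpace R).1 hP
  obtain ⟨c, rfl⟩ := (S.mem_rPerp R).1 hM
  have e : (a : 𝔡) + R a + ((c : 𝔡) - S.adjoint R c) = (a : 𝔡) + c + R a - S.adjoint R c := by abel
  rw [e, K_eq]
  have i1 := S.isotropic_gHat _ a.2 _ a.2
  have i2 := S.isotropic_gHat _ c.2 _ c.2
  have i3 := S.isotropic_g _ (R a).2 _ (R a).2
  have i4 := S.isotropic_g _ (S.adjoint R c).2 _ (S.adjoint R c).2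
  have s1 := S.symm.eq (a : 𝔡) (R a : 𝔡)
  have s2 := S.symm.eq (c : 𝔡) (R c : 𝔡)
  have s3 := S.symm.eq (c : 𝔡) (S.adjoint R c : 𝔡)
  have e2 := S.form_adjoint R c c
  simp only [map_add, map_sub, LinearMap.add_apply, LinearMap.sub_apply, i1, i2, i3, i4]
  linarith

/-- `ℱ` lies in the radical of `K`: `Y` is absorbed into the `ℛ`-component, is null, and is
orthogonal to `ℛ`. -/
theorem K_add_of_mem_fSpace {X Y : 𝔡} (hX : X ∈ S.fPerp R) (hY : Y ∈ S.fSpace R) :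
    S.K R (Y + X) = S.K R X := by
  obtain ⟨P, hP, M, hM, rfl⟩ := S.exists_rSpace_add_rPerp R hX
  have hY' := (S.mem_fSpace_iff R).1 hY
  rw [← add_assoc, S.K_add R (add_mem hY'.1 hP) hM, S.K_add R hP hM]
  have e1 := S.form_rSpace_rPerp R hY'.1 hY'.2
  have e2 := S.form_rSpace_rPerp R hP hY'.2
  have s1 := S.symm.eq P Y
  simp only [map_add, LinearMap.add_apply]
  linarith

theorem add_eq_of_mem (X : 𝔡) : S.JHat X + S.J X = X := by
  obtain ⟨x, a, rfl⟩ := S.exists_add X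
  simp [J, JHat]

variable {R} {A A' : 𝔡 →ₗ[ℝ] 𝔡}

/-- On `γ ∈ 𝒢̂` the condition reads `J A(γ + Rγ) = R Ĵ A(γ + Rγ)`, which says that `A(γ + Rγ)` lies
on the graph of `R`. -/
theorem DressingCondition.apply_mem_rSpace (h : S.DressingCondition R A) {X : 𝔡}
    (hX : X ∈ S.rSpace R) : A X ∈ S.rSpace R := by
  obtain ⟨γ, rfl⟩ := (S.mem_rSpace R).1 hX
  have h1 := LinearMap.congr_fun h (γ : 𝔡)
  have e1 : S.JHat (γ : 𝔡) = γ := by simp [JHat]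
  have e2 : S.extend R (γ : 𝔡) = R γ := by simp [extend]
  have e3 : ∀ Y, S.J (S.extend R Y) = S.extend R Y := fun Y => by simp [extend, J]
  simp only [LinearMap.add_apply, LinearMap.comp_apply, LinearMap.sub_apply, e1, e2, map_sub, e3] at h1
  rw [mem_rSpace]
  refine ⟨S.GHat.projectionOnto S.G S.isCompl.symm (A (γ + R γ)), ?_⟩
  have e4 : ((R (S.GHat.projectionOnto S.G S.isCompl.symm (A (γ + R γ))) : S.G) : 𝔡) =
      S.J (A (γ + R γ)) := by
    change S.extend R (A (γ + R γ)) = _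
    simp only [map_add]
    rw [← h1]; abel
  rw [e4]
  exact S.add_eq_of_mem _


variable (R A A') in
/-- Two mutually inverse isometries that preserve `ℛ`. -/
structure IsDressingPair : Prop where
  mem : ∀ X ∈ S.rSpace R, A X ∈ S.rSpace R
  mem_inv : ∀ X ∈ S.rSpace R, A' X ∈ S.rSpace R
  apply_inv : ∀ X, A (A' X) = X
  inv_apply : ∀ X, A' (A X) = X
  form_apply : ∀ X Y, S.form (A X) (A Y) = S.form X Y

namespace IsDressingPair
variable {S}

theorem symm (h : S.IsDressingPair R A A') : S.IsDressingPair R A' A :=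
  ⟨h.mem_inv, h.mem, h.inv_apply, h.apply_inv, fun X Y => by
    rw [← h.form_apply, h.apply_inv, h.apply_inv]⟩

theorem mem_rPerp (h : S.IsDressingPair R A A') {X : 𝔡} (hX : X ∈ S.rPerp R) : A X ∈ S.rPerp R := by
  rw [mem_rPerp_iff] at hX ⊢
  intro Y hY
  rw [← h.apply_inv Y, h.form_apply]
  exact hX _ (h.mem_inv Y hY)

theorem map_rSpace (h : S.IsDressingPair R A A') : (S.rSpace R).map A = S.rSpace R := by
  apply le_antisymm
  · rintro _ ⟨X, hX, rfl⟩
    exact h.mem X hX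
  · exact fun X hX => ⟨A' X, h.mem_inv X hX, h.apply_inv X⟩

theorem map_rPerp (h : S.IsDressingPair R A A') : (S.rPerp R).map A = S.rPerp R := by
  apply le_antisymm
  · rintro _ ⟨X, hX, rfl⟩
    exact h.mem_rPerp hX
  · exact fun X hX => ⟨A' X, h.symm.mem_rPerp hX, h.apply_inv X⟩

theorem mem_fSpace (h : S.IsDressingPair R A A') {X : 𝔡} (hX : X ∈ S.fSpace R) : A X ∈ S.fSpace R := by
  rw [mem_fSpace_iff] at hX ⊢
  exact ⟨h.mem X hX.1, h.mem_rPerp hX.2⟩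

theorem mem_fPerp (h : S.IsDressingPair R A A') {X : 𝔡} (hX : X ∈ S.fPerp R) : A X ∈ S.fPerp R := by
  intro Y hY
  rw [← h.apply_inv Y]
  exact (h.form_apply _ _).trans (hX _ (h.symm.mem_fSpace hY))

theorem K_apply (h : S.IsDressingPair R A A') {X : 𝔡} (hX : X ∈ S.fPerp R) : S.K R (A X) = S.K R X := by
  obtain ⟨P, hP, M, hM, rfl⟩ := S.exists_rSpace_add_rPerp R hX
  rw [map_add, S.K_add R (h.mem P hP) (h.mem_rPerp hM), S.K_add R hP hM, h.form_apply, h.form_apply]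

end IsDressingPair
end
end DoubleAlgebra

/-! ### The 2-form measuring the change of the action is closed -/

section
variable {m : ℕ} {D : Type*} [TopologicalSpace D] [ChartedSpace (EuclideanSpace ℝ (Fin m)) D]
  [Group D] [LieGroup (𝓡 m) ∞ D]
variable {E : Type*} [NormedAddCommGroup E] [NormedSpace ℝ E]
variable (S : DoubleAlgebra (GroupLieAlgebra (𝓡 m) D))
  (b : D → LinearMap.BilinForm ℝ (GroupLieAlgebra (𝓡 m) D))

/-- The change of `6 ⟨dl l⁻¹ ∧, dl l⁻¹⟩ + b` under `l ↦ h l`, up to terms that cancel. -/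
def gaugeTwoForm (h l : E → D) (x : E) : E →L[ℝ] E →L[ℝ] ℝ :=
  pullTwoForm b (fun y => h y * l y) x - pullTwoForm b l x +
    (6 : ℝ) • ((formCLM S).bilinearComp (mcForm h x) (mcForm (fun y => h y * l y) x - mcForm h x) -
      ((formCLM S).bilinearComp (mcForm h x) (mcForm (fun y => h y * l y) x - mcForm h x)).flip)

theorem gaugeTwoForm_apply (h l : E → D) (x u v : E) :
    gaugeTwoForm S b h l x u v = pullTwoForm b (fun y => h y * l y) x u v - pullTwoForm b l x u v +
    6 * (formCLM S (mcForm h x u) (mcForm (fun y => h y * l y) x v - mcForm h x v) -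
      formCLM S (mcForm h x v) (mcForm (fun y => h y * l y) x u - mcForm h x u)) := rfl

variable {S b}

theorem IsPotential.pullTwoForm_self (hb : IsPotential S b) (Φ : E → D) (x u : E) :
    pullTwoForm b Φ x u u = 0 := hb.alt _ _

variable (S) in
/-- The total antisymmetry of `⟨X|[Y, Z]⟩`. -/
theorem formCLM_bracket_perm (X Y Z : Vec m) :
    (formCLM S Y (bracketCLM D Z X) = formCLM S X (bracketCLM D Y Z) ∧
    formCLM S Z (bracketCLM D X Y) = formCLM S X (bracketCLM D Y Z) ∧
    formCLM S X (bracketCLM D Z Y) = -formCLM S X (bracketCLM D Y Z) ∧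
    formCLM S Y (bracketCLM D X Z) = -formCLM S X (bracketCLM D Y Z) ∧
    formCLM S Z (bracketCLM D Y X) = -formCLM S X (bracketCLM D Y Z)) ∧
    (formCLM S (bracketCLM D Z X) Y = formCLM S X (bracketCLM D Y Z) ∧
    formCLM S (bracketCLM D X Y) Z = formCLM S X (bracketCLM D Y Z) ∧
    formCLM S (bracketCLM D Y Z) X = formCLM S X (bracketCLM D Y Z)) := by
  have r := formCLM_bracket_rotate S
  have s := formCLM_bracket_swap S
  have e1 := r X Y Z
  have e2 := r Y Z X
  refine ⟨⟨e1, e2.trans e1, s X Y Z, ?_, ?_⟩, ?_, ?_, formCLM_symm S _ _⟩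
  · rw [s, e1]
  · rw [s, e2, e1]
  · rw [formCLM_symm, e1]
  · rw [formCLM_symm, e2, e1]

/-- Write `θ = φ + Y` with `Y = Ad_h (dl l⁻¹)`. The difference of the pulled back 3-forms is the
cubic `⟨θ|[θ, θ]⟩` minus `⟨Y|[Y, Y]⟩`. Its mixed terms cancel against the derivative of the `⟨φ ∧
Y⟩` term, and what is left is a multiple of `⟨φ|[φ, φ]⟩`, zero by `hf`. -/
theorem isClosedTwoForm_gaugeTwoForm [FiniteDimensional ℝ E] (hb : IsPotential S b) {h l : E → D}
    (hh : ContMDiff 𝓘(ℝ, E) (𝓡 m) ∞ h) (hl : ContMDiff 𝓘(ℝ, E) (𝓡 m) ∞ l)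
    (hf : ∀ x u v w, formCLM S (mcForm h x u) (bracketCLM D (mcForm h x v) (mcForm h x w)) = 0)
    (hAd : ∀ x X Y, formCLM S (adCLM (h x) X) (adCLM (h x) Y) = formCLM S X Y) :
    IsClosedTwoForm (gaugeTwoForm S b h l) := by
  have hhl : ContMDiff 𝓘(ℝ, E) (𝓡 m) ∞ (fun y => h y * l y) := hh.mul hl
  set θ : E → E →L[ℝ] Vec m := mcForm (fun y => h y * l y) with hθ
  set φ : E → E →L[ℝ] Vec m := mcForm h with hφ
  have sθ : ContDiff ℝ ∞ θ := contDiff_mcForm hhl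
  have sφ : ContDiff ℝ ∞ φ := contDiff_mcForm hh
  have sm : ContDiff ℝ ∞ (gaugeTwoForm S b h l) := by
    refine contDiff_clm_apply_iff.2 fun u => contDiff_clm_apply_iff.2 fun v => ?_
    simp only [gaugeTwoForm_apply]
    have p1 : ∀ u v, ContDiff ℝ ∞ (fun x => formCLM S (φ x u) (θ x v - φ x v)) := fun u v =>
      ((formCLM S).contDiff.comp (sφ.clm_apply contDiff_const)).clm_apply
        ((sθ.clm_apply contDiff_const).sub (sφ.clm_apply contDiff_const))
    exact ((((hb.contDiff_pullTwoForm hhl).clm_apply contDiff_const).clm_apply contDiff_const).sub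
      (((hb.contDiff_pullTwoForm hl).clm_apply contDiff_const).clm_apply contDiff_const)).add
      (contDiff_const.mul ((p1 u v).sub (p1 v u)))
  refine ⟨sm, fun x u => ?_, fun x u v w => ?_⟩
  · rw [gaugeTwoForm_apply, hb.pullTwoForm_self, hb.pullTwoForm_self]; ring
  have dθ : HasFDerivAt θ (fderiv ℝ θ x) x := (sθ.differentiable (by simp) x).hasFDerivAt
  have dφ : HasFDerivAt φ (fderiv ℝ φ x) x := (sφ.differentiable (by simp) x).hasFDerivAt
  have dg : HasFDerivAt (gaugeTwoForm S b h l) (fderiv ℝ (gaugeTwoForm S b h l) x) x :=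
    (sm.differentiable (by simp) x).hasFDerivAt
  have d1 : HasFDerivAt (pullTwoForm b (fun y => h y * l y)) _ x :=
    ((hb.contDiff_pullTwoForm hhl).differentiable (by simp) x).hasFDerivAt
  have d2 : HasFDerivAt (pullTwoForm b l) _ x :=
    ((hb.contDiff_pullTwoForm hl).differentiable (by simp) x).hasFDerivAt
  have hd : ∀ u v w, fderiv ℝ (gaugeTwoForm S b h l) x u v w =
      fderiv ℝ (pullTwoForm b (fun y => h y * l y)) x u v w - fderiv ℝ (pullTwoForm b l) x u v w +
      6 * (formCLM S (fderiv ℝ φ x u v) (θ x w - φ x w)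
        + formCLM S (φ x v) (fderiv ℝ θ x u w - fderiv ℝ φ x u w)
        - formCLM S (fderiv ℝ φ x u w) (θ x v - φ x v)
        - formCLM S (φ x w) (fderiv ℝ θ x u v - fderiv ℝ φ x u v)) := by
    intro u v w
    have ap : ∀ {L : E → E →L[ℝ] Vec m} {L' : E →L[ℝ] E →L[ℝ] Vec m} (_ : HasFDerivAt L L' x) (v : E),
        HasFDerivAt (fun y => L y v) (L'.flip v) x := fun hL v => by
      simpa using hL.clm_apply (hasFDerivAt_const v x)
    have ap2 : ∀ {L : E → E →L[ℝ] E →L[ℝ] ℝ} {L' : E →L[ℝ] E →L[ℝ] E →L[ℝ] ℝ} (_ : HasFDerivAt L L' x) (v w : E),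
        HasFDerivAt (fun y => L y v w) ((L'.flip v).flip w) x := fun hL v w => by
      simpa using (hL.clm_apply (hasFDerivAt_const v x)).clm_apply (hasFDerivAt_const w x)
    have q : ∀ v w, HasFDerivAt (fun y => formCLM S (φ y v) (θ y w - φ y w)) _ x := fun v w =>
      ((formCLM S).hasFDerivAt.comp x (ap dφ v)).clm_apply ((ap dθ w).sub (ap dφ w))
    have h2 := (((ap2 d1 v w).sub (ap2 d2 v w)).add (((q v w).sub (q w v)).const_mul 6))
    have h3 := DFunLike.congr_fun ((ap2 dg v w).unique h2) u
    simp at h3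
    rw [h3]
    simp
    ring
  have Mθ : ∀ u v, fderiv ℝ θ x u v = fderiv ℝ θ x v u + bracketCLM D (θ x u) (θ x v) := fun u v => by
    rw [hθ, ← mcForm_maurerCartan hhl]; abel
  have Mφ : ∀ u v, fderiv ℝ φ x u v = fderiv ℝ φ x v u + bracketCLM D (φ x u) (φ x v) := fun u v => by
    rw [hφ, ← mcForm_maurerCartan hh]; abel
  have P1 := hb.fderiv_pullTwoForm hhl x u v w
  have P2 := hb.fderiv_pullTwoForm hl x u v w
  have hY : ∀ u, θ x u = φ x u + adCLM (h x) (mcForm l x u) := fun u => by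
    rw [hθ, mcForm_mul (hh.mdifferentiableAt (by simp)) (hl.mdifferentiableAt (by simp))]; rfl
  -- `Ad` preserves both bracket and form, so the 3-form of `l` may be computed on `Y`.
  have hYY : formCLM S (mcForm l x u) (bracketCLM D (mcForm l x v) (mcForm l x w)) =
      formCLM S (θ x u - φ x u) (bracketCLM D (θ x v - φ x v) (θ x w - φ x w)) := by
    rw [hY u, hY v, hY w]
    simp only [add_sub_cancel_left]
    rw [← adCLM_bracket, hAd]
  rw [hYY] at P2
  rw [← hθ] at P1
  rw [hd, hd, hd, Mθ u v, Mθ v w, Mθ w u, Mφ u v, Mφ v w, Mφ w u]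
  have h0 := hf x u v w
  -- Total antisymmetry brings every triple product to a standard order of its arguments; the rest
  -- is linear.
  simp only [map_add, map_sub, add_apply, sub_apply,
    formCLM_bracket_perm S (φ x u) (φ x v) (φ x w),
    formCLM_bracket_perm S (φ x u) (φ x v) (θ x w),
    formCLM_bracket_perm S (φ x u) (θ x v) (φ x w),
    formCLM_bracket_perm S (θ x u) (φ x v) (φ x w),
    formCLM_bracket_perm S (θ x u) (φ x v) (θ x w),
    formCLM_bracket_perm S (θ x u) (θ x v) (φ x w)] at P1 P2 h0 ⊢
  linarith
end

/-! ### Homotopy invariance on the plane and integration of periodic functions -/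

section
variable {E : Type*} [NormedAddCommGroup E] [NormedSpace ℝ E]

theorem setIntegral_swap_of_continuous {E₁ E₂ : Type*} [NormedAddCommGroup E₁] [NormedSpace ℝ E₁]
    [FiniteDimensional ℝ E₁] [MeasurableSpace E₁] [BorelSpace E₁]
    [NormedAddCommGroup E₂] [NormedSpace ℝ E₂] [FiniteDimensional ℝ E₂] [MeasurableSpace E₂]
    [BorelSpace E₂] (μ : Measure E₁) (ν : Measure E₂) [IsLocallyFiniteMeasure μ]
    [IsLocallyFiniteMeasure ν] {A : Set E₁} {B : Set E₂} (hA : Bornology.IsBounded A)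
    (hB : Bornology.IsBounded B) {G : E₁ × E₂ → ℝ} (hG : Continuous G) :
    ∫ x in A, ∫ y in B, G (x, y) ∂ν ∂μ = ∫ y in B, ∫ x in A, G (x, y) ∂μ ∂ν := by
  have := FiniteDimensional.proper ℝ E₁
  have := FiniteDimensional.proper ℝ E₂
  refine integral_integral_swap (f := fun x y => G (x, y)) ?_
  rw [Measure.prod_restrict]
  have hK : IsCompact (closure A ×ˢ closure B) := hA.isCompact_closure.prod hB.isCompact_closure
  exact (hG.continuousOn.integrableOn_compact hK).mono_set
    (Set.prod_mono subset_closure subset_closure)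

theorem sub_eq_integral_fderiv {g : E → ℝ} (hg : ContDiff ℝ ∞ g) (x v : E) :
    g (x + v) - g x = ∫ t in Set.Ioc (0 : ℝ) 1, fderiv ℝ g (x + t • v) v := by
  have h : ∀ t ∈ Set.uIcc (0 : ℝ) 1, HasDerivAt (fun t : ℝ => g (x + t • v)) (fderiv ℝ g (x + t • v) v) t := by
    intro t _
    have h1 : HasDerivAt (fun t : ℝ => x + t • v) v t := by
      simpa using ((hasDerivAt_id t).smul_const v).const_add x
    exact ((hg.differentiable (by simp) _).hasFDerivAt).comp_hasDerivAt t h1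
  have hc : Continuous fun t : ℝ => fderiv ℝ g (x + t • v) v :=
    (((hg.continuous_fderiv (by simp)).comp (by fun_prop : Continuous fun t : ℝ => x + t • v))).clm_apply continuous_const
  have := intervalIntegral.integral_eq_sub_of_hasDerivAt h (hc.intervalIntegrable _ _)
  rw [← intervalIntegral.integral_of_le zero_le_one, this]
  simp

theorem integral_fderiv_eq_zero_of_hasCompactSupport [FiniteDimensional ℝ E] [MeasurableSpace E]
    [BorelSpace E] (μ : Measure E) [μ.IsAddHaarMeasure] {g : E → ℝ} (hg : ContDiff ℝ ∞ g)
    (hc : HasCompactSupport g) (v : E) : ∫ x, fderiv ℝ g x v ∂μ = 0 := by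
  have hcont : Continuous fun x => fderiv ℝ g x v :=
    (hg.continuous_fderiv (by simp)).clm_apply continuous_const
  have h1 : Integrable (fun x => fderiv ℝ g x v) μ :=
    hcont.integrable_of_hasCompactSupport (hc.fderiv_apply (𝕜 := ℝ) v)
  have h2 : Integrable g μ := hg.continuous.integrable_of_hasCompactSupport hc
  have := integral_smul_fderiv_eq_neg_fderiv_smul_of_integrable (𝕜 := ℝ) (μ := μ) (f := fun _ => (1 : ℝ))
    (g := g) (v := v) (by simp) (by simpa using h1) (by simpa using h2)
    (fun x _ => by fun_prop) (fun x _ => hg.differentiable (by simp) x)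
  simpa using this

theorem fderiv_clm_apply_const₂ {η : E → E →L[ℝ] E →L[ℝ] ℝ} (hη : ContDiff ℝ ∞ η) (x u v w : E) :
    fderiv ℝ (fun y => η y v w) x u = fderiv ℝ η x u v w := by
  have h := (hη.differentiable (by simp) x).hasFDerivAt
  have h1 := (h.clm_apply (hasFDerivAt_const v x)).clm_apply (hasFDerivAt_const w x)
  rw [h1.fderiv]
  simp

/-- Homotopy invariance of the integral of a closed 2-form that is compactly supported in the
directions of the plane. -/
theorem IsClosedTwoForm.integral_eq {η : ℝ × (ℝ × ℝ) → ℝ × (ℝ × ℝ) →L[ℝ] ℝ × (ℝ × ℝ) →L[ℝ] ℝ}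
    (hη : IsClosedTwoForm η) {K : Set (ℝ × ℝ)} (hK : IsCompact K)
    (h0 : ∀ t, ∀ x ∉ K, η (t, x) = 0) :
    ∫ x, η (1, x) (0, (1, 0)) (0, (0, 1)) = ∫ x, η (0, x) (0, (1, 0)) (0, (0, 1)) := by
  set eσ : ℝ × (ℝ × ℝ) := (0, (1, 0))
  set eτ : ℝ × (ℝ × ℝ) := (0, (0, 1))
  set eT : ℝ × (ℝ × ℝ) := (1, 0)
  have sm : ∀ u v, ContDiff ℝ ∞ (fun p => η p u v) := fun u v =>
    (hη.smooth.clm_apply contDiff_const).clm_apply contDiff_const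
  have hg : ∀ (t : ℝ) (u v : ℝ × (ℝ × ℝ)), ContDiff ℝ ∞ (fun x : ℝ × ℝ => η (t, x) u v) := fun t u v =>
    (sm u v).comp (contDiff_const.prodMk contDiff_id)
  have hs : ∀ (t : ℝ) (u v : ℝ × (ℝ × ℝ)), HasCompactSupport (fun x : ℝ × ℝ => η (t, x) u v) := fun t u v =>
    HasCompactSupport.intro hK fun x hx => by simp [h0 t x hx]
  have hi : ∀ (t : ℝ) (u v : ℝ × (ℝ × ℝ)), Integrable (fun x : ℝ × ℝ => η (t, x) u v) := fun t u v =>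
    (hg t u v).continuous.integrable_of_hasCompactSupport (hs t u v)
  have hslice : ∀ (t : ℝ) (u v : ℝ × (ℝ × ℝ)) (x w : ℝ × ℝ),
      fderiv ℝ (fun x : ℝ × ℝ => η (t, x) u v) x w = fderiv ℝ η (t, x) (0, w) u v := by
    intro t u v x w
    rw [← fderiv_clm_apply_const₂ hη.smooth]
    have h1 := (((sm u v).differentiable (by simp) (t, x)).hasFDerivAt).comp x
      (hasFDerivAt_prodMk_right t x)
    have h2 : fderiv ℝ (fun x : ℝ × ℝ => η (t, x) u v) x = _ := h1.fderiv
    rw [h2]; simp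
  rw [← sub_eq_zero, ← integral_sub (hi _ _ _) (hi _ _ _)]
  have key : ∀ x : ℝ × ℝ, η (1, x) eσ eτ - η (0, x) eσ eτ =
      ∫ t in Set.Ioc (0 : ℝ) 1, fderiv ℝ η (t, x) eT eσ eτ := by
    intro x
    have := sub_eq_integral_fderiv (sm eσ eτ) (0, x) eT
    simpa [eT, fderiv_clm_apply_const₂ hη.smooth] using this
  have hz : ∀ t : ℝ, ∫ x in K, fderiv ℝ η (t, x) eT eσ eτ = 0 := by
    intro t
    -- Closedness turns the homotopy derivative into a divergence in the plane, which integrates to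
    -- zero by compact support.
    have e : ∀ x : ℝ × ℝ, fderiv ℝ η (t, x) eT eσ eτ =
        - (fderiv ℝ (fun x : ℝ × ℝ => η (t, x) eτ eT) x (1, 0) +
          fderiv ℝ (fun x : ℝ × ℝ => η (t, x) eT eσ) x (0, 1)) := by
      intro x
      rw [hslice, hslice]
      have := hη.closed (t, x) eT eσ eτ
      linarith
    have h1 : ∀ u v w, Integrable fun x : ℝ × ℝ => fderiv ℝ (fun x : ℝ × ℝ => η (t, x) u v) x w := fun u v w =>
      (((hg t u v).continuous_fderiv (by simp)).clm_apply continuous_const).integrable_of_hasCompactSupport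
        ((hs t u v).fderiv_apply (𝕜 := ℝ) w)
    rw [setIntegral_eq_integral_of_forall_compl_eq_zero]
    · simp only [e]
      rw [integral_neg, integral_add (h1 _ _ _) (h1 _ _ _),
        integral_fderiv_eq_zero_of_hasCompactSupport _ (hg _ _ _) (hs _ _ _),
        integral_fderiv_eq_zero_of_hasCompactSupport _ (hg _ _ _) (hs _ _ _)]
      simp
    · intro x hx
      have : η =ᶠ[𝓝 (t, x)] fun _ => 0 := by
        have ho : IsOpen {p : ℝ × (ℝ × ℝ) | p.2 ∈ Kᶜ} := hK.isClosed.isOpen_compl.preimage continuous_snd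
        filter_upwards [ho.mem_nhds (by exact hx : (t, x) ∈ {p : ℝ × (ℝ × ℝ) | p.2 ∈ Kᶜ})] with p hp
        exact h0 p.1 p.2 hp
      rw [this.fderiv_eq]
      simp
  have hcont : Continuous fun p : (ℝ × ℝ) × ℝ => fderiv ℝ η (p.2, p.1) eT eσ eτ :=
    ((((hη.smooth.continuous_fderiv (by simp)).comp
      (by fun_prop : Continuous fun p : (ℝ × ℝ) × ℝ => (p.2, p.1))).clm_apply continuous_const).clm_apply
      continuous_const).clm_apply continuous_const
  rw [← setIntegral_eq_integral_of_forall_compl_eq_zero (s := K)]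
  · simp only [key]
    rw [setIntegral_swap_of_continuous volume volume hK.isBounded (Metric.isBounded_Ioc 0 1) hcont]
    simp only [hz, integral_zero]
  · intro x hx
    simp [h0 _ x hx]

/-- The open-closed unit cube. -/
def unitCube (ι : Type*) : Set (ι → ℝ) := Set.univ.pi fun _ => Set.Ico 0 1

/-- Functions on `ℝ^ι` that are periodic with respect to the standard lattice. -/
def IsUnitPeriodic {ι β : Type*} [DecidableEq ι] (g : (ι → ℝ) → β) : Prop :=
  ∀ x i, g (x + Pi.single i 1) = g x

variable {ι : Type*} [Fintype ι] [DecidableEq ι]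

theorem isBounded_unitCube : Bornology.IsBounded (unitCube ι) :=
  (Metric.isBounded_Icc (0 : ι → ℝ) 1).subset fun x hx =>
    ⟨fun i => (hx i trivial).1, fun i => (hx i trivial).2.le⟩

theorem volume_unitCube : volume (unitCube ι) = 1 := by
  simp [unitCube, volume_pi_pi]

theorem volume_real_unitCube : (volume : Measure (ι → ℝ)).real (unitCube ι) = 1 := by
  simp [Measure.real, volume_unitCube]

theorem integrableOn_unitCube {g : (ι → ℝ) → ℝ} (hg : Continuous g) : IntegrableOn g (unitCube ι) :=
  (hg.continuousOn.integrableOn_compact isBounded_unitCube.isCompact_closure).mono_set subset_closure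

/-- The cube and its translate are both fundamental domains of the standard lattice. -/
theorem setIntegral_unitCube_add {g : (ι → ℝ) → ℝ} (hg : IsUnitPeriodic g) (v : ι → ℝ) :
    ∫ x in unitCube ι, g (x + v) = ∫ x in unitCube ι, g x := by
  have hF := ZSpan.isAddFundamentalDomain (Pi.basisFun ℝ ι) (volume : Measure (ι → ℝ))
  rw [ZSpan.fundamentalDomain_pi_basisFun] at hF
  have hinv : ∀ (c : Submodule.span ℤ (Set.range (Pi.basisFun ℝ ι))) (x : ι → ℝ), g (c +ᵥ x) = g x := by
    rintro ⟨c, hc⟩ x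
    change g (c + x) = g x
    rw [add_comm]
    induction hc using Submodule.span_induction generalizing x with
    | mem y hy =>
      obtain ⟨i, rfl⟩ := hy
      simpa using hg x i
    | zero => simp
    | add y z _ _ hy hz => rw [← add_assoc, hz, hy]
    | smul a y _ hy =>
      induction a using Int.induction_on generalizing x with
      | zero => simp
      | succ n ih => rw [add_smul, one_smul, ← add_assoc, hy, ih]
      | pred n ih =>
        rw [sub_smul, one_smul, ← hy (x + _), add_assoc, sub_add_cancel, ih]
  have : VAddInvariantMeasure (Submodule.span ℤ (Set.range (Pi.basisFun ℝ ι))) (ι → ℝ) volume :=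
    ⟨fun c s _ => measure_preimage_add volume (c : ι → ℝ) s⟩
  have h2 := (hF.vadd_of_comm v).setIntegral_eq hF (f := g) hinv
  rw [show unitCube ι = Set.univ.pi fun _ => Set.Ico 0 1 from rfl, ← h2]
  have hmp := measurePreserving_add_right (volume : Measure (ι → ℝ)) v
  have := hmp.setIntegral_image_emb (measurableEmbedding_addRight v) g (unitCube ι)
  rw [show unitCube ι = Set.univ.pi fun _ => Set.Ico 0 1 from rfl] at this
  rw [← this]
  congr 2
  ext x
  simp only [Set.mem_vadd_set, Set.mem_image, vadd_eq_add, add_comm v]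

theorem IsUnitPeriodic.fderiv {β : Type*} [NormedAddCommGroup β] [NormedSpace ℝ β] {g : (ι → ℝ) → β}
    (hg : IsUnitPeriodic g) : IsUnitPeriodic (fderiv ℝ g) := by
  intro x i
  rw [← fderiv_comp_add_right]
  congr 1
  funext y
  exact hg y i

/-- The integral of `g (x + v) - g x` is zero. Written as an integral of derivatives along the
segment, it is also the mean over `t` of equal integrals of `∂_v g`, by translation invariance. -/
theorem setIntegral_unitCube_fderiv {g : (ι → ℝ) → ℝ} (hg : IsUnitPeriodic g)
    (hs : ContDiff ℝ ∞ g) (v : ι → ℝ) : ∫ x in unitCube ι, fderiv ℝ g x v = 0 := by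
  have h1 : ∫ x in unitCube ι, (g (x + v) - g x) = 0 := by
    rw [integral_sub, setIntegral_unitCube_add hg, sub_self]
    · exact integrableOn_unitCube (hs.continuous.comp (by fun_prop))
    · exact integrableOn_unitCube hs.continuous
  have hcont : Continuous fun p : (ι → ℝ) × ℝ => fderiv ℝ g (p.1 + p.2 • v) v :=
    ((hs.continuous_fderiv (by simp)).comp (by fun_prop)).clm_apply continuous_const
  simp only [sub_eq_integral_fderiv hs] at h1
  rw [setIntegral_swap_of_continuous volume volume isBounded_unitCube (Metric.isBounded_Ioc 0 1) hcont] at h1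
  have h2 : ∀ t : ℝ, ∫ x in unitCube ι, fderiv ℝ g (x + t • v) v = ∫ x in unitCube ι, fderiv ℝ g x v := fun t =>
    setIntegral_unitCube_add (g := fun x => fderiv ℝ g x v) (fun x i => by simp only [hg.fderiv x i]) (t • v)
  simpa [h2] using h1
end

/-! ### Pfaffians: linearity, vanishing for small rank, positivity for the symplectic form -/

section
variable {κ : Type*} [Fintype κ] [DecidableEq κ]

/-- The standard basis vectors of `ℝ^ι`. -/
abbrev stdVec {ι : Type*} [DecidableEq ι] (a : ι) : ι → ℝ := Pi.single a 1

/-- The space of bilinear forms on `ℝ^(κ × 2)`. -/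
abbrev BlockForm (κ : Type*) [Fintype κ] : Type _ :=
  (κ × Fin 2 → ℝ) →L[ℝ] (κ × Fin 2 → ℝ) →L[ℝ] ℝ

/-- The polarized Pfaffian (up to a factor) of a family of two-forms on `ℝ^(κ × 2)`. -/
def pfaffian (M : κ → BlockForm κ) : ℝ :=
  ∑ σ : Equiv.Perm (κ × Fin 2), (Equiv.Perm.sign σ : ℝ) *
    ∏ j, M j (stdVec (σ (j, 0))) (stdVec (σ (j, 1)))

/-- The product of all the factors except one in a term of the Pfaffian. -/
def pfaffianCofactor (M : κ → BlockForm κ) (j : κ) (σ : Equiv.Perm (κ × Fin 2)) : ℝ :=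
  ∏ i ∈ Finset.univ.erase j, M i (stdVec (σ (i, 0))) (stdVec (σ (i, 1)))

/-- The Pfaffian as a linear function of one of its arguments. -/
def pfaffianSlot (M : κ → BlockForm κ) (j : κ) : BlockForm κ →L[ℝ] ℝ :=
  ∑ σ : Equiv.Perm (κ × Fin 2), ((Equiv.Perm.sign σ : ℝ) * pfaffianCofactor M j σ) •
    (ContinuousLinearMap.apply ℝ ℝ (stdVec (σ (j, 1)))).comp
      (ContinuousLinearMap.apply ℝ _ (stdVec (σ (j, 0))))

theorem pfaffianSlot_apply (M : κ → BlockForm κ) (j : κ) (A : BlockForm κ) :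
    pfaffianSlot M j A = ∑ σ : Equiv.Perm (κ × Fin 2), (Equiv.Perm.sign σ : ℝ) *
      (A (stdVec (σ (j, 0))) (stdVec (σ (j, 1))) * pfaffianCofactor M j σ) := by
  simp only [pfaffianSlot, sum_apply]
  refine Finset.sum_congr rfl fun σ _ => ?_
  change _ * (A (stdVec (σ (j, 0))) (stdVec (σ (j, 1)))) = _
  ring

theorem pfaffian_update (M : κ → BlockForm κ) (j : κ) (A : BlockForm κ) :
    pfaffian (Function.update M j A) = pfaffianSlot M j A := by
  rw [pfaffianSlot_apply, pfaffian]
  refine Finset.sum_congr rfl fun σ _ => ?_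
  rw [← Finset.mul_prod_erase _ _ (Finset.mem_univ j), Function.update_self, pfaffianCofactor]
  congr 2
  refine Finset.prod_congr rfl fun i hi => ?_
  rw [Function.update_of_ne (Finset.ne_of_mem_erase hi)]

theorem pfaffianSlot_self (M : κ → BlockForm κ) (j : κ) : pfaffianSlot M j (M j) = pfaffian M := by
  rw [← pfaffian_update, Function.update_eq_self]

/-- Composing `σ` with the swap of `(j, 0)` and `(j, 1)` reverses its sign and transposes only slot
`j`. -/
theorem pfaffianSlot_flip (M : κ → BlockForm κ) (j : κ) (A : BlockForm κ) :
    pfaffianSlot M j A.flip = - pfaffianSlot M j A := by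
  rw [pfaffianSlot_apply, pfaffianSlot_apply,
    ← Equiv.sum_comp (Equiv.mulRight (Equiv.swap ((j, 0) : κ × Fin 2) (j, 1))), ← Finset.sum_neg_distrib]
  refine Finset.sum_congr rfl fun σ _ => ?_
  have h : pfaffianCofactor M j (σ * Equiv.swap (j, 0) (j, 1)) = pfaffianCofactor M j σ := by
    refine Finset.prod_congr rfl fun i hi => ?_
    have hi := Finset.ne_of_mem_erase hi
    simp only [Equiv.Perm.mul_apply]
    rw [Equiv.swap_apply_of_ne_of_ne, Equiv.swap_apply_of_ne_of_ne] <;> simp [hi]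
  simp only [Equiv.coe_mulRight, h, Equiv.Perm.mul_apply, Equiv.swap_apply_left,
    Equiv.swap_apply_right, ContinuousLinearMap.flip_apply, Equiv.Perm.sign_mul]
  rw [Equiv.Perm.sign_swap (by simp)]
  push_cast
  ring

/-- Reindexing by the even permutation `c` makes the three signed sums equal, and their total is
zero. With `c` a 3-cycle, this is how the cyclic identity of a closed 2-form enters sums over
permutations. -/
theorem sum_sign_mul_eq_zero_of_cycle {ι : Type*} [Fintype ι] [DecidableEq ι]
    (G : Equiv.Perm ι → ℝ) (c : Equiv.Perm ι) (hc : Equiv.Perm.sign c = 1)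
    (h : ∀ σ, G σ + G (σ * c) + G (σ * c * c) = 0) :
    ∑ σ, (Equiv.Perm.sign σ : ℝ) * G σ = 0 := by
  have e : ∀ H : Equiv.Perm ι → ℝ, ∑ σ, (Equiv.Perm.sign σ : ℝ) * H (σ * c) =
      ∑ σ, (Equiv.Perm.sign σ : ℝ) * H σ := fun H => by
    rw [← Equiv.sum_comp (Equiv.mulRight c) fun σ => (Equiv.Perm.sign σ : ℝ) * H σ]
    simp [Equiv.Perm.sign_mul, hc]
  have e2 := e fun σ => G (σ * c)
  have h3 : ∑ σ, (Equiv.Perm.sign σ : ℝ) * (G σ + G (σ * c) + G (σ * c * c)) = 0 := by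
    simp [h]
  simp only [mul_add, Finset.sum_add_distrib] at h3
  have e1 := e G
  linarith

section rank
variable {V : Type*} [AddCommGroup V] [Module ℝ V]

/-- The multilinear map `v ↦ ∏ⱼ B (v (j, 0)) (v (j, 1))`. -/
def prodBilin (B : V →ₗ[ℝ] V →ₗ[ℝ] ℝ) : MultilinearMap ℝ (fun _ : κ × Fin 2 => V) ℝ where
  toFun v := ∏ j, B (v (j, 0)) (v (j, 1))
  map_update_add' {inst} v a x y := by
    obtain rfl := Subsingleton.elim inst instDecidableEqProd
    obtain ⟨j, s⟩ := a
    have h : ∀ z, ∏ i ∈ Finset.univ.erase j, B (Function.update v (j, s) z (i, 0))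
        (Function.update v (j, s) z (i, 1)) =
        ∏ i ∈ Finset.univ.erase j, B (v (i, 0)) (v (i, 1)) := fun z =>
      Finset.prod_congr rfl fun i hi => by
        have hi := Finset.ne_of_mem_erase hi
        rw [Function.update_of_ne (by simp [hi]), Function.update_of_ne (by simp [hi])]
    simp only [← Finset.mul_prod_erase _ _ (Finset.mem_univ j), h, ← add_mul]
    congr 1
    fin_cases s <;> simp
  map_update_smul' {inst} v a c x := by
    obtain rfl := Subsingleton.elim inst instDecidableEqProd
    obtain ⟨j, s⟩ := a
    have h : ∀ z, ∏ i ∈ Finset.univ.erase j, B (Function.update v (j, s) z (i, 0))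
        (Function.update v (j, s) z (i, 1)) =
        ∏ i ∈ Finset.univ.erase j, B (v (i, 0)) (v (i, 1)) := fun z =>
      Finset.prod_congr rfl fun i hi => by
        have hi := Finset.ne_of_mem_erase hi
        rw [Function.update_of_ne (by simp [hi]), Function.update_of_ne (by simp [hi])]
    simp only [← Finset.mul_prod_erase _ _ (Finset.mem_univ j), h, smul_eq_mul, ← mul_assoc]
    congr 1
    fin_cases s <;> simp

/-- The Pfaffian of a two-form of small rank vanishes. -/
theorem pfaffian_eq_zero_of_finrank_lt [FiniteDimensional ℝ V] (B : V →ₗ[ℝ] V →ₗ[ℝ] ℝ)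
    (L : (κ × Fin 2 → ℝ) →ₗ[ℝ] V) (hd : Module.finrank ℝ V < Fintype.card κ)
    (M : BlockForm κ) (hM : ∀ u v, M u v = B (L u) (L v)) : pfaffian (fun _ : κ => M) = 0 := by
  -- The Pfaffian is an alternating function of the images of the basis vectors, and these are too
  -- many to be independent in `V`.
  have h := (MultilinearMap.alternatization (prodBilin (κ := κ) B)).map_linearDependent
    (fun a => L (stdVec a)) (fun hli => by
      have := hli.fintype_card_le_finrank
      simp at this
      omega)
  rw [MultilinearMap.alternatization_apply] at h
  rw [← h, pfaffian]
  refine Finset.sum_congr rfl fun σ _ => ?_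
  simp only [hM]
  rw [Units.smul_def, zsmul_eq_mul]
  rfl
end rank

theorem sign_perm_fin_two (ε : Equiv.Perm (Fin 2)) :
    (Equiv.Perm.sign ε : ℝ) = ((ε 1 : ℕ) : ℝ) - ((ε 0 : ℕ) : ℝ) := by
  have : ∀ ε : Equiv.Perm (Fin 2), (Equiv.Perm.sign ε : ℤ) = ((ε 1 : ℕ) : ℤ) - ((ε 0 : ℕ) : ℤ) := by
    decide
  exact_mod_cast congrArg (Int.cast : ℤ → ℝ) (this ε)

/-- The matrix of the standard symplectic form on `ℝ^(κ × 2)`. -/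
def blockSymplectic (a b : κ × Fin 2) : ℝ :=
  if a.1 = b.1 then ((b.2 : ℕ) : ℝ) - ((a.2 : ℕ) : ℝ) else 0

/-- In a nonzero term `σ` carries blocks to blocks: it permutes the blocks by `π` and acts inside
them by `ε j`. Moving whole blocks of size 2 is even, so the sign is `∏ sign (ε j)`. The product of
entries is the same number, and the term is a square. -/
theorem sign_mul_prod_blockSymplectic_nonneg (σ : Equiv.Perm (κ × Fin 2)) :
    0 ≤ (Equiv.Perm.sign σ : ℝ) * ∏ j, blockSymplectic (σ (j, 0)) (σ (j, 1)) := by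
  by_cases h0 : ∏ j, blockSymplectic (σ (j, 0)) (σ (j, 1)) = 0
  · rw [h0, mul_zero]
  have hne : ∀ j, blockSymplectic (σ (j, 0)) (σ (j, 1)) ≠ 0 := fun j =>
    (Finset.prod_ne_zero_iff.1 h0) j (Finset.mem_univ j)
  have h1 : ∀ j, (σ (j, 0)).1 = (σ (j, 1)).1 := fun j => by
    by_contra h
    exact hne j (by simp [blockSymplectic, h])
  have hfst : ∀ j s, (σ (j, s)).1 = (σ (j, 0)).1 := fun j s => by
    fin_cases s
    · rfl
    · exact (h1 j).symm
  have hinj : ∀ j, Function.Injective fun s => (σ (j, s)).2 := fun j s t hst => by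
    have : σ (j, s) = σ (j, t) := Prod.ext (by rw [hfst, hfst j t]) hst
    simpa using this
  let ε : κ → Equiv.Perm (Fin 2) := fun j =>
    Equiv.ofBijective _ (Finite.injective_iff_bijective.1 (hinj j))
  have hπ : Function.Injective fun j => (σ (j, 0)).1 := fun i j hij => by
    obtain ⟨s, hs⟩ := (ε i).surjective (σ (j, 0)).2
    have : σ (i, s) = σ (j, 0) := Prod.ext (by rw [hfst]; exact hij) hs
    exact congrArg Prod.fst (σ.injective this)
  let π : Equiv.Perm κ := Equiv.ofBijective _ (Finite.injective_iff_bijective.1 hπ)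
  have hσ : σ = Equiv.prodCongrLeft (fun _ => π) * Equiv.prodCongrRight ε := by
    ext ⟨j, s⟩
    · exact hfst j s
    · rfl
  have hs : Equiv.Perm.sign σ = ∏ j, Equiv.Perm.sign (ε j) := by
    rw [hσ, Equiv.Perm.sign_mul, Equiv.Perm.sign_prodCongrLeft, Equiv.Perm.sign_prodCongrRight]
    simp [Int.units_sq]
  have hp : ∀ j, blockSymplectic (σ (j, 0)) (σ (j, 1)) = (Equiv.Perm.sign (ε j) : ℝ) := fun j => by
    rw [sign_perm_fin_two, blockSymplectic, if_pos (h1 j)]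
    rfl
  simp only [hp, hs]
  push_cast
  exact mul_self_nonneg _

/-- The Pfaffian is a power of `c` times a sum of nonnegative terms, and the identity permutation
contributes 1 to that sum. -/
theorem eq_zero_of_pfaffian_blockSymplectic_eq_zero (M : BlockForm κ) (c : ℝ)
    (hM : ∀ a b, M (stdVec a) (stdVec b) = c * blockSymplectic a b)
    (h : pfaffian (fun _ : κ => M) = 0) : c = 0 := by
  simp only [pfaffian, hM, Finset.prod_mul_distrib, mul_left_comm _ (∏ _ : κ, c), ← Finset.mul_sum] at h
  rcases mul_eq_zero.1 h with h | h
  · obtain ⟨j, -, hj⟩ := Finset.prod_eq_zero_iff.1 h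
    exact hj
  · have := (Finset.sum_eq_zero_iff_of_nonneg fun σ _ =>
      sign_mul_prod_blockSymplectic_nonneg σ).1 h 1 (Finset.mem_univ _)
    simp [blockSymplectic] at this
end

/-! ### Closed 2-forms on tori: periods and integrals of top products -/

section

section
variable {E : Type*} [NormedAddCommGroup E] [NormedSpace ℝ E] {η : E → E →L[ℝ] E →L[ℝ] ℝ}

theorem IsClosedTwoForm.fderiv_alt (hη : IsClosedTwoForm η) (x u v : E) :
    fderiv ℝ η x u v v = 0 := by
  rw [← fderiv_clm_apply_const₂ hη.smooth]
  simp [hη.alt]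

theorem IsClosedTwoForm.fderiv_swap (hη : IsClosedTwoForm η) (x u v w : E) :
    fderiv ℝ η x u v w = - fderiv ℝ η x u w v := by
  have h := hη.fderiv_alt x u (v + w)
  simp only [map_add, add_apply, hη.fderiv_alt] at h
  linarith

theorem IsClosedTwoForm.swap (hη : IsClosedTwoForm η) (x v w : E) : η x v w = - η x w v := by
  have h := hη.alt x (v + w)
  simp only [map_add, add_apply, hη.alt] at h
  linarith

/-- A directional derivative of a closed 2-form is the exterior derivative of its contraction. -/
theorem IsClosedTwoForm.fderiv_eq (hη : IsClosedTwoForm η) (x v u w : E) :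
    fderiv ℝ η x v u w = fderiv ℝ η x u v w - fderiv ℝ η x w v u := by
  have h1 := hη.closed x v u w
  have h2 := hη.fderiv_swap x u w v
  linarith

theorem IsClosedTwoForm.comp_add_right (hη : IsClosedTwoForm η) (c : E) :
    IsClosedTwoForm fun x => η (x + c) where
  smooth := hη.smooth.comp (contDiff_id.add contDiff_const)
  alt x u := hη.alt _ u
  closed x u v w := by
    rw [show fderiv ℝ (fun x => η (x + c)) x = fderiv ℝ η (x + c) from fderiv_comp_add_right (𝕜 := ℝ) (f := η) (x := x) c]
    exact hη.closed (x + c) u v w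

theorem isClosedTwoForm_const (A : E →L[ℝ] E →L[ℝ] ℝ) (hA : ∀ u, A u u = 0) :
    IsClosedTwoForm fun _ : E => A where
  smooth := contDiff_const
  alt _ u := hA u
  closed x u v w := by simp

end

section
variable {ι : Type*} [Fintype ι] [DecidableEq ι]

theorem IsUnitPeriodic.comp_add_right {β : Type*} {g : (ι → ℝ) → β} (hg : IsUnitPeriodic g)
    (c : ι → ℝ) : IsUnitPeriodic fun x => g (x + c) := fun x i => by
  simp only [add_right_comm x, hg (x + c) i]

theorem IsUnitPeriodic.comp {β γ : Type*} {g : (ι → ℝ) → β} (hg : IsUnitPeriodic g)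
    (F : β → γ) : IsUnitPeriodic fun x => F (g x) := fun x i => by simp only [hg x i]

/-- The period of a closed 2-form on a torus over a coordinate 2-torus is its mean. -/
theorem IsClosedTwoForm.setIntegral_unitCube_eq
    {η : (ι → ℝ) → (ι → ℝ) →L[ℝ] (ι → ℝ) →L[ℝ] ℝ} (hη : IsClosedTwoForm η)
    (hp : IsUnitPeriodic η) (a b : ι) :
    ∫ x in unitCube ι, η x (stdVec a) (stdVec b) =
      ∫ y in unitCube (Fin 2), η (y 0 • stdVec a + y 1 • stdVec b) (stdVec a) (stdVec b) := by
  set A : (Fin 2 → ℝ) →L[ℝ] (ι → ℝ) :=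
    (ContinuousLinearMap.proj (R := ℝ) (φ := fun _ : Fin 2 => ℝ) 0).smulRight (stdVec a) +
      (ContinuousLinearMap.proj (R := ℝ) (φ := fun _ : Fin 2 => ℝ) 1).smulRight (stdVec b) with hA
  have hAy : ∀ y, A y = y 0 • stdVec a + y 1 • stdVec b := fun y => rfl
  have hA0 : A (Pi.single 0 1) = stdVec a := by simp [hAy]
  have hA1 : A (Pi.single 1 1) = stdVec b := by simp [hAy]
  simp only [← hAy]
  have sm : ∀ u v, ContDiff ℝ ∞ (fun p => η p u v) := fun u v =>
    (hη.smooth.clm_apply contDiff_const).clm_apply contDiff_const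
  have hsm : ∀ (c u v), ContDiff ℝ ∞ (fun y : Fin 2 → ℝ => η (A y + c) u v) := fun c u v =>
    (sm u v).comp (A.contDiff.add contDiff_const)
  have hper : ∀ (c u v), IsUnitPeriodic (fun y : Fin 2 → ℝ => η (A y + c) u v) := fun c u v y i => by
    have : A (Pi.single i 1) = stdVec a ∨ A (Pi.single i 1) = stdVec b := by
      fin_cases i
      · exact Or.inl hA0
      · exact Or.inr hA1
    simp only [map_add, add_right_comm (A y)]
    rcases this with h | h <;> simp only [h, hp _ _]
  have hd : ∀ c u v y w, fderiv ℝ (fun y : Fin 2 → ℝ => η (A y + c) u v) y w =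
      fderiv ℝ η (A y + c) (A w) u v := fun c u v y w => by
    rw [← fderiv_clm_apply_const₂ hη.smooth]
    have h1 := ((sm u v).differentiable (by simp) (A y + c)).hasFDerivAt.comp y
      (A.hasFDerivAt.add_const c)
    have h2 : fderiv ℝ (fun y : Fin 2 → ℝ => η (A y + c) u v) y = _ := h1.fderiv
    rw [h2]; rfl
  -- Translating the 2-torus does not change the period: a directional derivative of a closed form
  -- is exact, and exact periodic forms integrate to zero.
  have hconst : ∀ x, ∫ y in unitCube (Fin 2), η (A y + x) (stdVec a) (stdVec b) =
      ∫ y in unitCube (Fin 2), η (A y) (stdVec a) (stdVec b) := by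
    intro x
    have hi : IntegrableOn (fun y => η (A y) (stdVec a) (stdVec b)) (unitCube (Fin 2)) :=
      integrableOn_unitCube ((sm (stdVec a) (stdVec b)).continuous.comp A.continuous)
    rw [← sub_eq_zero, ← integral_sub (integrableOn_unitCube (hsm x _ _).continuous) hi]
    simp only [sub_eq_integral_fderiv (sm (stdVec a) (stdVec b)),
      fderiv_clm_apply_const₂ hη.smooth]
    have hcont : Continuous fun p : (Fin 2 → ℝ) × ℝ =>
        fderiv ℝ η (A p.1 + p.2 • x) x (stdVec a) (stdVec b) :=
      ((((hη.smooth.continuous_fderiv (by simp)).comp (by fun_prop)).clm_apply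
        continuous_const).clm_apply continuous_const).clm_apply continuous_const
    rw [setIntegral_swap_of_continuous volume volume isBounded_unitCube
      (Metric.isBounded_Ioc 0 1) hcont]
    have hz : ∀ t : ℝ, ∫ y in unitCube (Fin 2),
        fderiv ℝ η (A y + t • x) x (stdVec a) (stdVec b) = 0 := by
      intro t
      have e : ∀ y, fderiv ℝ η (A y + t • x) x (stdVec a) (stdVec b) =
          fderiv ℝ (fun y : Fin 2 → ℝ => η (A y + t • x) x (stdVec b)) y (Pi.single 0 1) -
          fderiv ℝ (fun y : Fin 2 → ℝ => η (A y + t • x) x (stdVec a)) y (Pi.single 1 1) := fun y => by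
        rw [hd, hd, hA0, hA1, hη.fderiv_eq]
      have hi : ∀ u v w, IntegrableOn (fun y => fderiv ℝ (fun y : Fin 2 → ℝ => η (A y + t • x) u v) y w)
          (unitCube (Fin 2)) := fun u v w =>
        integrableOn_unitCube (((hsm _ _ _).continuous_fderiv (by simp)).clm_apply continuous_const)
      simp only [e]
      rw [integral_sub (hi _ _ _) (hi _ _ _), setIntegral_unitCube_fderiv (hper _ _ _) (hsm _ _ _),
        setIntegral_unitCube_fderiv (hper _ _ _) (hsm _ _ _), sub_zero]
    simp only [hz, integral_zero]
  -- The double integral of `η (x + A y)` is the mean when `x` is integrated first, and the period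
  -- when `y` is.
  have h1 : ∀ y, ∫ x in unitCube ι, η (x + A y) (stdVec a) (stdVec b) =
      ∫ x in unitCube ι, η x (stdVec a) (stdVec b) := fun y =>
    setIntegral_unitCube_add (g := fun x => η x (stdVec a) (stdVec b))
      (hp.comp fun M => M (stdVec a) (stdVec b)) (A y)
  have h2 := setIntegral_swap_of_continuous (volume : Measure (ι → ℝ))
    (volume : Measure (Fin 2 → ℝ)) isBounded_unitCube isBounded_unitCube
    (G := fun p => η (p.1 + A p.2) (stdVec a) (stdVec b))
    ((sm _ _).continuous.comp (by fun_prop))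
  simp only [h1] at h2
  simp only [add_comm _ (A _), hconst] at h2
  simpa [volume_real_unitCube] using h2.symm
end

section
variable {κ : Type*} [Fintype κ] [DecidableEq κ]

theorem pfaffianSlot_sub (M : κ → BlockForm κ) (j : κ) (A B : BlockForm κ) :
    pfaffianSlot M j (A - B) = pfaffianSlot M j A - pfaffianSlot M j B := by
  simp only [pfaffianSlot_apply, ← Finset.sum_sub_distrib]
  refine Finset.sum_congr rfl fun σ _ => ?_
  change _ * ((A _ _ - B _ _) * _) = _
  ring

/-- The derivative of `ζ` along `v` is the exterior derivative of `w = ζ(v, ·)`, and the product of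
an exact form with closed forms is exact. -/
theorem setIntegral_pfaffianSlot_fderiv {η : κ → (κ × Fin 2 → ℝ) → BlockForm κ}
    (hη : ∀ j, IsClosedTwoForm (η j)) (hp : ∀ j, IsUnitPeriodic (η j))
    {ζ : (κ × Fin 2 → ℝ) → BlockForm κ} (hζ : IsClosedTwoForm ζ) (hζp : IsUnitPeriodic ζ)
    (j : κ) (v : κ × Fin 2 → ℝ) :
    ∫ x in unitCube (κ × Fin 2), pfaffianSlot (fun i => η i x) j (fderiv ℝ ζ x v) = 0 := by
  set w : (κ × Fin 2 → ℝ) → (κ × Fin 2 → ℝ) →L[ℝ] ℝ := fun x => ζ x v with hw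
  have hws : ContDiff ℝ ∞ w := hζ.smooth.clm_apply contDiff_const
  have hdw : ∀ x a b, fderiv ℝ w x a b = fderiv ℝ ζ x a v b := fun x a b => by
    have h1 := ((hζ.smooth.differentiable (by simp) x).hasFDerivAt).clm_apply (hasFDerivAt_const v x)
    have h2 : fderiv ℝ w x = _ := h1.fderiv
    rw [h2]; simp
  have e1 : ∀ x, fderiv ℝ ζ x v = fderiv ℝ w x - (fderiv ℝ w x).flip := fun x => by
    ext1 a; ext1 b
    change _ = fderiv ℝ w x a b - fderiv ℝ w x b a
    rw [hdw, hdw, hζ.fderiv_eq]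
  have hηs : ∀ i a b, ContDiff ℝ ∞ fun x => η i x a b := fun i a b =>
    ((hη i).smooth.clm_apply contDiff_const).clm_apply contDiff_const
  let u : Equiv.Perm (κ × Fin 2) → (κ × Fin 2 → ℝ) → ℝ := fun σ x =>
    w x (stdVec (σ (j, 1))) * pfaffianCofactor (fun i => η i x) j σ
  have hcs : ∀ σ, ContDiff ℝ ∞ fun x => pfaffianCofactor (fun i => η i x) j σ := fun σ =>
    contDiff_prod fun i _ => hηs i _ _
  have hus : ∀ σ, ContDiff ℝ ∞ (u σ) := fun σ => (hws.clm_apply contDiff_const).mul (hcs σ)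
  have hup : ∀ σ, IsUnitPeriodic (u σ) := fun σ x i => by
    simp only [u, hw, hζp x i, hp _ x i]
  have hdu : ∀ σ x c, fderiv ℝ (u σ) x c =
      fderiv ℝ w x c (stdVec (σ (j, 1))) * pfaffianCofactor (fun i => η i x) j σ +
      ∑ i ∈ Finset.univ.erase j, w x (stdVec (σ (j, 1))) *
        (fderiv ℝ (η i) x c (stdVec (σ (i, 0))) (stdVec (σ (i, 1))) *
        ∏ k ∈ (Finset.univ.erase j).erase i, η k x (stdVec (σ (k, 0))) (stdVec (σ (k, 1)))) := by
    intro σ x c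
    have h1 : HasFDerivAt (fun x => w x (stdVec (σ (j, 1)))) _ x :=
      ((hws.differentiable (by simp) x).hasFDerivAt).clm_apply (hasFDerivAt_const _ x)
    have h2 : HasFDerivAt (fun x => ∏ i ∈ Finset.univ.erase j, η i x (stdVec (σ (i, 0))) (stdVec (σ (i, 1)))) _ x :=
      HasFDerivAt.finsetProd (fun i _ => ((hηs i (stdVec (σ (i, 0))) (stdVec (σ (i, 1)))).differentiable (by simp) x).hasFDerivAt)
    have h3 : fderiv ℝ (u σ) x = _ := (h1.mul h2).fderiv
    rw [h3]
    simp only [add_apply, smul_apply, sum_apply, smul_eq_mul,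
      fderiv_clm_apply_const₂ (hη _).smooth, Finset.mul_sum]
    rw [add_comm]
    congr 1
    · simp [pfaffianCofactor, mul_comm]
    · exact Finset.sum_congr rfl fun i _ => by ring
  have e2 : ∀ x, pfaffianSlot (fun i => η i x) j (fderiv ℝ ζ x v) =
      2 * ∑ σ : Equiv.Perm (κ × Fin 2), (Equiv.Perm.sign σ : ℝ) *
        fderiv ℝ (u σ) x (stdVec (σ (j, 0))) := by
    intro x
    rw [e1, pfaffianSlot_sub, pfaffianSlot_flip, sub_neg_eq_add, ← two_mul, pfaffianSlot_apply]
    simp only [hdu, mul_add, Finset.sum_add_distrib]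
    -- What remains are the Leibniz terms where the derivative falls on some `η i`; they have to
    -- vanish after summation over `σ`.
    rw [left_eq_add, mul_eq_zero]
    right
    simp only [Finset.mul_sum]
    rw [Finset.sum_comm]
    refine Finset.sum_eq_zero fun i hi => ?_
    have hij := Finset.ne_of_mem_erase hi
    -- The 3-cycle `(j, 0) → (i, 0) → (i, 1) → (j, 0)` rotates the derivative direction and both
    -- arguments of `η i`, so each triple is a multiple of `dη i = 0`.
    refine sum_sign_mul_eq_zero_of_cycle _
      (Equiv.swap (j, 0) (i, 0) * Equiv.swap (i, 0) (i, 1)) ?_ fun σ => ?_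
    · rw [Equiv.Perm.sign_mul, Equiv.Perm.sign_swap (by simp [hij.symm]), Equiv.Perm.sign_swap (by simp)]
      simp
    · set c : Equiv.Perm (κ × Fin 2) := Equiv.swap (j, 0) (i, 0) * Equiv.swap (i, 0) (i, 1) with hc
      have c1 : c (j, 0) = (i, 0) := by simp [hc, Equiv.swap_apply_def, hij, hij.symm]
      have c2 : c (i, 0) = (i, 1) := by simp [hc, Equiv.swap_apply_def, hij]
      have c3 : c (i, 1) = (j, 0) := by simp [hc]
      have c4 : c (j, 1) = (j, 1) := by simp [hc, Equiv.swap_apply_def, hij.symm]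
      have c5 : ∀ k ∈ (Finset.univ.erase j).erase i, ∀ s, c (k, s) = (k, s) := fun k hk s => by
        simp only [Finset.mem_erase, Finset.mem_univ, and_true] at hk
        simp [hc, Equiv.swap_apply_def, hk]
      have hprod : ∀ τ : Equiv.Perm (κ × Fin 2),
          ∏ k ∈ (Finset.univ.erase j).erase i, η k x (stdVec ((τ * c) (k, 0))) (stdVec ((τ * c) (k, 1))) =
          ∏ k ∈ (Finset.univ.erase j).erase i, η k x (stdVec (τ (k, 0))) (stdVec (τ (k, 1))) := fun τ =>
        Finset.prod_congr rfl fun k hk => by simp only [Equiv.Perm.mul_apply, c5 k hk]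
      simp only [hprod, ← mul_assoc, ← add_mul]
      simp only [Equiv.Perm.mul_apply, c1, c2, c3, c4]
      rw [← mul_add, ← mul_add, (hη i).closed, mul_zero, zero_mul]
  simp only [e2]
  rw [integral_const_mul, integral_finsetSum]
  · rw [Finset.sum_eq_zero, mul_zero]
    intro σ _
    rw [integral_const_mul, setIntegral_unitCube_fderiv (hup σ) (hus σ), mul_zero]
  · intro σ _
    exact (integrableOn_unitCube
      (((hus σ).continuous_fderiv (by simp)).clm_apply continuous_const)).const_mul _
end
end

/-! ### Replacing closed forms by their means -/

section
variable {κ : Type*} [Fintype κ] [DecidableEq κ]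

theorem continuous_pfaffianSlot {X : Type*} [TopologicalSpace X] {M : κ → X → BlockForm κ}
    {A : X → BlockForm κ} (hM : ∀ i, Continuous (M i)) (hA : Continuous A) (j : κ) :
    Continuous fun x => pfaffianSlot (fun i => M i x) j (A x) := by
  simp only [pfaffianSlot_apply]
  refine continuous_finsetSum _ fun σ _ => continuous_const.mul (.mul ?_ ?_)
  · exact (hA.clm_apply continuous_const).clm_apply continuous_const
  · exact continuous_finsetProd _ fun i _ =>
      ((hM i).clm_apply continuous_const).clm_apply continuous_const

section
variable {ι : Type*} [Fintype ι] [DecidableEq ι] (η : (ι → ℝ) → (ι → ℝ) →L[ℝ] (ι → ℝ) →L[ℝ] ℝ)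
  (hη : Continuous η)

/-- The mean of a field of bilinear forms over the unit cube. -/
def meanForm : (ι → ℝ) →L[ℝ] (ι → ℝ) →L[ℝ] ℝ :=
  have hi : ∀ u v, IntegrableOn (fun x => η x u v) (unitCube ι) := fun _ _ =>
    integrableOn_unitCube ((hη.clm_apply continuous_const).clm_apply continuous_const)
  (LinearMap.mk₂ ℝ (fun u v => ∫ x in unitCube ι, η x u v)
    (fun u u' v => by
      rw [← integral_add (hi _ _) (hi _ _)]
      simp only [map_add, add_apply])
    (fun c u v => by
      rw [← integral_smul]
      simp only [map_smul, smul_apply])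
    (fun u v v' => by
      rw [← integral_add (hi _ _) (hi _ _)]
      simp only [map_add])
    (fun c u v => by
      rw [← integral_smul]
      simp only [map_smul])).toContinuousBilinearMap

theorem meanForm_apply (u v : ι → ℝ) : meanForm η hη u v = ∫ x in unitCube ι, η x u v := rfl
end

variable {η : κ → (κ × Fin 2 → ℝ) → BlockForm κ}

/-- Translates of a closed form are cohomologous: along the segment the derivative of the integral
vanishes by `setIntegral_pfaffianSlot_fderiv`. -/
theorem setIntegral_pfaffianSlot_add
    (hη : ∀ j, IsClosedTwoForm (η j)) (hp : ∀ j, IsUnitPeriodic (η j))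
    {ζ : (κ × Fin 2 → ℝ) → BlockForm κ} (hζ : IsClosedTwoForm ζ) (hζp : IsUnitPeriodic ζ)
    (j : κ) (v : κ × Fin 2 → ℝ) :
    ∫ x in unitCube (κ × Fin 2), pfaffianSlot (fun i => η i x) j (ζ (x + v)) =
      ∫ x in unitCube (κ × Fin 2), pfaffianSlot (fun i => η i x) j (ζ x) := by
  have hc : ∀ i, Continuous (η i) := fun i => (hη i).smooth.continuous
  have hi : ∀ w, IntegrableOn (fun x => pfaffianSlot (fun i => η i x) j (ζ (x + w)))
      (unitCube (κ × Fin 2)) := fun w => integrableOn_unitCube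
    (continuous_pfaffianSlot hc (hζ.smooth.continuous.comp (continuous_id.add continuous_const)) j)
  have hi0 := hi 0
  simp only [add_zero] at hi0
  rw [← sub_eq_zero, ← integral_sub (hi v) hi0]
  have e : ∀ x, pfaffianSlot (fun i => η i x) j (ζ (x + v)) - pfaffianSlot (fun i => η i x) j (ζ x) =
      ∫ t in Set.Ioc (0 : ℝ) 1, pfaffianSlot (fun i => η i x) j (fderiv ℝ ζ (x + t • v) v) := fun x => by
    have hd : ∀ y, fderiv ℝ (fun y => pfaffianSlot (fun i => η i x) j (ζ y)) y v =
        pfaffianSlot (fun i => η i x) j (fderiv ℝ ζ y v) := fun y => by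
      have h1 := (pfaffianSlot (fun i => η i x) j).hasFDerivAt.comp y
        ((hζ.smooth.differentiable (by simp) y).hasFDerivAt)
      have h2 : fderiv ℝ (fun y => pfaffianSlot (fun i => η i x) j (ζ y)) y = _ := h1.fderiv
      rw [h2]; rfl
    have hs : ContDiff ℝ ∞ fun y => pfaffianSlot (fun i => η i x) j (ζ y) := by
      simp only [pfaffianSlot_apply]
      exact ContDiff.sum fun σ _ => contDiff_const.mul
        (((hζ.smooth.clm_apply contDiff_const).clm_apply contDiff_const).mul contDiff_const)
    have := sub_eq_integral_fderiv (g := fun y => pfaffianSlot (fun i => η i x) j (ζ y)) hs x v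
    simpa only [hd] using this
  simp only [e]
  rw [setIntegral_swap_of_continuous volume volume isBounded_unitCube (Metric.isBounded_Ioc 0 1)
    (G := fun p => pfaffianSlot (fun i => η i p.1) j (fderiv ℝ ζ (p.1 + p.2 • v) v))
    (continuous_pfaffianSlot (fun i => (hc i).comp continuous_fst)
      (((hζ.smooth.continuous_fderiv (by simp)).comp (by fun_prop)).clm_apply continuous_const) j)]
  have hz : ∀ t : ℝ, ∫ x in unitCube (κ × Fin 2),
      pfaffianSlot (fun i => η i x) j (fderiv ℝ ζ (x + t • v) v) = 0 := fun t => by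
    have := setIntegral_pfaffianSlot_fderiv hη hp (hζ.comp_add_right (t • v))
      (hζp.comp_add_right (t • v)) j v
    have hd : ∀ x, fderiv ℝ (fun y => ζ (y + t • v)) x = fderiv ℝ ζ (x + t • v) := fun x =>
      fderiv_comp_add_right (𝕜 := ℝ) (f := ζ) (x := x) (t • v)
    simpa only [hd] using this
  simp only [hz, integral_zero]

/-- In the integral of the Pfaffian a closed 2-form may be replaced by its mean. -/
theorem setIntegral_pfaffianSlot_mean
    (hη : ∀ j, IsClosedTwoForm (η j)) (hp : ∀ j, IsUnitPeriodic (η j)) (j : κ) :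
    ∫ x in unitCube (κ × Fin 2), pfaffian (fun i => η i x) =
      ∫ x in unitCube (κ × Fin 2),
        pfaffianSlot (fun i => η i x) j (meanForm (η j) (hη j).smooth.continuous) := by
  have hc : ∀ i, Continuous (η i) := fun i => (hη i).smooth.continuous
  -- Only slot `j` is translated by `p.2`. Averaging over the translations first produces the mean;
  -- integrating over `p.1` first removes the translation.
  have hswap := setIntegral_swap_of_continuous (volume : Measure (κ × Fin 2 → ℝ))
    (volume : Measure (κ × Fin 2 → ℝ)) isBounded_unitCube isBounded_unitCube
    (G := fun p => pfaffianSlot (fun i => η i p.1) j (η j (p.1 + p.2)))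
    (continuous_pfaffianSlot (fun i => (hc i).comp continuous_fst)
      ((hc j).comp (continuous_fst.add continuous_snd)) j)
  have h1 : ∀ x, ∫ y in unitCube (κ × Fin 2), pfaffianSlot (fun i => η i x) j (η j (x + y)) =
      pfaffianSlot (fun i => η i x) j (meanForm (η j) (hη j).smooth.continuous) := fun x => by
    simp only [add_comm x]
    rw [setIntegral_unitCube_add (g := fun y => pfaffianSlot (fun i => η i x) j (η j y))
      ((hp j).comp _) x]
    simp only [pfaffianSlot_apply, meanForm_apply]
    rw [integral_finsetSum]
    · simp only [integral_const_mul, integral_mul_const]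
    · exact fun σ _ => ((integrableOn_unitCube
        (((hc j).clm_apply continuous_const).clm_apply continuous_const)).mul_const _).const_mul _
  simp only [h1, setIntegral_pfaffianSlot_add hη hp (hη j) (hp j), pfaffianSlot_self] at hswap
  rw [hswap]
  simp [volume_real_unitCube]

/-- The slots are replaced one at a time. A mean is a constant form, hence again closed and
periodic, so the one-slot lemma keeps applying. -/
theorem setIntegral_pfaffian (hη : ∀ j, IsClosedTwoForm (η j)) (hp : ∀ j, IsUnitPeriodic (η j)) :
    ∫ x in unitCube (κ × Fin 2), pfaffian (fun i => η i x) =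
      pfaffian fun i => meanForm (η i) (hη i).smooth.continuous := by
  have key : ∀ s : Finset κ, ∫ x in unitCube (κ × Fin 2), pfaffian (fun i => η i x) =
      ∫ x in unitCube (κ × Fin 2),
        pfaffian (fun i => if i ∈ s then meanForm (η i) (hη i).smooth.continuous else η i x) := by
    intro s
    induction s using Finset.induction_on with
    | empty => simp
    | insert j s hj ih =>
      rw [ih]
      rw [setIntegral_pfaffianSlot_mean
        (η := fun i x => if i ∈ s then meanForm (η i) (hη i).smooth.continuous else η i x) _ _ j]
      · congr 1
        funext x
        rw [← pfaffian_update]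
        congr 1
        funext i
        by_cases hij : i = j
        · subst hij; simp [hj]
        · simp [hij]
      · intro i
        by_cases hi : i ∈ s
        · simp only [hi, if_true]
          refine isClosedTwoForm_const _ fun u => ?_
          simp [meanForm_apply, (hη i).alt]
        · simpa only [hi, if_false] using hη i
      · intro i
        by_cases hi : i ∈ s
        · simp only [hi, if_true]
          exact fun _ _ => rfl
        · simpa only [hi, if_false] using hp i
  rw [key Finset.univ]
  simp [volume_real_unitCube]
end

/-! ### Vanishing of spherical periods by the rank argument -/

section
variable {m : ℕ} {D : Type*} [TopologicalSpace D] [ChartedSpace (EuclideanSpace ℝ (Fin m)) D]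
  [Group D] [LieGroup (𝓡 m) ∞ D]
variable {E : Type*} [NormedAddCommGroup E] [NormedSpace ℝ E]
variable {k : ℕ} {F : Type*} [TopologicalSpace F] [ChartedSpace (EuclideanSpace ℝ (Fin k)) F]
  [Group F] [LieGroup (𝓡 k) ∞ F]
variable {S : DoubleAlgebra (GroupLieAlgebra (𝓡 m) D)}
  {b : D → LinearMap.BilinForm ℝ (GroupLieAlgebra (𝓡 m) D)}

theorem contMDiff_list_map_prod {κ : Type*} (L : List κ) {G : κ → E → F}
    (hG : ∀ j, ContMDiff 𝓘(ℝ, E) (𝓡 k) ∞ (G j)) :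
    ContMDiff 𝓘(ℝ, E) (𝓡 k) ∞ fun x => (L.map fun j => G j x).prod := by
  induction L with
  | nil => simpa using contMDiff_const
  | cons j L ih =>
    simp only [List.map_cons, List.prod_cons]
    exact (hG j).mul ih

theorem pullTwoForm_comp {E' : Type*} [NormedAddCommGroup E'] [NormedSpace ℝ E'] {Φ : E → D}
    {g : E' → E} {x : E'} (h : MDifferentiableAt 𝓘(ℝ, E) (𝓡 m) Φ (g x))
    (hg : DifferentiableAt ℝ g x) (u v : E') :
    pullTwoForm b (fun y => Φ (g y)) x u v =
      pullTwoForm b Φ (g x) (fderiv ℝ g x u) (fderiv ℝ g x v) := by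
  rw [pullTwoForm_apply, mcForm_comp h hg]
  rfl

theorem pullTwoForm_congr {Φ Ψ : E → D} {x : E} (h : Φ =ᶠ[𝓝 x] Ψ)
    (hΦ : MDifferentiableAt 𝓘(ℝ, E) (𝓡 m) Φ x) : pullTwoForm b Φ x = pullTwoForm b Ψ x := by
  rw [pullTwoForm, pullTwoForm, mcForm_congr h hΦ, h.eq_of_nhds]

theorem pullTwoForm_const (c : D) (x : E) : pullTwoForm b (fun _ : E => c) x = 0 := by
  ext u v
  rw [pullTwoForm_apply, mcForm_const]
  change b c 0 0 = 0
  simp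

/-- The 3-form of the potential restricts to zero on the translates of a subgroup with isotropic
Lie algebra. -/
theorem IsPotential.isClosedTwoForm_pullTwoForm [FiniteDimensional ℝ E] (hb : IsPotential S b)
    {𝔣 : Submodule ℝ (GroupLieAlgebra (𝓡 m) D)} (h𝔣 : ∀ X ∈ 𝔣, ∀ Y ∈ 𝔣, ∀ Z ∈ 𝔣, S.form X ⁅Y, Z⁆ = 0)
    {ι : F →* D} (hι : IsLieSubgroup (m := m) (k := k) ι 𝔣) {f : E → F}
    (hf : ContMDiff 𝓘(ℝ, E) (𝓡 k) ∞ f) (l₀ : D) :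
    IsClosedTwoForm (pullTwoForm b fun x => ι (f x) * l₀) := by
  have hs : ContMDiff 𝓘(ℝ, E) (𝓡 m) ∞ fun x => ι (f x) * l₀ :=
    (hι.smooth.comp hf).mul contMDiff_const
  refine ⟨hb.contDiff_pullTwoForm hs, fun x u => hb.pullTwoForm_self _ x u, fun x u v w => ?_⟩
  rw [hb.fderiv_pullTwoForm hs]
  have h := fun v => mcForm_hom_comp_mem hι (hf.mdifferentiableAt (x := x) (by simp)) v
  simp only [mcForm_mul_const (fun y => ι (f y)) l₀]
  have : formCLM S (mcForm (fun y => ι (f y)) x u) (bracketCLM D (mcForm (fun y => ι (f y)) x v)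
    (mcForm (fun y => ι (f y)) x w)) = 0 := h𝔣 _ (h u) _ (h v) _ (h w)
  rw [this, mul_zero]

/-- A substitute for the vanishing of the second homotopy group of a Lie group: a pulled back
closed 2-form has no periods over a sphere, regarded as a quotient of the 2-torus. -/
theorem IsPotential.setIntegral_unitCube_pullTwoForm (hb : IsPotential S b)
    {𝔣 : Submodule ℝ (GroupLieAlgebra (𝓡 m) D)} (h𝔣 : ∀ X ∈ 𝔣, ∀ Y ∈ 𝔣, ∀ Z ∈ 𝔣, S.form X ⁅Y, Z⁆ = 0)
    {ι : F →* D} (hι : IsLieSubgroup (m := m) (k := k) ι 𝔣) {g : (Fin 2 → ℝ) → F}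
    (hg : ContMDiff 𝓘(ℝ, Fin 2 → ℝ) (𝓡 k) ∞ g) (hp : IsUnitPeriodic g)
    (h1 : ∀ y i, y i = 0 → g y = 1) (l₀ : D) :
    ∫ y in unitCube (Fin 2), pullTwoForm b (fun y => ι (g y) * l₀) y (stdVec 0) (stdVec 1) = 0 := by
  -- With more blocks than the dimension `m` of the group, the pulled back form is too degenerate
  -- for its Pfaffian to be nonzero.
  let κ := Fin (m + 1)
  let p : (κ × Fin 2 → ℝ) → F := fun x =>
    ((List.finRange (m + 1)).map fun j => g fun s => x (j, s)).prod
  have hps : ContMDiff 𝓘(ℝ, κ × Fin 2 → ℝ) (𝓡 k) ∞ p := by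
    refine contMDiff_list_map_prod _ fun j => hg.comp ?_
    have : ContDiff ℝ ∞ fun (x : κ × Fin 2 → ℝ) (s : Fin 2) => x (j, s) := by fun_prop
    exact this.contMDiff
  have hpp : IsUnitPeriodic p := fun x i => by
    refine congrArg List.prod (List.map_congr_left fun j _ => ?_)
    obtain ⟨i, s⟩ := i
    by_cases hij : j = i
    · subst hij
      rw [← hp (fun s => x (j, s)) s]
      congr 1
      funext t
      simp [Pi.single_apply]
    · congr 1
      funext t
      simp [hij]
  set Φ : (κ × Fin 2 → ℝ) → D := fun x => ι (p x) * l₀ with hΦ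
  have hΦs : ContMDiff 𝓘(ℝ, κ × Fin 2 → ℝ) (𝓡 m) ∞ Φ :=
    (hι.smooth.comp hps).mul contMDiff_const
  have hη : IsClosedTwoForm (pullTwoForm b Φ) := hb.isClosedTwoForm_pullTwoForm h𝔣 hι hps l₀
  have hηp : IsUnitPeriodic (pullTwoForm b Φ) := fun x i => by
    have e : (fun y => Φ (y + Pi.single i 1)) = Φ := funext fun y => by rw [hΦ]; simp only [hpp y i]
    ext1 u; ext1 v
    have := pullTwoForm_comp (b := b) (g := fun y => y + Pi.single i 1) (x := x)
      (hΦs.mdifferentiableAt (by simp)) (by fun_prop) u v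
    rw [e] at this
    simpa [fderiv_add_const] using this.symm
  have hpf : ∀ x, pfaffian (fun _ : κ => pullTwoForm b Φ x) = 0 := fun x => by
    let B : Vec m →ₗ[ℝ] Vec m →ₗ[ℝ] ℝ := b (Φ x)
    exact pfaffian_eq_zero_of_finrank_lt B (mcForm (m := m) Φ x).toLinearMap
      (by simp [κ]) _ fun u v => rfl
  set M := meanForm _ hη.smooth.continuous with hM
  have hM0 : pfaffian (fun _ : κ => M) = 0 := by
    rw [hM, ← setIntegral_pfaffian (η := fun _ : κ => pullTwoForm b Φ) (fun _ => hη) (fun _ => hηp)]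
    simp only [hpf, integral_zero]
  set c := ∫ y in unitCube (Fin 2), pullTwoForm b (fun y => ι (g y) * l₀) y (stdVec 0) (stdVec 1) with hc
  have hplane : ∀ a a', M (stdVec a) (stdVec a') = ∫ y in unitCube (Fin 2),
      pullTwoForm b (fun y : Fin 2 → ℝ => Φ (y 0 • stdVec a + y 1 • stdVec a')) y (stdVec 0) (stdVec 1) := by
    intro a a'
    rw [hM, meanForm_apply, hη.setIntegral_unitCube_eq hηp]
    congr 1
    funext y
    let A : (Fin 2 → ℝ) →L[ℝ] (κ × Fin 2 → ℝ) :=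
      (ContinuousLinearMap.proj (R := ℝ) (φ := fun _ : Fin 2 => ℝ) 0).smulRight (stdVec a) +
      (ContinuousLinearMap.proj (R := ℝ) (φ := fun _ : Fin 2 => ℝ) 1).smulRight (stdVec a')
    have := pullTwoForm_comp (b := b) (g := A) (x := y) (hΦs.mdifferentiableAt (by simp))
      A.differentiableAt (stdVec 0) (stdVec 1)
    rw [A.fderiv] at this
    have e0 : A (stdVec 0) = stdVec a := by simp [A, stdVec]
    have e1 : A (stdVec 1) = stdVec a' := by simp [A, stdVec]
    rw [e0, e1] at this
    exact this.symm
  -- In the plane of block `j` every other factor is `g` at the origin, which is 1, so the product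
  -- is `g` itself.
  have hsame : ∀ j, M (stdVec (j, 0)) (stdVec (j, 1)) = c := fun j => by
    rw [hplane, hc]
    congr 1
    funext y
    congr 2
    congr 1
    funext y
    rw [hΦ]
    simp only [p]
    rw [List.prod_map_eq_pow_single j]
    · rw [List.count_eq_one_of_mem (List.nodup_finRange _) (List.mem_finRange j), pow_one]
      congr 3
      funext s
      fin_cases s <;> simp [stdVec]
    · intro i hij _
      exact h1 _ 0 (by simp [stdVec, hij])
  -- In a plane mixing two blocks each factor has a zero coordinate, so the map is constant.
  have hdiff : ∀ a a' : κ × Fin 2, a.1 ≠ a'.1 → M (stdVec a) (stdVec a') = 0 := by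
    rintro ⟨i, s⟩ ⟨j, t⟩ hij
    simp only [ne_eq] at hij
    rw [hplane]
    have e : (fun y : Fin 2 → ℝ => Φ (y 0 • stdVec (i, s) + y 1 • stdVec (j, t))) = fun _ => l₀ := by
      funext y
      rw [hΦ]
      simp only [p]
      rw [List.prod_eq_one, map_one, one_mul]
      intro z hz
      obtain ⟨r, -, rfl⟩ := List.mem_map.1 hz
      by_cases hri : r = i
      · subst hri
        -- In `Fin 2` the index `s + 1` is the other coordinate of the block, which vanishes on this
        -- plane.
        refine h1 _ (s + 1) ?_
        fin_cases s <;> simp [stdVec, hij]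
      · refine h1 _ (t + 1) ?_
        fin_cases t <;> simp [stdVec, hri]
    rw [e]
    simp [pullTwoForm_const]
  have hMalt : ∀ u v, M u v = - M v u := fun u v => by
    rw [hM, meanForm_apply, meanForm_apply, ← integral_neg]
    simp only [← hη.swap]
  refine eq_zero_of_pfaffian_blockSymplectic_eq_zero M c (fun a a' => ?_) hM0
  by_cases h : a.1 = a'.1
  · obtain ⟨j, s⟩ := a
    obtain ⟨j', t⟩ := a'
    obtain rfl : j = j' := h
    fin_cases s <;> fin_cases t
    · have := hMalt (stdVec (j, 0)) (stdVec (j, 0))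
      simp [blockSymplectic]
      linarith
    · simpa [blockSymplectic] using hsame j
    · have := hMalt (stdVec (j, 1)) (stdVec (j, 0))
      rw [hsame] at this
      simpa [blockSymplectic] using this
    · have := hMalt (stdVec (j, 1)) (stdVec (j, 1))
      simp [blockSymplectic]
      linarith
  · rw [hdiff _ _ h, blockSymplectic, if_neg h, mul_zero]
end

/-! ### From compactly supported maps on the plane to periodic ones -/

section
variable {m : ℕ} {D : Type*} [TopologicalSpace D] [ChartedSpace (EuclideanSpace ℝ (Fin m)) D]
  [Group D] [LieGroup (𝓡 m) ∞ D]
variable {k : ℕ} {F : Type*} [TopologicalSpace F] [ChartedSpace (EuclideanSpace ℝ (Fin k)) F]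
  [Group F] [LieGroup (𝓡 k) ∞ F]
variable {S : DoubleAlgebra (GroupLieAlgebra (𝓡 m) D)}
  {b : D → LinearMap.BilinForm ℝ (GroupLieAlgebra (𝓡 m) D)}

/-- The periodic extension of a function on the unit cube. -/
def periodicExtension {ι β : Type*} (g : (ι → ℝ) → β) (y : ι → ℝ) : β := g fun i => Int.fract (y i)

theorem isUnitPeriodic_periodicExtension {ι β : Type*} [DecidableEq ι] (g : (ι → ℝ) → β) :
    IsUnitPeriodic (periodicExtension g) := fun x i => by
  unfold periodicExtension
  congr 1
  funext j
  by_cases h : j = i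
  · subst h; simp
  · simp [h]

/-- For `z` within 1/4 of `y`, either `z - ⌊y⌋` lies in the cube and is its own fractional part, or
some coordinate has crossed a face and both arguments lie in the margin where `g` is constant. Hence
smoothness passes to the extension. -/
theorem periodicExtension_eventuallyEq {ι β : Type*} [Fintype ι] {g : (ι → ℝ) → β} {o : β}
    (h : ∀ y i, y i ∉ Set.Icc (1 / 4 : ℝ) (3 / 4) → g y = o) (y : ι → ℝ) :
    periodicExtension g =ᶠ[𝓝 y] fun z => g fun i => z i - ⌊y i⌋ := by
  filter_upwards [Metric.ball_mem_nhds y (by norm_num : (0 : ℝ) < 1 / 4)] with z hz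
  have hz' : ∀ i, |z i - y i| < 1 / 4 := fun i => (dist_pi_lt_iff (by norm_num)).1 hz i
  have hw : ∀ i, -(1 / 4) < z i - ⌊y i⌋ ∧ z i - ⌊y i⌋ < 5 / 4 := fun i => by
    have h1 := abs_lt.1 (hz' i)
    have h2 := Int.floor_le (y i)
    have h3 := Int.lt_floor_add_one (y i)
    constructor <;> linarith [h1.1, h1.2]
  have hf : ∀ i, Int.fract (z i) = Int.fract (z i - ⌊y i⌋) := fun i => by simp
  unfold periodicExtension
  by_cases hall : ∀ i, z i - ⌊y i⌋ ∈ Set.Ico (0 : ℝ) 1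
  · congr 1
    funext i
    rw [hf, Int.fract_eq_self.2 (hall i)]
  · push Not at hall
    obtain ⟨i, hi⟩ := hall
    rw [Set.mem_Ico, not_and_or, not_le, not_lt] at hi
    obtain ⟨h1, h2⟩ := hw i
    rw [h _ i, h _ i]
    · rintro ⟨h3, h4⟩
      rcases hi with hi | hi <;> linarith
    · rw [hf]
      rintro ⟨h3, h4⟩
      rcases hi with hi | hi
      · have : Int.fract (z i - ⌊y i⌋) = z i - ⌊y i⌋ + 1 := by
          rw [Int.fract_eq_iff]
          exact ⟨by linarith, by linarith, -1, by push_cast; ring⟩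
        linarith
      · have : Int.fract (z i - ⌊y i⌋) = z i - ⌊y i⌋ - 1 := by
          rw [Int.fract_eq_iff]
          exact ⟨by linarith, by linarith, 1, by push_cast; ring⟩
        linarith

theorem IsPotential.setIntegral_unitCube_pullTwoForm_of_eq_one (hb : IsPotential S b)
    {𝔣 : Submodule ℝ (GroupLieAlgebra (𝓡 m) D)} (h𝔣 : ∀ X ∈ 𝔣, ∀ Y ∈ 𝔣, ∀ Z ∈ 𝔣, S.form X ⁅Y, Z⁆ = 0)
    {ι : F →* D} (hι : IsLieSubgroup (m := m) (k := k) ι 𝔣) {g : (Fin 2 → ℝ) → F}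
    (hg : ContMDiff 𝓘(ℝ, Fin 2 → ℝ) (𝓡 k) ∞ g)
    (h1 : ∀ y i, y i ∉ Set.Icc (1 / 4 : ℝ) (3 / 4) → g y = 1) (l₀ : D) :
    ∫ y, pullTwoForm b (fun y => ι (g y) * l₀) y (stdVec 0) (stdVec 1) = 0 := by
  have hev := periodicExtension_eventuallyEq h1
  have hs : ContMDiff 𝓘(ℝ, Fin 2 → ℝ) (𝓡 k) ∞ (periodicExtension g) := fun y => by
    refine ContMDiffAt.congr_of_eventuallyEq ?_ (hev y)
    have : ContDiff ℝ ∞ fun (z : Fin 2 → ℝ) (i : Fin 2) => z i - (⌊y i⌋ : ℝ) := by fun_prop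
    exact (hg.comp this.contMDiff) y
  have key := hb.setIntegral_unitCube_pullTwoForm h𝔣 hι hs (isUnitPeriodic_periodicExtension g)
    (fun y i hy => h1 _ i (by simp [hy])) l₀
  have hgs : ContMDiff 𝓘(ℝ, Fin 2 → ℝ) (𝓡 m) ∞ fun y => ι (g y) * l₀ :=
    (hι.smooth.comp hg).mul contMDiff_const
  rw [← key, ← setIntegral_eq_integral_of_forall_compl_eq_zero (s := unitCube (Fin 2))]
  · refine setIntegral_congr_fun (MeasurableSet.univ_pi fun _ => measurableSet_Ico) fun y hy => ?_
    have : (fun y => ι (g y) * l₀) =ᶠ[𝓝 y] fun y => ι (periodicExtension g y) * l₀ := by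
      filter_upwards [hev y] with z hz
      rw [hz]
      congr 3
      funext i
      have : ⌊y i⌋ = 0 := Int.floor_eq_zero_iff.2 (hy i trivial)
      simp [this]
    simp only [pullTwoForm_congr this (hgs.mdifferentiableAt (by simp))]
  · intro y hy
    have : ∃ i, y i ∉ Set.Icc (1 / 4 : ℝ) (3 / 4) := by
      simp only [unitCube, Set.mem_univ_pi, not_forall] at hy
      obtain ⟨i, hi⟩ := hy
      exact ⟨i, fun h => hi ⟨by linarith [h.1], by linarith [h.2]⟩⟩
    obtain ⟨i, hi⟩ := this
    have : (fun y => ι (g y) * l₀) =ᶠ[𝓝 y] fun _ => l₀ := by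
      have ho : IsOpen {z : Fin 2 → ℝ | z i ∉ Set.Icc (1 / 4 : ℝ) (3 / 4)} :=
        isClosed_Icc.isOpen_compl.preimage (continuous_apply i)
      filter_upwards [ho.mem_nhds hi] with z hz
      rw [h1 z i hz, map_one, one_mul]
    rw [pullTwoForm_congr this (hgs.mdifferentiableAt (by simp)), pullTwoForm_const]
    simp

/-- The integral over the plane of a two-form pulled back along a compactly supported map to a
subgroup vanishes if the two-form restricts to closed forms on the translates of the subgroup. -/
theorem IsPotential.integral_pullTwoForm (hb : IsPotential S b)
    {𝔣 : Submodule ℝ (GroupLieAlgebra (𝓡 m) D)} (h𝔣 : ∀ X ∈ 𝔣, ∀ Y ∈ 𝔣, ∀ Z ∈ 𝔣, S.form X ⁅Y, Z⁆ = 0)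
    {ι : F →* D} (hι : IsLieSubgroup (m := m) (k := k) ι 𝔣) {f : ℝ × ℝ → F}
    (hf : ContMDiff 𝓘(ℝ, ℝ × ℝ) (𝓡 k) ∞ f) (hc : HasCompactMulSupport f) (l₀ : D) :
    ∫ x, pullTwoForm b (fun x => ι (f x) * l₀) x (1, 0) (0, 1) = 0 := by
  obtain ⟨L, hL0, hL⟩ : ∃ L : ℝ, 0 < L ∧ ∀ x, f x ≠ 1 → ‖x‖ ≤ L := by
    obtain ⟨L, hL0, hL⟩ := hc.isCompact.isBounded.exists_pos_norm_le
    exact ⟨L, hL0, fun x hx => hL x (subset_mulTSupport _ hx)⟩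
  -- If `f (T y) ≠ 1` then `r‖A y - p‖ ≤ L`, so `y` is within 1/4 of the centre of the cube, which
  -- leaves the required margin.
  set r := 4 * L with hr
  have hr0 : r ≠ 0 := by positivity
  set p : ℝ × ℝ := (1 / 2, 1 / 2)
  let A : (Fin 2 → ℝ) →L[ℝ] ℝ × ℝ :=
    (ContinuousLinearMap.proj (R := ℝ) (φ := fun _ : Fin 2 => ℝ) 0).prod
      (ContinuousLinearMap.proj (R := ℝ) (φ := fun _ : Fin 2 => ℝ) 1)
  let T : (Fin 2 → ℝ) → ℝ × ℝ := fun y => r • (A y - p)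
  have hT : ∀ y, HasFDerivAt T (r • A) y := fun y => (A.hasFDerivAt.sub_const p).const_smul r
  have hTs : ContDiff ℝ ∞ T := (A.contDiff.sub contDiff_const).const_smul r
  have h1 : ∀ y i, y i ∉ Set.Icc (1 / 4 : ℝ) (3 / 4) → f (T y) = 1 := fun y i hy => by
    by_contra h
    have h2 := hL _ h
    rw [norm_smul, Real.norm_eq_abs, abs_of_pos (by positivity : (0 : ℝ) < r)] at h2
    have h3 : ‖A y - p‖ ≤ 1 / 4 := by
      rw [hr] at h2
      nlinarith
    have h4 : |y i - 1 / 2| ≤ 1 / 4 := by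
      fin_cases i
      · exact (norm_fst_le (A y - p)).trans h3
      · exact (norm_snd_le (A y - p)).trans h3
    have := abs_le.1 h4
    exact hy ⟨by linarith, by linarith⟩
  have key := hb.setIntegral_unitCube_pullTwoForm_of_eq_one h𝔣 hι
    (hf.comp hTs.contMDiff) h1 l₀
  have hfs : ContMDiff 𝓘(ℝ, ℝ × ℝ) (𝓡 m) ∞ fun y => ι (f y) * l₀ :=
    (hι.smooth.comp hf).mul contMDiff_const
  set G : ℝ × ℝ → ℝ := fun x => pullTwoForm b (fun x => ι (f x) * l₀) x (1, 0) (0, 1) with hG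
  have e : ∀ y, pullTwoForm b (fun y => ι ((f ∘ T) y) * l₀) y (stdVec 0) (stdVec 1) =
      r ^ 2 * G (r • (A y - p)) := fun y => by
    have h2 := pullTwoForm_comp (b := b) (g := T) (x := y) (hfs.mdifferentiableAt (by simp))
      (hT y).differentiableAt (stdVec 0) (stdVec 1)
    rw [(hT y).fderiv] at h2
    have e0 : (r • A) (stdVec 0) = r • ((1 : ℝ), (0 : ℝ)) := by simp [A, stdVec]
    have e1 : (r • A) (stdVec 1) = r • ((0 : ℝ), (1 : ℝ)) := by simp [A, stdVec]
    rw [e0, e1] at h2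
    refine h2.trans ?_
    rw [map_smul, map_smul, smul_apply, smul_eq_mul, smul_eq_mul, hG]
    ring
  simp only [e] at key
  rw [integral_const_mul, mul_eq_zero, or_iff_right (pow_ne_zero 2 hr0)] at key
  have h2 : ∫ y : Fin 2 → ℝ, G (r • (A y - p)) = ∫ x : ℝ × ℝ, G (r • (x - p)) :=
    (volume_preserving_finTwoArrow ℝ).integral_comp' (fun x => G (r • (x - p)))
  rw [h2, integral_sub_right_eq_self (fun x => G (r • x)), Measure.integral_comp_smul,
    smul_eq_zero] at key
  refine key.resolve_left ?_
  simpa using hr0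
end

/-! ### The gauge 2-form integrates to zero over the plane -/

section
variable {m : ℕ} {D : Type*} [TopologicalSpace D] [ChartedSpace (EuclideanSpace ℝ (Fin m)) D]
  [Group D] [LieGroup (𝓡 m) ∞ D]
variable {E : Type*} [NormedAddCommGroup E] [NormedSpace ℝ E]
variable {k : ℕ} {F : Type*} [TopologicalSpace F] [ChartedSpace (EuclideanSpace ℝ (Fin k)) F]
  [Group F] [LieGroup (𝓡 k) ∞ F]
variable {S : DoubleAlgebra (GroupLieAlgebra (𝓡 m) D)}
  {b : D → LinearMap.BilinForm ℝ (GroupLieAlgebra (𝓡 m) D)}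

theorem gaugeTwoForm_comp {E' : Type*} [NormedAddCommGroup E'] [NormedSpace ℝ E'] {h l : E → D}
    {g : E' → E} {x : E'} (hh : ContMDiff 𝓘(ℝ, E) (𝓡 m) ∞ h) (hl : ContMDiff 𝓘(ℝ, E) (𝓡 m) ∞ l)
    (hg : DifferentiableAt ℝ g x) (u v : E') :
    gaugeTwoForm S b (fun y => h (g y)) (fun y => l (g y)) x u v =
      gaugeTwoForm S b h l (g x) (fderiv ℝ g x u) (fderiv ℝ g x v) := by
  have d1 := hh.mdifferentiableAt (x := g x) (by simp)
  have d2 := hl.mdifferentiableAt (x := g x) (by simp)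
  have d3 : MDifferentiableAt 𝓘(ℝ, E) (𝓡 m) (fun y => h y * l y) (g x) :=
    (hh.mul hl).mdifferentiableAt (x := g x) (by simp)
  rw [gaugeTwoForm_apply, gaugeTwoForm_apply, pullTwoForm_comp d2 hg,
    pullTwoForm_comp (Φ := fun y => h y * l y) d3 hg, mcForm_comp d1 hg,
    mcForm_comp (Φ := fun y => h y * l y) d3 hg]
  rfl

theorem gaugeTwoForm_eq_zero {h l : E → D} {x : E} (h1 : h =ᶠ[𝓝 x] fun _ => 1)
    (hh : ContMDiff 𝓘(ℝ, E) (𝓡 m) ∞ h) (hl : ContMDiff 𝓘(ℝ, E) (𝓡 m) ∞ l) :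
    gaugeTwoForm S b h l x = 0 := by
  have e : (fun y => h y * l y) =ᶠ[𝓝 x] l := by
    filter_upwards [h1] with y hy
    rw [hy, one_mul]
  have d3 : MDifferentiableAt 𝓘(ℝ, E) (𝓡 m) (fun y => h y * l y) x :=
    (hh.mul hl).mdifferentiableAt (by simp)
  ext u v
  rw [gaugeTwoForm_apply, pullTwoForm_congr e d3, mcForm_congr h1 (hh.mdifferentiableAt (by simp)),
    mcForm_const]
  simp

theorem gaugeTwoForm_const (h : E → D) (c : D) (x u v : E) :
    gaugeTwoForm S b h (fun _ => c) x u v = pullTwoForm b (fun y => h y * c) x u v := by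
  rw [gaugeTwoForm_apply, mcForm_mul_const, pullTwoForm_const]
  simp

variable [ConnectedSpace F] {𝔣 : Submodule ℝ (GroupLieAlgebra (𝓡 m) D)} {ι : F →* D}

theorem IsPotential.isClosedTwoForm_gaugeTwoForm_hom [FiniteDimensional ℝ E] (hb : IsPotential S b)
    (h𝔣 : ∀ X ∈ 𝔣, ∀ Y ∈ 𝔣, ∀ Z ∈ 𝔣, S.form X ⁅Y, Z⁆ = 0)
    (hι : IsLieSubgroup (m := m) (k := k) ι 𝔣) {f : E → F} (hf : ContMDiff 𝓘(ℝ, E) (𝓡 k) ∞ f)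
    {l : E → D} (hl : ContMDiff 𝓘(ℝ, E) (𝓡 m) ∞ l) :
    IsClosedTwoForm (gaugeTwoForm S b (fun x => ι (f x)) l) := by
  refine isClosedTwoForm_gaugeTwoForm hb (hι.smooth.comp hf) hl (fun x u v w => ?_)
    fun x X Y => formCLM_adCLM S hι.smooth (f x) X Y
  have h := fun v => mcForm_hom_comp_mem hι (hf.mdifferentiableAt (x := x) (by simp)) v
  exact h𝔣 _ (h u) _ (h v) _ (h w)

/-- With `f` fixed, the homotopy `l(tx)` contracts `l` to `l(0)` through a closed form whose support
in the plane stays in that of `f`. At `t = 0` only the pull-back of `b` along `f·l(0)` remains. -/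
theorem IsPotential.integral_gaugeTwoForm (hb : IsPotential S b)
    (h𝔣 : ∀ X ∈ 𝔣, ∀ Y ∈ 𝔣, ∀ Z ∈ 𝔣, S.form X ⁅Y, Z⁆ = 0)
    (hι : IsLieSubgroup (m := m) (k := k) ι 𝔣) {f : ℝ × ℝ → F}
    (hf : ContMDiff 𝓘(ℝ, ℝ × ℝ) (𝓡 k) ∞ f) (hc : HasCompactMulSupport f)
    {l : ℝ × ℝ → D} (hl : ContMDiff 𝓘(ℝ, ℝ × ℝ) (𝓡 m) ∞ l) :
    ∫ x, gaugeTwoForm S b (fun x => ι (f x)) l x (1, 0) (0, 1) = 0 := by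
  let H : ℝ × (ℝ × ℝ) → D := fun p => ι (f p.2)
  let G : ℝ × (ℝ × ℝ) → D := fun p => l (p.1 • p.2)
  have hf2 : ContMDiff 𝓘(ℝ, ℝ × (ℝ × ℝ)) (𝓡 k) ∞ fun p : ℝ × (ℝ × ℝ) => f p.2 :=
    hf.comp (contDiff_snd (𝕜 := ℝ) (E := ℝ) (F := ℝ × ℝ)).contMDiff
  have hH : ContMDiff 𝓘(ℝ, ℝ × (ℝ × ℝ)) (𝓡 m) ∞ H := hι.smooth.comp hf2
  have hG : ContMDiff 𝓘(ℝ, ℝ × (ℝ × ℝ)) (𝓡 m) ∞ G := hl.comp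
    (contDiff_fst.smul contDiff_snd : ContDiff ℝ ∞ fun p : ℝ × (ℝ × ℝ) => p.1 • p.2).contMDiff
  have hcl : IsClosedTwoForm (gaugeTwoForm S b H G) :=
    hb.isClosedTwoForm_gaugeTwoForm_hom h𝔣 hι hf2 hG
  have h0 : ∀ t, ∀ x ∉ mulTSupport f, gaugeTwoForm S b H G (t, x) = 0 := fun t x hx => by
    refine gaugeTwoForm_eq_zero ?_ hH hG
    have : ∀ᶠ p : ℝ × (ℝ × ℝ) in 𝓝 (t, x), f p.2 = 1 :=
      continuous_snd.continuousAt.eventually (notMem_mulTSupport_iff_eventuallyEq.1 hx)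
    filter_upwards [this] with p hp
    simp only [H, hp, map_one]
  have hslice : ∀ t x u v, gaugeTwoForm S b (fun x => ι (f x)) (fun x => l (t • x)) x u v =
      gaugeTwoForm S b H G (t, x) (0, u) (0, v) := fun t x u v => by
    have hd : HasFDerivAt (fun x : ℝ × ℝ => (t, x)) (ContinuousLinearMap.inr ℝ ℝ (ℝ × ℝ)) x :=
      hasFDerivAt_prodMk_right t x
    have := gaugeTwoForm_comp (S := S) (b := b) (x := x) hH hG hd.differentiableAt u v
    rw [hd.fderiv] at this
    exact this
  have key := hcl.integral_eq hc h0
  simp only [← hslice, one_smul, zero_smul, gaugeTwoForm_const] at key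
  rw [key]
  exact hb.integral_pullTwoForm h𝔣 hι hf hc _
end

theorem SameAction.of_sub_eq {W : Set (ℝ × ℝ)} {L L' G : ℝ × ℝ → ℝ} (hG : Integrable G)
    (hW : ∀ x ∉ W, G x = 0) (h0 : ∫ x, G x = 0) (h : ∀ x, L' x = L x + G x) :
    SameAction W L L' := by
  intro hL
  obtain rfl : L' = fun x => L x + G x := funext h
  refine ⟨hL.add hG.integrableOn, ?_⟩
  unfold action
  rw [integral_add hL hG.integrableOn, setIntegral_eq_integral_of_forall_compl_eq_zero hW, h0,
    add_zero]

/-! ### Gauge variation of the fields and densities -/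

namespace DoubleAlgebra.IsDressingPair
variable {𝔡 : Type*} [LieRing 𝔡] [LieAlgebra ℝ 𝔡] {S : DoubleAlgebra 𝔡} [FiniteDimensional ℝ 𝔡]
  {R : S.GHat →ₗ[ℝ] S.G} {A A' : 𝔡 →ₗ[ℝ] 𝔡}

theorem form_add_apply (h : S.IsDressingPair R A A') {P Q X Y : 𝔡} (hP : P ∈ S.fSpace R)
    (hQ : Q ∈ S.fSpace R) :
    S.form (P + A X) (Q + A Y) = S.form X Y + S.form P (A Y) + S.form Q (A X) := by
  rw [map_add, map_add, LinearMap.add_apply, LinearMap.add_apply, S.fSpace_isotropic R hP hQ,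
    S.symm.eq Q, h.form_apply]
  ring

theorem form_sub_apply (h : S.IsDressingPair R A A') {L P Q X : 𝔡} (hL : L ∈ S.fSpace R)
    (hP : P ∈ S.fSpace R) (hQ : Q ∈ S.fSpace R) :
    S.form (A L - P) (Q + A X) = S.form L X - S.form P (A X) := by
  rw [map_add, map_sub, LinearMap.sub_apply, LinearMap.sub_apply, S.fSpace_isotropic R hP hQ,
    S.fSpace_isotropic R (h.mem_fSpace hL) hQ, h.form_apply]
  ring

end DoubleAlgebra.IsDressingPair

section
variable {m k : ℕ} {D : Type*} [TopologicalSpace D] [ChartedSpace (EuclideanSpace ℝ (Fin m)) D]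
  [Group D] [LieGroup (𝓡 m) ∞ D]
  {S : DoubleAlgebra (GroupLieAlgebra (𝓡 m) D)} {R : S.GHat →ₗ[ℝ] S.G}
  {F : Type*} [TopologicalSpace F] [ChartedSpace (EuclideanSpace ℝ (Fin k)) F]
  [Group F] [LieGroup (𝓡 k) ∞ F] {ι : F →* D}

/-- The condition holds for all of `F`, in particular for `f⁻¹`; hence the inverse operator also
preserves `ℛ`. -/
theorem isDressingPair_Ad [ConnectedSpace F] (hι : ContMDiff (𝓡 k) (𝓡 m) ∞ ι)
    (hcond : ∀ f : F, S.DressingCondition R (Ad (ι f))) (f : F) :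
    S.IsDressingPair R (Ad (ι f)) (Ad (ι f⁻¹)) where
  mem _ hX := DoubleAlgebra.DressingCondition.apply_mem_rSpace S (hcond f) hX
  mem_inv _ hX := DoubleAlgebra.DressingCondition.apply_mem_rSpace S (hcond f⁻¹) hX
  apply_inv X := by
    rw [map_inv]
    exact adCLM_apply_inv (ι f) X
  inv_apply X := by
    rw [map_inv]
    exact adCLM_inv_apply (ι f) X
  form_apply X Y := formCLM_adCLM S hι f X Y

theorem maurerCartan_gaugeField {h l : ℝ × ℝ → D} (hh : ContMDiff 𝓘(ℝ, ℝ × ℝ) (𝓡 m) ∞ h)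
    (hl : ContMDiff 𝓘(ℝ, ℝ × ℝ) (𝓡 m) ∞ l) (x v : ℝ × ℝ) :
    maurerCartan (m := m) (gaugeField h l) x v = maurerCartan h x v + Ad (h x) (maurerCartan l x v) :=
  DFunLike.congr_fun (mcForm_mul (hh.mdifferentiableAt (x := x) (by simp))
    (hl.mdifferentiableAt (x := x) (by simp))) v

theorem gaugeTwoForm_apply_maurerCartan {b : D → LinearMap.BilinForm ℝ (GroupLieAlgebra (𝓡 m) D)}
    {h l : ℝ × ℝ → D} (hh : ContMDiff 𝓘(ℝ, ℝ × ℝ) (𝓡 m) ∞ h)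
    (hl : ContMDiff 𝓘(ℝ, ℝ × ℝ) (𝓡 m) ∞ l) (x : ℝ × ℝ) :
    gaugeTwoForm S b h l x (1, 0) (0, 1) =
      b (gaugeField h l x) (dSigma (gaugeField h l) x) (dTau (gaugeField h l) x)
      - b (l x) (dSigma l x) (dTau l x)
      + 6 * (S.form (dSigma h x) (Ad (h x) (dTau l x)) - S.form (dTau h x) (Ad (h x) (dSigma l x))) := by
  have e : ∀ v, mcForm (m := m) (fun y => h y * l y) x v - mcForm h x v = adCLM (h x) (mcForm l x v) :=
    fun v => by
      rw [mcForm_mul (hh.mdifferentiableAt (x := x) (by simp))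
        (hl.mdifferentiableAt (x := x) (by simp))]
      exact add_sub_cancel_left _ _
  rw [gaugeTwoForm_apply, e, e]
  rfl

theorem isWorldSheetField_gauge [ConnectedSpace F] (hι : IsLieSubgroup (m := m) (k := k) ι (S.fSpace R))
    (hcond : ∀ f : F, S.DressingCondition R (Ad (ι f))) {f : ℝ × ℝ → F}
    (hf : ContMDiff 𝓘(ℝ, ℝ × ℝ) (𝓡 k) ∞ f) {l : ℝ × ℝ → D} {Λ : ℝ × ℝ → GroupLieAlgebra (𝓡 m) D}
    (h : IsWorldSheetField S R l Λ) :
    IsWorldSheetField S R (gaugeField (ι ∘ f) l) (gaugeMultiplier (ι ∘ f) Λ) where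
  smooth_l := (hι.smooth.comp hf).mul h.smooth_l
  smooth_Λ := ((contDiff_adCLM (hι.smooth.comp hf)).clm_apply h.smooth_Λ).sub
    ((contDiff_mcForm (hι.smooth.comp hf)).clm_apply contDiff_const)
  mem x := sub_mem ((isDressingPair_Ad hι.smooth hcond (f x)).mem_fSpace (h.mem x))
    (mcForm_hom_comp_mem hι (hf.mdifferentiableAt (x := x) (by simp)) (0, 1))

theorem isConstrained_gauge [ConnectedSpace F] (hι : IsLieSubgroup (m := m) (k := k) ι (S.fSpace R))
    (hcond : ∀ f : F, S.DressingCondition R (Ad (ι f))) {f : ℝ × ℝ → F}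
    (hf : ContMDiff 𝓘(ℝ, ℝ × ℝ) (𝓡 k) ∞ f) {l : ℝ × ℝ → D}
    (hl : ContMDiff 𝓘(ℝ, ℝ × ℝ) (𝓡 m) ∞ l) (h : IsConstrained S R l) :
    IsConstrained S R (gaugeField (ι ∘ f) l) := fun x => by
  rw [dSigma, maurerCartan_gaugeField (hι.smooth.comp hf) hl]
  have h1 : maurerCartan (m := m) (ι ∘ f) x (1, 0) ∈ S.fSpace R :=
    mcForm_hom_comp_mem hι (hf.mdifferentiableAt (x := x) (by simp)) (1, 0)
  exact add_mem (fun Y hY => S.fSpace_isotropic R hY h1)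
    ((isDressingPair_Ad hι.smooth hcond (f x)).mem_fPerp (h x))

/-- The kinetic term contributes `½⟨φ_τ|Ad ∂_σl l⁻¹⟩ + ½⟨φ_σ|Ad ∂_τl l⁻¹⟩`, and the shift of `Λ`
subtracts `⟨φ_τ|Ad ∂_σl l⁻¹⟩`. The antisymmetric remainder has coefficient ½ = 6/12, matching the
1/12 in front of `b`; terms within `ℱ` vanish by isotropy. -/
theorem unconstrainedDensity_gauge [ConnectedSpace F]
    (hι : IsLieSubgroup (m := m) (k := k) ι (S.fSpace R))
    (hcond : ∀ f : F, S.DressingCondition R (Ad (ι f))) {f : ℝ × ℝ → F}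
    (hf : ContMDiff 𝓘(ℝ, ℝ × ℝ) (𝓡 k) ∞ f) {l : ℝ × ℝ → D} {Λ : ℝ × ℝ → GroupLieAlgebra (𝓡 m) D}
    (h : IsWorldSheetField S R l Λ) (b : D → LinearMap.BilinForm ℝ (GroupLieAlgebra (𝓡 m) D))
    (x : ℝ × ℝ) :
    unconstrainedDensity S b (gaugeField (ι ∘ f) l) (gaugeMultiplier (ι ∘ f) Λ) x =
      unconstrainedDensity S b l Λ x + (1 / 12) * gaugeTwoForm S b (ι ∘ f) l x (1, 0) (0, 1) := by
  have hP := isDressingPair_Ad hι.smooth hcond (f x)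
  have hh : ContMDiff 𝓘(ℝ, ℝ × ℝ) (𝓡 m) ∞ (ι ∘ f) := hι.smooth.comp hf
  have hmem : ∀ v, maurerCartan (m := m) (ι ∘ f) x v ∈ S.fSpace R :=
    mcForm_hom_comp_mem hι (hf.mdifferentiableAt (x := x) (by simp))
  have e1 : dSigma (m := m) (gaugeField (ι ∘ f) l) x =
      dSigma (ι ∘ f) x + Ad (ι (f x)) (dSigma l x) := maurerCartan_gaugeField hh h.smooth_l x (1, 0)
  have e2 : dTau (m := m) (gaugeField (ι ∘ f) l) x =
      dTau (ι ∘ f) x + Ad (ι (f x)) (dTau l x) := maurerCartan_gaugeField hh h.smooth_l x (0, 1)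
  have k1 := hP.form_add_apply (X := dTau l x) (Y := dSigma l x) (hmem (0, 1)) (hmem (1, 0))
  have k2 := hP.form_sub_apply (X := dSigma l x) (h.mem x) (hmem (0, 1)) (hmem (1, 0))
  change S.form (dTau (ι ∘ f) x + _) (dSigma (ι ∘ f) x + _) =
    _ + S.form (dTau (ι ∘ f) x) _ + S.form (dSigma (ι ∘ f) x) _ at k1
  change S.form (gaugeMultiplier (ι ∘ f) Λ x) (dSigma (ι ∘ f) x + _) =
    _ - S.form (dTau (ι ∘ f) x) _ at k2
  rw [← e1, ← e2] at k1
  rw [← e1] at k2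
  rw [gaugeTwoForm_apply_maurerCartan hh h.smooth_l]
  simp only [unconstrainedDensity, wzwDensity, Function.comp_apply]
  linarith

/-- On constrained fields the multiplier term is zero before and after the transformation, so its
coefficient, ½ here and 1 in `unconstrainedDensity`, is immaterial. The term `K` is unchanged
because it ignores `ℱ` and is `Ad`-invariant. -/
theorem lagrangian_gauge [ConnectedSpace F]
    (hι : IsLieSubgroup (m := m) (k := k) ι (S.fSpace R))
    (hcond : ∀ f : F, S.DressingCondition R (Ad (ι f))) {f : ℝ × ℝ → F}
    (hf : ContMDiff 𝓘(ℝ, ℝ × ℝ) (𝓡 k) ∞ f) {l : ℝ × ℝ → D} {Λ : ℝ × ℝ → GroupLieAlgebra (𝓡 m) D}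
    (h : IsWorldSheetField S R l Λ) (hc : IsConstrained S R l)
    (b : D → LinearMap.BilinForm ℝ (GroupLieAlgebra (𝓡 m) D)) (x : ℝ × ℝ) :
    lagrangian S R b (gaugeField (ι ∘ f) l) (gaugeMultiplier (ι ∘ f) Λ) x =
      lagrangian S R b l Λ x + (1 / 12) * gaugeTwoForm S b (ι ∘ f) l x (1, 0) (0, 1) := by
  have hΛ : ∀ {l : ℝ × ℝ → D} {Λ : ℝ × ℝ → GroupLieAlgebra (𝓡 m) D}, IsWorldSheetField S R l Λ →
      IsConstrained S R l → S.form (Λ x) (dSigma l x) = 0 := fun h hc => hc x _ (h.mem x)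
  have hlag : ∀ {l : ℝ × ℝ → D} {Λ : ℝ × ℝ → GroupLieAlgebra (𝓡 m) D}, IsWorldSheetField S R l Λ →
      IsConstrained S R l → lagrangian S R b l Λ x =
        unconstrainedDensity S b l Λ x + (1 / 2) * S.K R (dSigma l x) := fun h hc => by
    rw [lagrangian, unconstrainedDensity, hΛ h hc]
    ring
  have hP := isDressingPair_Ad hι.smooth hcond (f x)
  have hK : S.K R (dSigma (gaugeField (ι ∘ f) l) x) = S.K R (dSigma l x) := by
    have e1 : dSigma (m := m) (gaugeField (ι ∘ f) l) x =
        dSigma (ι ∘ f) x + Ad (ι (f x)) (dSigma l x) :=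
      maurerCartan_gaugeField (hι.smooth.comp hf) h.smooth_l x (1, 0)
    rw [e1, S.K_add_of_mem_fSpace R (hP.mem_fPerp (hc x)), hP.K_apply (hc x)]
    exact mcForm_hom_comp_mem hι (hf.mdifferentiableAt (x := x) (by simp)) (1, 0)
  rw [hlag (isWorldSheetField_gauge hι hcond hf h) (isConstrained_gauge hι hcond hf h.smooth_l hc),
    hlag h hc, hK, unconstrainedDensity_gauge hι hcond hf h]
  ring
end

end

theorem theorem3 {n k : ℕ}
    {D : Type*} [TopologicalSpace D] [ChartedSpace (EuclideanSpace ℝ (Fin (2 * n))) D]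
    [Group D] [LieGroup (𝓡 (2 * n)) ∞ D]
    (S : DoubleAlgebra (GroupLieAlgebra (𝓡 (2 * n)) D)) (R : S.GHat →ₗ[ℝ] S.G)
    (hR : LinearMap.ker R = ⊥) (hRs : LinearMap.ker (S.adjoint R) = ⊥)
    (hF : ∀ X ∈ S.fSpace R, ∀ Y ∈ S.fSpace R, ⁅X, Y⁆ ∈ S.fSpace R)
    {F : Type*} [TopologicalSpace F] [ChartedSpace (EuclideanSpace ℝ (Fin k)) F]
    [Group F] [LieGroup (𝓡 k) ∞ F] [ConnectedSpace F]
    (ι : F →* D) (hι : IsLieSubgroup (m := 2 * n) (k := k) ι (S.fSpace R))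
    (hcond : ∀ f : F, S.DressingCondition R (Ad (ι f))) :
    (∀ f : F, (S.rSpace R).map (Ad (ι f)) = S.rSpace R ∧
      (S.rPerp R).map (Ad (ι f)) = S.rPerp R) ∧
    (∀ f : F, ∀ X ∈ S.fPerp R, Ad (ι f) X ∈ S.fPerp R ∧ S.K R (Ad (ι f) X) = S.K R X) ∧
    (∀ f : ℝ × ℝ → F, ContMDiff 𝓘(ℝ, ℝ × ℝ) (𝓡 k) ∞ f →
      ∀ (l : ℝ × ℝ → D) (Λ : ℝ × ℝ → GroupLieAlgebra (𝓡 (2 * n)) D),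
        IsWorldSheetField S R l Λ →
        IsWorldSheetField S R (gaugeField (ι ∘ f) l) (gaugeMultiplier (ι ∘ f) Λ) ∧
        (IsConstrained S R l → IsConstrained S R (gaugeField (ι ∘ f) l)) ∧
        ∀ b : D → LinearMap.BilinForm ℝ (GroupLieAlgebra (𝓡 (2 * n)) D), IsPotential S b →
        HasCompactMulSupport f →
        ∀ W : Set (ℝ × ℝ), MeasurableSet W → mulTSupport f ⊆ W →
          (IsConstrained S R l →
            SameAction W (lagrangian S R b l Λ)
              (lagrangian S R b (gaugeField (ι ∘ f) l) (gaugeMultiplier (ι ∘ f) Λ))) ∧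
          SameAction W (unconstrainedDensity S b l Λ)
            (unconstrainedDensity S b (gaugeField (ι ∘ f) l) (gaugeMultiplier (ι ∘ f) Λ))) := by
  have hP := isDressingPair_Ad hι.smooth hcond
  -- `ℱ` is isotropic and closed under brackets, so the Wess-Zumino 3-form vanishes on it.
  have h𝔣 : ∀ X ∈ S.fSpace R, ∀ Y ∈ S.fSpace R, ∀ Z ∈ S.fSpace R, S.form X ⁅Y, Z⁆ = 0 :=
    fun X hX Y hY Z hZ => S.fSpace_isotropic R hX (hF Y hY Z hZ)
  refine ⟨fun f => ⟨(hP f).map_rSpace, (hP f).map_rPerp⟩,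
    fun f X hX => ⟨(hP f).mem_fPerp hX, (hP f).K_apply hX⟩, fun f hf l Λ h =>
    ⟨isWorldSheetField_gauge hι hcond hf h, isConstrained_gauge hι hcond hf h.smooth_l,
      fun b hb hc W _ hW => ?_⟩⟩
  set G : ℝ × ℝ → ℝ := fun x =>
    (1 / 12) * gaugeTwoForm S b (ι ∘ f) l x (1, 0) (0, 1) with hG
  have h0 : ∀ x ∉ mulTSupport f, G x = 0 := fun x hx => by
    rw [hG]
    simp only
    rw [gaugeTwoForm_eq_zero _ (hι.smooth.comp hf) h.smooth_l]
    · simp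
    · filter_upwards [notMem_mulTSupport_iff_eventuallyEq.1 hx] with y hy
      simp [hy]
  have hcl := hb.isClosedTwoForm_gaugeTwoForm_hom h𝔣 hι hf h.smooth_l
  have hcont : Continuous G := continuous_const.mul
    ((hcl.smooth.continuous.clm_apply continuous_const).clm_apply continuous_const)
  have hint : Integrable G :=
    hcont.integrable_of_hasCompactSupport (HasCompactSupport.intro hc h0)
  have hzero : ∫ x, G x = 0 := by
    rw [hG, integral_const_mul]
    exact mul_eq_zero_of_right _ (hb.integral_gaugeTwoForm h𝔣 hι hf hc h.smooth_l)
  -- The change of density is supported inside `W`, so its integral over `W` equals that over the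
  -- plane.
  have hGW : ∀ x ∉ W, G x = 0 := fun x hx => h0 x fun hx' => hx (hW hx')
  exact ⟨fun hcs => .of_sub_eq hint hGW hzero (lagrangian_gauge hι hcond hf h hcs b),
    .of_sub_eq hint hGW hzero (unconstrainedDensity_gauge hι hcond hf h b)⟩
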